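/- **Setting.** An instance of correlation clustering on complete graphs is a finite vertex set $V$ in which every pair of distinct vertices is labelled as a positive edge ($E^+$) or a negative edge ($E^-$). The cost of a partition of $V$ into clusters is the number of positive edges with endpoints in different clusters plus the number of negative edges with both endpoints in the same cluster. The standard LP relaxation has a variable $x_{uv}=x_{vu}\in[0,1]$ for every pair $u,v\in V$, the constraints $x_{uu}=0$ and $x_{uw}\le x_{uv}+x_{vw}$ for all $u,v,w\in V$, and it minimizes $$LP(x)=\sum_{(u,v)\in E^+}x_{uv}+\sum_{(u,v)\in E^-}(1-x_{uv}).$$ **Rounding algorithm.** Let $a=0.19$, $b=0.5095$, $f^-(x)=x$, and $$f^+(x)=\begin{cases}0,&x<a,\\ \left(\frac{x-a}{b-a}\right)^2,&a\le x\le b,\\ 1,&x>b.\end{cases}$$ Given a feasible LP solution $x$, put $p_{uw}=f^+(x_{uw})$ if $(u,w)\in E^+$ or $u=w$, and $p_{uw}=f^-(x_{uw})$ if $(u,w)\in E^-$. Start with $V_0=V$. While $V_t\ne\varnothing$: pick a pivot $w\in V_t$ uniformly at random, put every $u\in V_t$ into $S_t$ with probability $1-p_{uw}$ independently, and let $V_{t+1}=V_t\setminus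 S_t$. Output the clusters $S_0,S_1,\dots$ **Theorem.** There is a constant $\varepsilon$ with $0<\varepsilon<0.01$ such that the following two statements hold. 1. For every instance on a finite complete graph and every feasible LP solution $x$, the rounding algorithm outputs a partition of $V$ whose expected cost is at most $(2.06-\varepsilon)\,LP(x)$. In particular, if $x$ is an optimal LP solution, then the expected cost is at most $(2.06-\varepsilon)$ times the cost of every clustering of $V$. 2. There is a deterministic polynomial-time algorithm that, given an instance on a complete graph, outputs a clustering whose cost is at most $(2.06-\varepsilon)\,LP(x)$ for every feasible LP solution $x$, and hence at most $(2.06-\varepsilon)$ times the cost of every clustering. Here polynomial time means that a single program of a unit-cost random access machine with addition and truncated subtraction of natural numbers, given $n=|V|$ and the $n\times n$ $0/1$ adjacency matrix of $E^+$, halts within a number of steps bounded by a polynomial in $n$. -/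

import Mathlib

open unitInterval
open scoped ENNReal NNReal

universe u

noncomputable section

namespace CorrClust

/-! ### Instances, clusterings, and the linear program

An instance on the vertex set `V` is a complete graph whose edges are labelled `+` or `-`. It is
given by the simple graph `G` of its positive edges: the negative edges are the edges of `Gᶜ`. -/

section Problem

variable {V : Type u} [Fintype V] [DecidableEq V]

open scoped Classical in
/-- The number of violated constraints of a clustering: positive edges whose endpoints are not
together plus negative edges whose endpoints are together. Here `together e` says that both
endpoints of the edge `e` lie in the same cluster. -/
def numViolated (G : SimpleGraph V) [DecidableRel G.Adj] (together : Sym2 V → Prop) : ℕ :=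
  (G.edgeFinset.filter fun e => ¬ together e).card + (Gᶜ.edgeFinset.filter fun e => together e).card

/-- Both endpoints of `e` lie in one of the sets of the list `L`. -/
def TogetherInList (L : List (Finset V)) (e : Sym2 V) : Prop :=
  ∃ S ∈ L, ∀ v ∈ e, v ∈ S

/-- Both endpoints of `e` have the same label. (A labelling `c` encodes the clustering into the
classes of vertices with equal labels; every clustering of a finite set arises in this way.) -/
def TogetherInLabels (c : V → ℕ) (e : Sym2 V) : Prop :=
  ∀ u ∈ e, ∀ v ∈ e, c u = c v

/-- The list `L` is a partition of the vertices into disjoint nonempty sets. -/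
def IsClustering (L : List (Finset V)) : Prop :=
  L.Pairwise Disjoint ∧ (∀ S ∈ L, S.Nonempty) ∧ ∀ v, ∃ S ∈ L, v ∈ S

/-- Feasible solutions of the linear program. There is one variable in `[0, 1]` for each
unordered pair of (possibly equal) vertices. -/
structure IsFeasible (x : Sym2 V → I) : Prop where
  diag : ∀ u, x s(u, u) = 0
  triangle : ∀ u v w, (x s(u, w) : ℝ) ≤ x s(u, v) + x s(v, w)

/-- The objective function of the linear program. -/
def lpCost (G : SimpleGraph V) [DecidableRel G.Adj] (x : Sym2 V → I) : ℝ :=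
  ∑ e ∈ G.edgeFinset, (x e : ℝ) + ∑ e ∈ Gᶜ.edgeFinset, (1 - (x e : ℝ))

end Problem

/-! ### The pivot-based rounding algorithm -/

section Rounding

variable {V : Type u} [DecidableEq V]

/-- The random subset of `A` that contains each `u ∈ A` with probability `q u`, independently. -/
def randomSubset (A : Finset V) (q : V → I) : PMF (Finset V) :=
  PMF.ofFinset
    (fun S => if S ⊆ A then
      (((∏ u ∈ S, toNNReal (q u)) * ∏ u ∈ A \ S, toNNReal (σ (q u)) : ℝ≥0) : ℝ≥0∞) else 0)
    A.powerset
    (by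
      have h := Finset.prod_add (fun u => toNNReal (q u)) (fun u => toNNReal (σ (q u))) A
      simp only [toNNReal_add_toNNReal_symm, Finset.prod_const_one] at h
      rw [Finset.sum_congr rfl fun S hS => if_pos (Finset.mem_powerset.mp hS)]
      exact_mod_cast h.symm)
    (fun S hS => if_neg fun h => hS (Finset.mem_powerset.mpr h))

/-- At most `k` iterations of the main loop, started with the set `A` of active vertices and with
cut probabilities `p`: choose a pivot `w ∈ A` uniformly at random, put each `u ∈ A` into the
cluster `S` with probability `1 - p u w` independently, remove `S`, and go on with `A \ S` until
no active vertex is left. The value is the law of the list of clusters. -/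
def pivotLoop (p : V → V → I) : ℕ → Finset V → PMF (List (Finset V))
  | 0, _ => PMF.pure []
  | k + 1, A =>
    if h : A.Nonempty then
      (PMF.uniformOfFinset A h).bind fun w =>
        (randomSubset A fun u => σ (p u w)).bind fun S =>
          (pivotLoop p k (A \ S)).map fun L => S :: L
    else PMF.pure []

/-- The cut probabilities determined by rounding functions `fp` for positive and `fm` for negative
edges. Each vertex carries a positive self-loop. -/
def cutProb (G : SimpleGraph V) [DecidableRel G.Adj] (fp fm : I → I) (x : Sym2 V → I)
    (u w : V) : I :=
  if u = w ∨ G.Adj u w then fp (x s(u, w)) else fm (x s(u, w))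

/-- The law of the output of the rounding algorithm. When the cut probability of every self-loop
is `0`, the pivot always leaves the set of active vertices, so that `|V|` iterations suffice. -/
def pivotRounding [Fintype V] (G : SimpleGraph V) [DecidableRel G.Adj] (fp fm : I → I)
    (x : Sym2 V → I) : PMF (List (Finset V)) :=
  pivotLoop (cutProb G fp fm x) (Fintype.card V) Finset.univ

/-- The expected number of violated constraints of a random clustering. -/
def expectedViolated [Fintype V] (G : SimpleGraph V) [DecidableRel G.Adj]
    (D : PMF (List (Finset V))) : ℝ≥0∞ :=
  ∑' L, D L * (numViolated G (TogetherInList L) : ℝ≥0∞)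

/-- The piecewise quadratic function with parameters `a < b`. -/
def piecewiseQuadratic (a b x : ℝ) : ℝ :=
  if x < a then 0 else if x ≤ b then ((x - a) / (b - a)) ^ 2 else 1

theorem piecewiseQuadratic_mem (a b x : ℝ) : piecewiseQuadratic a b x ∈ Set.Icc (0 : ℝ) 1 := by
  unfold piecewiseQuadratic
  split_ifs with h1 h2
  · simp
  · have h3 : 0 ≤ x - a := by linarith
    have h4 : 0 ≤ b - a := by linarith
    exact ⟨by positivity, pow_le_one₀ (by positivity) (div_le_one_of_le₀ (by linarith) h4)⟩
  · simp

/-- The rounding function for positive edges, with `a = 0.19` and `b = 0.5095`. -/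
def fPlus (x : I) : I := ⟨piecewiseQuadratic 0.19 0.5095 x, piecewiseQuadratic_mem _ _ _⟩

/-- The rounding function for negative edges. -/
def fMinus (x : I) : I := x

end Rounding

/-! ### Deterministic algorithms and their running time

The machine model is the random access machine with unit cost, whose only arithmetic operations
are addition and truncated subtraction of natural numbers, so that numbers grow by at most one bit
per step and time is polynomially related to the time of a Turing machine. Programs are written in
structured form. -/

section Machine

/-- The content of the registers and of the arrays of memory cells. -/
structure Store where
  reg : ℕ → ℕ
  arr : ℕ → ℕ → ℕ

def Store.setReg (s : Store) (r v : ℕ) : Store :=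
  { s with reg := Function.update s.reg r v }

def Store.setArr (s : Store) (k i v : ℕ) : Store :=
  { s with arr := Function.update s.arr k (Function.update (s.arr k) i v) }

/-- Programs. All arguments other than programs are fixed numbers written in the program:
`r`, `a`, `b` name registers, `k` names an array, and `c` is a constant. -/
inductive Program : Type
  /-- Register `r` gets the value `c`. -/
  | const (r c : ℕ)
  /-- Register `r` gets the sum of registers `a` and `b`. -/
  | add (r a b : ℕ)
  /-- Register `r` gets the truncated difference of registers `a` and `b`. -/
  | sub (r a b : ℕ)
  /-- Register `r` gets the content of the cell of array `k` whose index is in register `a`. -/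
  | read (r k a : ℕ)
  /-- The cell of array `k` whose index is in register `a` gets the value of register `b`. -/
  | write (k a b : ℕ)
  | seq (P Q : Program)
  /-- Run `P` if register `r` is nonzero, and `Q` otherwise. -/
  | ite (r : ℕ) (P Q : Program)
  /-- Run `P` as long as register `r` is nonzero. -/
  | while (r : ℕ) (P : Program)

/-- `Runs P s t s'`: the program `P`, started on `s`, halts after exactly `t` steps on `s'`. Each
elementary instruction and each test of a register is one step. -/
inductive Runs : Program → Store → ℕ → Store → Prop
  | const (r c : ℕ) (s : Store) : Runs (.const r c) s 1 (s.setReg r c)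
  | add (r a b : ℕ) (s : Store) : Runs (.add r a b) s 1 (s.setReg r (s.reg a + s.reg b))
  | sub (r a b : ℕ) (s : Store) : Runs (.sub r a b) s 1 (s.setReg r (s.reg a - s.reg b))
  | read (r k a : ℕ) (s : Store) : Runs (.read r k a) s 1 (s.setReg r (s.arr k (s.reg a)))
  | write (k a b : ℕ) (s : Store) : Runs (.write k a b) s 1 (s.setArr k (s.reg a) (s.reg b))
  | seq {P Q : Program} {s s₁ s₂ : Store} {t₁ t₂ : ℕ} :
      Runs P s t₁ s₁ → Runs Q s₁ t₂ s₂ → Runs (.seq P Q) s (t₁ + t₂) s₂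
  | ite_pos {r : ℕ} {P Q : Program} {s s₁ : Store} {t : ℕ} :
      s.reg r ≠ 0 → Runs P s t s₁ → Runs (.ite r P Q) s (t + 1) s₁
  | ite_neg {r : ℕ} {P Q : Program} {s s₁ : Store} {t : ℕ} :
      s.reg r = 0 → Runs Q s t s₁ → Runs (.ite r P Q) s (t + 1) s₁
  | while_stop {r : ℕ} {P : Program} {s : Store} :
      s.reg r = 0 → Runs (.while r P) s 1 s
  | while_step {r : ℕ} {P : Program} {s s₁ s₂ : Store} {t₁ t₂ : ℕ} :
      s.reg r ≠ 0 → Runs P s t₁ s₁ → Runs (.while r P) s₁ t₂ s₂ →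
        Runs (.while r P) s (t₁ + t₂ + 1) s₂

open scoped Classical in
/-- The input: register `0` holds the number `n` of vertices, and array `0` holds the adjacency
matrix of the positive edges row by row. Everything else is `0`. -/
def inputStore {n : ℕ} (G : SimpleGraph (Fin n)) : Store where
  reg r := if r = 0 then n else 0
  arr k i := if k = 0 ∧ ∃ u v : Fin n, G.Adj u v ∧ i = u * n + v then 1 else 0

/-- The output: array `1` holds the labels of the clusters of the vertices. -/
def outputLabels (n : ℕ) (s : Store) (v : Fin n) : ℕ := s.arr 1 v

end Machine

end CorrClust

end

open CorrClust

/-!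
The randomized algorithm is analysed with the ratio `2.0599`; the deterministic one has the ratio
`2.05995`, so `ε = 0.00005` serves for both.

*Randomized rounding.* For a set `A` of active vertices, a pivot and a vector of cut probabilities,
`stepSlack` is the expected cost of the next step minus `2.0599` times the part of the objective
function that the step removes. It suffices that its sum over all pivots in `A` is at most `0`
(`sum_stepSlack_nonpos`); the bound on the expected cost follows by induction on the number of steps
(`expected_pairViolated_le`). The sum over pivots is a sum over triples of vertices, and each triple
contributes at most `0` (`tripleTerm_add_le`). This is an inequality in the three edge lengths for
each of the sign patterns of a triangle: `slackPPP_nonneg`, `slackPPN_nonneg`, `slackPNN_nonneg` and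
`slackNNN_nonneg`. For three positive edges, the slack is concave in a parameter of the longest edge,
and for two positive edges it is affine in the length of the negative edge. This leaves the
degenerate triangles and the triangles at the break points of the rounding function, where
polynomial inequalities in one or two variables remain.

*The linear program.* The machine has no division, so the linear program is solved approximately
with integers. Violations of the triangle inequality are penalized with weight `n ^ 2`; the penalty
is exact, because adding the total violation to all off-diagonal entries restores the triangle
inequality at no higher cost (`linearPart_repair_le`). The projected subgradient method with step
size `1` on matrices of integers in `[0, lpScale n]`, for `lpRounds n` rounds, gives a feasible
solution that is optimal up to `1 / 50000` (`lpCost_lpSolution_le`), and all numbers stay polynomial.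

*Derandomization.* For every pivot, `stepSlack` is affine in each cut probability
(`stepSlack_update`), so the probabilities can be rounded to `0` or `1` one after the other without
increasing it. Some pivot then has a cluster that pays for itself (`exists_isGood`), and repeating
this costs at most `2.0599` times the value of the approximate solution (`RoundInv.cost_le`). If the
optimum of the linear program is at least `1`, then the additive error is absorbed by the larger
ratio. If it is less than `1`, then adjacency is transitive, the optimum is `0`, and the cost, an
integer less than `1`, is `0` as well (`RoundInv.ratio`).

*Running time.* Arithmetic expressions with bounded sums are compiled to programs whose running time
is polynomial in a bound on the memory (`Expr.compile_spec`). The algorithm consists of loops that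
fill matrices with the values of such expressions; `memBound` bounds its memory, and
`mainProgram_spec` is the resulting statement about the whole program.
-/

set_option linter.unusedSectionVars false

noncomputable section

namespace CorrClust

/-! ### The inequality for triangles with three positive edges -/

/-- `2.0599 · LP - ALG` for a triangle with three positive edges of lengths `x, y, z` and cut
probabilities `p, q, r`, summed over the three choices of the pivot. -/
def slackPPP (x y z p q r : ℝ) : ℝ :=
  2.0599 * (x * (1 - q * r) + y * (1 - p * r) + z * (1 - p * q))
    - ((q + r - 2 * q * r) + (p + r - 2 * p * r) + (p + q - 2 * p * q))

/-- `2.0599 · LP - ALG` for a triangle with two positive edges of lengths `x, y` and a negative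
edge of length `z`. -/
def slackPPN (x y z p q : ℝ) : ℝ :=
  2.0599 * (x * (1 - q * z) + y * (1 - p * z) + (1 - z) * (1 - p * q))
    - ((q + z - 2 * q * z) + (p + z - 2 * p * z) + (1 - p) * (1 - q))

theorem piecewiseQuadratic_cases (x : ℝ) :
    (x < 0.19 ∧ piecewiseQuadratic 0.19 0.5095 x = 0) ∨
    (∃ t : ℝ, 0 ≤ t ∧ t ≤ 1 ∧ x = 0.19 + 0.3195 * t ∧ piecewiseQuadratic 0.19 0.5095 x = t ^ 2) ∨
    (0.5095 < x ∧ piecewiseQuadratic 0.19 0.5095 x = 1) := by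
  unfold piecewiseQuadratic
  split_ifs with h1 h2
  · exact Or.inl ⟨h1, rfl⟩
  · refine Or.inr (Or.inl ⟨(x - 0.19) / (0.5095 - 0.19), ?_, ?_, ?_, rfl⟩)
    · apply div_nonneg <;> linarith
    · rw [div_le_one (by norm_num)]; linarith
    · ring
  · exact Or.inr (Or.inr ⟨not_le.mp h2, rfl⟩)

/-- The chord of the rounding function through the origin. -/
theorem piecewiseQuadratic_le (x : ℝ) (hx : 0 ≤ x) :
    0.5095 * piecewiseQuadratic 0.19 0.5095 x ≤ x := by
  rcases piecewiseQuadratic_cases x with ⟨_, h⟩ | ⟨t, h0, h1, rfl, h⟩ | ⟨h1, h⟩ <;> rw [h]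
  · linarith
  · nlinarith
  · linarith

/-- The rate at which `slackPPP` decreases in the third cut probability. -/
theorem coeff_nonneg {x y p q : ℝ} (hp : 0 ≤ p) (hq : 0 ≤ q) (hp1 : p ≤ 1) (hq1 : q ≤ 1)
    (hpx : 0.5095 * p ≤ x) (hqy : 0.5095 * q ≤ y) :
    0 ≤ 2 - 2 * p - 2 * q + 2.0599 * x * q + 2.0599 * y * p := by
  nlinarith [mul_nonneg (sub_nonneg.2 hp1) (sub_nonneg.2 hq1), mul_nonneg hp hq,
    mul_le_mul_of_nonneg_right hpx hq, mul_le_mul_of_nonneg_right hqy hp]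

/-- A shortest edge that is never cut. -/
theorem slackPPP_of_zero {x y z : ℝ} (hy : 0 ≤ y) (hyz : y ≤ z)
    (hz : z ≤ x + y) :
    0 ≤ slackPPP x y z 0 (piecewiseQuadratic 0.19 0.5095 y)
      (piecewiseQuadratic 0.19 0.5095 z) := by
  have hq := piecewiseQuadratic_mem 0.19 0.5095 y
  have hr := piecewiseQuadratic_mem 0.19 0.5095 z
  have hrz := piecewiseQuadratic_le z (hy.trans hyz)
  set q := piecewiseQuadratic 0.19 0.5095 y with hqdef
  set r := piecewiseQuadratic 0.19 0.5095 z with hrdef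
  obtain ⟨hq0, hq1⟩ := hq
  obtain ⟨hr0, hr1⟩ := hr
  have hqr : q * r ≤ 1 := mul_le_one₀ hq1 hr0 hr1
  -- the slack increases with `x`, and `x ≥ z - y`
  suffices h : 0 ≤ 2 * 2.0599 * z - 2.0599 * (q * r) * (z - y) - 2 * (q + r) + 2 * (q * r) by
    have := mul_nonneg (sub_nonneg.2 hqr) (show 0 ≤ x - (z - y) by linarith)
    unfold slackPPP
    nlinarith
  rcases piecewiseQuadratic_cases y with ⟨_, h⟩ | ⟨s, hs0, hs1, hys, h⟩ | ⟨hyb, h⟩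
  · have h0 : q = 0 := h
    rw [h0]; nlinarith
  · have h0 : q = s ^ 2 := h
    -- the value at `z = 0.5095`
    have hend : 0 ≤ 2 * 2.0599 * 0.5095 - 2 - 2.0599 * q * (0.5095 - y) := by
      rw [h0, hys]
      nlinarith [mul_nonneg (show 0 ≤ s + 1 / 3 by linarith) (sq_nonneg (s - 2 / 3))]
    rcases piecewiseQuadratic_cases z with ⟨hza, h'⟩ | ⟨w, hw0, hw1, hzw, h'⟩ | ⟨hzb, h'⟩
    · linarith
    · have h1 : r = w ^ 2 := h'
      have hsw : s ≤ w := by linarith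
      have hstart : 0 ≤ 2 * 2.0599 * y - 4 * s ^ 2 + 2 * s ^ 4 := by
        rw [hys]
        rcases le_total s (3 / 4) with hc | hc
        · nlinarith [mul_nonneg hs0 (sub_nonneg.2 hc), sq_nonneg (s ^ 2), sq_nonneg (s - 1),
            mul_nonneg (mul_nonneg hs0 hs0) (sub_nonneg.2 hc), sq_nonneg (s ^ 2 - 1 / 2)]
        · nlinarith [mul_nonneg (sub_nonneg.2 hs1) (sub_nonneg.2 hc), sq_nonneg (s ^ 2 - 82 / 100),
            mul_nonneg (mul_nonneg (sub_nonneg.2 hs1) (sub_nonneg.2 hc)) hs0,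
            sq_nonneg (s - 9 / 10)]
      -- concavity in `w`, after replacing `r` by `1` in the product `r (z - y)`
      have hlow : 2 * 2.0599 * z - 2.0599 * q * (z - y) - 2 * (q + r) + 2 * (q * r) ≤
          2 * 2.0599 * z - 2.0599 * (q * r) * (z - y) - 2 * (q + r) + 2 * (q * r) := by
        have : q * r * (z - y) ≤ q * (z - y) :=
          mul_le_mul_of_nonneg_right (mul_le_of_le_one_right hq0 hr1) (by linarith)
        linarith
      refine le_trans ?_ hlow
      rcases hs1.eq_or_lt with hs | hs
      · have hw : w = 1 := by linarith
        rw [hs] at h0 hys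
        rw [hw] at h1 hzw
        rw [h0, h1, hzw, hys]; norm_num
      · have key : (1 - s) * (2 * 2.0599 * z - 2.0599 * q * (z - y) - 2 * (q + r) + 2 * (q * r)) =
            (1 - w) * (2 * 2.0599 * y - 4 * s ^ 2 + 2 * s ^ 4)
            + (w - s) * (2 * 2.0599 * 0.5095 - 2 - 2.0599 * q * (0.5095 - y))
            + 2 * (1 - s ^ 2) * ((w - s) * (1 - w) * (1 - s)) := by
          rw [h0, h1, hys, hzw]; ring
        have h2 : 0 ≤ (w - s) * (1 - w) * (1 - s) :=
          mul_nonneg (mul_nonneg (by linarith) (by linarith)) (by linarith)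
        have h3 : 0 ≤ 1 - s ^ 2 := by nlinarith
        have h4 : 0 ≤ (1 - s) *
            (2 * 2.0599 * z - 2.0599 * q * (z - y) - 2 * (q + r) + 2 * (q * r)) := by
          rw [key]
          exact add_nonneg (add_nonneg (mul_nonneg (by linarith) hstart)
            (mul_nonneg (by linarith) hend)) (mul_nonneg (by linarith) h2)
        exact nonneg_of_mul_nonneg_right h4 (by linarith)
    · have h1 : r = 1 := h'
      rw [h1]
      nlinarith [mul_nonneg (show 0 ≤ 2 - q by linarith) (sub_nonneg.2 hzb.le)]
  · have h0 : q = 1 := h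
    have h1 : r = 1 := by
      rcases piecewiseQuadratic_cases z with ⟨_, h'⟩ | ⟨w, _, hw1, hzw, h'⟩ | ⟨_, h'⟩
      · linarith
      · linarith
      · exact h'
    rw [h0, h1]; linarith

/-- The longest edge has length `0.5095`. -/
theorem slackPPP_of_top {t s : ℝ} (ht : 0 ≤ t) (hts : t ≤ s) (hs : s ≤ 1)
    (h : 0.5095 ≤ (0.19 + 0.3195 * t) + (0.19 + 0.3195 * s)) :
    0 ≤ slackPPP (0.19 + 0.3195 * t) (0.19 + 0.3195 * s) 0.5095 (t ^ 2) (s ^ 2) 1 := by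
  have ht1 : t ≤ 1 := hts.trans hs
  have hs0 : 0 ≤ s := ht.trans hts
  rcases le_total 0.3195 (0.19 + 0.3195 * s) with hy | hy
  · -- concavity in `t`: compare with `t = 0` and `t = 1`
    have h0 : 0 ≤ 2.0599 * (0.19 + (0.19 + 0.3195 * s) + 0.5095) - 2 - 2.0599 * 0.19 * s ^ 2 := by
      nlinarith
    have h1 : 0 ≤ (1 - s ^ 2) * (2 * 2.0599 * 0.5095 - 2) :=
      mul_nonneg (by nlinarith) (by norm_num)
    have hc : 0 ≤ 2.0599 * (0.19 + 0.3195 * s) - s ^ 2 * (2 - 2.0599 * 0.5095) := by nlinarith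
    have key : slackPPP (0.19 + 0.3195 * t) (0.19 + 0.3195 * s) 0.5095 (t ^ 2) (s ^ 2) 1 =
        (1 - t) * (2.0599 * (0.19 + (0.19 + 0.3195 * s) + 0.5095) - 2 - 2.0599 * 0.19 * s ^ 2)
        + t * ((1 - s ^ 2) * (2 * 2.0599 * 0.5095 - 2))
        + (2.0599 * (0.19 + 0.3195 * s) - s ^ 2 * (2 - 2.0599 * 0.5095)) * (t * (1 - t)) := by
      unfold slackPPP; ring
    rw [key]
    exact add_nonneg (add_nonneg (mul_nonneg (by linarith) h0) (mul_nonneg ht h1))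
      (mul_nonneg hc (mul_nonneg ht (by linarith)))
  · have hst : s + t ≤ 2 := by linarith
    have h1 : 0 ≤ t * s := mul_nonneg ht hs0
    have h2 : 0 ≤ (t * s) ^ 2 := sq_nonneg _
    have h3 : 0 ≤ t * s * (0.38 - 0.3195 * (s + t)) := mul_nonneg h1 (by linarith)
    have h4 : 0.1295 ≤ 0.3195 * (s + t) := by linarith
    have h5 : 0.3195 * (s + t) ≤ 0.259 := by linarith
    have h6 : 0 ≤ (0.3195 * (s + t) - 0.1295) * (0.259 - 0.3195 * (s + t)) :=
      mul_nonneg (by linarith) (by linarith)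
    unfold slackPPP
    nlinarith

/-- Two longest edges of equal length. -/
theorem slackPPP_of_eq {t s : ℝ} (ht : 0 ≤ t) (hts : t ≤ s) (hs : s ≤ 1) :
    0 ≤ slackPPP (0.19 + 0.3195 * t) (0.19 + 0.3195 * s) (0.19 + 0.3195 * s)
      (t ^ 2) (s ^ 2) (s ^ 2) := by
  have hs0 : 0 ≤ s := ht.trans hts
  have hss : piecewiseQuadratic 0.19 0.5095 (0.19 + 0.3195 * s) = s ^ 2 := by
    unfold piecewiseQuadratic
    rw [if_neg (by linarith), if_pos (by linarith)]
    congr 1; ring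
  have h0 := slackPPP_of_zero (x := 0.19) (y := 0.19 + 0.3195 * s) (z := 0.19 + 0.3195 * s)
    (by linarith) le_rfl (by linarith)
  rw [hss] at h0
  rcases hs0.eq_or_lt with hs' | hs'
  · have : t = 0 := by linarith
    subst this
    simpa using h0
  have h1 : 0 ≤ slackPPP (0.19 + 0.3195 * s) (0.19 + 0.3195 * s) (0.19 + 0.3195 * s)
      (s ^ 2) (s ^ 2) (s ^ 2) := by
    have e : slackPPP (0.19 + 0.3195 * s) (0.19 + 0.3195 * s) (0.19 + 0.3195 * s)
        (s ^ 2) (s ^ 2) (s ^ 2) =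
        3 * (1 - s ^ 2) * (2.0599 * (0.19 + 0.3195 * s) * (1 + s ^ 2) - 2 * s ^ 2) := by
      unfold slackPPP; ring
    rw [e]
    have h2 : s ^ 2 ≤ s := by nlinarith
    refine mul_nonneg (by nlinarith) ?_
    nlinarith [sq_nonneg (s ^ 2 - 0.72), mul_nonneg (sub_nonneg.2 h2) (sq_nonneg s)]
  have hc : 0 ≤ 2 - 4 * s ^ 2 + 2 * 2.0599 * (0.19 + 0.3195 * s) * s ^ 2 := by
    have := coeff_nonneg (x := 0.19 + 0.3195 * s) (y := 0.19 + 0.3195 * s) (p := s ^ 2)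
      (q := s ^ 2) (by positivity) (by positivity) (by nlinarith) (by nlinarith) (by nlinarith)
      (by nlinarith)
    linarith
  have key : s * slackPPP (0.19 + 0.3195 * t) (0.19 + 0.3195 * s) (0.19 + 0.3195 * s)
      (t ^ 2) (s ^ 2) (s ^ 2) =
      (s - t) * slackPPP 0.19 (0.19 + 0.3195 * s) (0.19 + 0.3195 * s) 0 (s ^ 2) (s ^ 2)
      + t * slackPPP (0.19 + 0.3195 * s) (0.19 + 0.3195 * s) (0.19 + 0.3195 * s)
      (s ^ 2) (s ^ 2) (s ^ 2)
      + (2 - 4 * s ^ 2 + 2 * 2.0599 * (0.19 + 0.3195 * s) * s ^ 2) * (s * t * (s - t)) := by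
    unfold slackPPP; ring
  refine nonneg_of_mul_nonneg_right (b := slackPPP _ _ _ _ _ _) (a := s) ?_ hs'
  rw [key]
  exact add_nonneg (add_nonneg (mul_nonneg (by linarith) h0) (mul_nonneg ht h1))
    (mul_nonneg hc (mul_nonneg (by positivity) (by linarith)))

/-- The degenerate triangle whose longest edge is the sum of the others. -/
theorem slackPPP_of_sum {t s w : ℝ} (ht : 0 ≤ t) (hs : 0 ≤ s) (hw : w ≤ 1)
    (h : 0.19 + 0.3195 * w = (0.19 + 0.3195 * t) + (0.19 + 0.3195 * s)) :
    0 ≤ slackPPP (0.19 + 0.3195 * t) (0.19 + 0.3195 * s) (0.19 + 0.3195 * w)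
      (t ^ 2) (s ^ 2) (w ^ 2) := by
  set m := t + s with hm
  have hwm : 0.3195 * w = 0.19 + 0.3195 * m := by linarith
  have hm0 : 0 ≤ m := by positivity
  have hw0 : 0 ≤ w := by linarith
  have hm1 : 0.3195 * m ≤ 0.1295 := by linarith
  have hπ : 0 ≤ t * s := mul_nonneg ht hs
  have hw2 : w ^ 2 ≤ 1 := by nlinarith
  have hz : 0.19 + 0.3195 * w ≤ 0.5095 := by linarith
  -- `p + q ≤ m²` and `x q + y p ≤ 0.19 m²`
  have e1 : t ^ 2 + s ^ 2 ≤ m ^ 2 := by rw [hm]; nlinarith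
  have e2 : (0.19 + 0.3195 * t) * s ^ 2 + (0.19 + 0.3195 * s) * t ^ 2 ≤ 0.19 * m ^ 2 := by
    have : 0 ≤ (t * s) * (0.38 - 0.3195 * m) := mul_nonneg hπ (by linarith)
    rw [hm] at this ⊢; nlinarith
  have e3 : 0 ≤ (t * s) ^ 2 * (2 - 2.0599 * (0.19 + 0.3195 * w)) :=
    mul_nonneg (sq_nonneg _) (by linarith)
  have e4 := mul_le_mul_of_nonneg_right e1 (show 0 ≤ 1 - w ^ 2 by linarith)
  have e5 := mul_le_mul_of_nonneg_right e2 (show 0 ≤ w ^ 2 by positivity)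
  have key : slackPPP (0.19 + 0.3195 * t) (0.19 + 0.3195 * s) (0.19 + 0.3195 * w)
      (t ^ 2) (s ^ 2) (w ^ 2) =
      2 * 2.0599 * (0.19 + 0.3195 * w) - 2 * w ^ 2 - 2 * ((t ^ 2 + s ^ 2) * (1 - w ^ 2))
      - 2.0599 * (((0.19 + 0.3195 * t) * s ^ 2 + (0.19 + 0.3195 * s) * t ^ 2) * w ^ 2)
      + (t * s) ^ 2 * (2 - 2.0599 * (0.19 + 0.3195 * w)) := by
    unfold slackPPP
    linear_combination -2.0599 * h
  rw [key]
  have e6 : m ^ 2 ≤ 0.4054 * m := by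
    have : m * m ≤ 0.4054 * m := mul_le_mul_of_nonneg_right (by linarith) hm0
    linarith [sq m]
  have e7 : m ^ 2 * (1 - w ^ 2) ≤ 0.4054 * m * (1 - w ^ 2) :=
    mul_le_mul_of_nonneg_right e6 (by linarith)
  have e8 : m ^ 2 * w ^ 2 ≤ 0.4054 * m * 1 :=
    mul_le_mul e6 hw2 (by positivity) (by positivity)
  have e9 : m * (1 - w ^ 2) ≤ m * (2 * (1 - w)) :=
    mul_le_mul_of_nonneg_left (by nlinarith [sq_nonneg (1 - w)]) hm0
  have e10 : 0 ≤ m * (1 - w) := mul_nonneg hm0 (by linarith)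
  have e11 : m * (1 - w) = (w - 0.19 / 0.3195) * (1 - w) := by
    congr 1; linarith
  have hw3 : 0.59 ≤ w := by linarith
  have e12 : 0 ≤ (w - 0.59) * (1 - w) := mul_nonneg (by linarith) (by linarith)
  have e13 : 0 ≤ 2 * 2.0599 * (0.19 + 0.3195 * w) - 2 * w ^ 2 - 4 * 0.4054 * (m * (1 - w))
      - 2.0599 * 0.19 * 0.4054 * m := by
    rw [e11]; nlinarith
  linarith

theorem slackPPP_sorted {x y z : ℝ} (hx : 0 ≤ x) (hxy : x ≤ y) (hyz : y ≤ z) (hz : z ≤ x + y) :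
    0 ≤ slackPPP x y z (piecewiseQuadratic 0.19 0.5095 x) (piecewiseQuadratic 0.19 0.5095 y)
      (piecewiseQuadratic 0.19 0.5095 z) := by
  rcases piecewiseQuadratic_cases x with ⟨hxa, h⟩ | ⟨t, ht0, ht1, hxt, h⟩ | ⟨hxb, h⟩
  · rw [h]; exact slackPPP_of_zero (hx.trans hxy) hyz hz
  · rcases piecewiseQuadratic_cases y with ⟨hya, h'⟩ | ⟨s, hs0, hs1, hys, h'⟩ | ⟨hyb, h'⟩
    · linarith
    · have hts : t ≤ s := by linarith
      rcases piecewiseQuadratic_cases z with ⟨hza, h''⟩ | ⟨w, hw0, hw1, hzw, h''⟩ | ⟨hzb, h''⟩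
      · linarith
      · -- concavity in `w`: the upper end `W` is `1` or the degenerate triangle
        rw [h, h', h'']
        obtain ⟨W, hwW, hW⟩ : ∃ W, w ≤ W ∧ 0 ≤ slackPPP (0.19 + 0.3195 * t) (0.19 + 0.3195 * s)
            (0.19 + 0.3195 * W) (t ^ 2) (s ^ 2) (W ^ 2) := by
          rcases le_total 0.5095 (x + y) with hb | hb
          · refine ⟨1, hw1, ?_⟩
            have := slackPPP_of_top ht0 hts hs1 (by linarith)
            norm_num at this ⊢; exact this
          · exact ⟨t + s + 0.19 / 0.3195, by linarith,
              slackPPP_of_sum ht0 hs0 (by linarith) (by ring)⟩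
        have h0 := slackPPP_of_eq ht0 hts hs1
        have hsw : s ≤ w := by linarith
        have hc := coeff_nonneg (x := x) (y := y) (p := t ^ 2) (q := s ^ 2) (by positivity)
          (by positivity) (by nlinarith) (by nlinarith) (by nlinarith) (by nlinarith)
        rw [hxt, hys, hzw] at *
        rcases (hsw.trans hwW).eq_or_lt with he | hlt
        · have : w = s := by linarith
          rw [this]; exact h0
        have key : (W - s) * slackPPP (0.19 + 0.3195 * t) (0.19 + 0.3195 * s)
            (0.19 + 0.3195 * w) (t ^ 2) (s ^ 2) (w ^ 2) =
            (W - w) * slackPPP (0.19 + 0.3195 * t) (0.19 + 0.3195 * s)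
              (0.19 + 0.3195 * s) (t ^ 2) (s ^ 2) (s ^ 2)
            + (w - s) * slackPPP (0.19 + 0.3195 * t) (0.19 + 0.3195 * s)
              (0.19 + 0.3195 * W) (t ^ 2) (s ^ 2) (W ^ 2)
            + (2 - 2 * t ^ 2 - 2 * s ^ 2 + 2.0599 * (0.19 + 0.3195 * t) * s ^ 2
              + 2.0599 * (0.19 + 0.3195 * s) * t ^ 2) * ((w - s) * (W - w) * (W - s)) := by
          unfold slackPPP; ring
        refine nonneg_of_mul_nonneg_right (a := W - s) ?_ (by linarith)
        rw [key]
        exact add_nonneg (add_nonneg (mul_nonneg (by linarith) h0) (mul_nonneg (by linarith) hW))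
          (mul_nonneg hc (mul_nonneg (mul_nonneg (by linarith) (by linarith)) (by linarith)))
      · -- the slack increases with `z` beyond `0.5095`
        rw [h, h', h'']
        rcases le_total 0.5095 (x + y) with hb | hb
        · have h0 := slackPPP_of_top ht0 hts hs1 (by linarith)
          rw [hxt, hys]
          have e : slackPPP (0.19 + 0.3195 * t) (0.19 + 0.3195 * s) z (t ^ 2) (s ^ 2) 1 =
              slackPPP (0.19 + 0.3195 * t) (0.19 + 0.3195 * s) 0.5095 (t ^ 2) (s ^ 2) 1
              + 2.0599 * ((z - 0.5095) * (1 - t ^ 2 * s ^ 2)) := by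
            unfold slackPPP; ring
          rw [e]
          have h1 : t ^ 2 * s ^ 2 ≤ 1 :=
            mul_le_one₀ (by nlinarith) (by positivity) (by nlinarith)
          have := mul_nonneg (sub_nonneg.2 hzb.le) (sub_nonneg.2 h1)
          linarith
        · linarith
    · have hr : piecewiseQuadratic 0.19 0.5095 z = 1 := by
        rcases piecewiseQuadratic_cases z with ⟨_, h'⟩ | ⟨w, _, hw1, hzw, h'⟩ | ⟨_, h'⟩
        · linarith
        · linarith
        · exact h'
      rw [h, h', hr]
      have e : slackPPP x y z (t ^ 2) 1 1 = (1 - t ^ 2) * (2.0599 * (y + z) - 2) := by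
        unfold slackPPP; ring
      rw [e]
      exact mul_nonneg (by nlinarith) (by linarith)
  · have hq : piecewiseQuadratic 0.19 0.5095 y = 1 := by
      rcases piecewiseQuadratic_cases y with ⟨_, h'⟩ | ⟨w, _, hw1, hzw, h'⟩ | ⟨_, h'⟩
      · linarith
      · linarith
      · exact h'
    have hr : piecewiseQuadratic 0.19 0.5095 z = 1 := by
      rcases piecewiseQuadratic_cases z with ⟨_, h'⟩ | ⟨w, _, hw1, hzw, h'⟩ | ⟨_, h'⟩
      · linarith
      · linarith
      · exact h'
    rw [h, hq, hr]
    unfold slackPPP; norm_num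

theorem slackPPP_nonneg {x y z : ℝ} (hx : 0 ≤ x) (hy : 0 ≤ y) (hz : 0 ≤ z) (hxy : z ≤ x + y)
    (hyz : x ≤ y + z) (hxz : y ≤ x + z) :
    0 ≤ slackPPP x y z (piecewiseQuadratic 0.19 0.5095 x) (piecewiseQuadratic 0.19 0.5095 y)
      (piecewiseQuadratic 0.19 0.5095 z) := by
  have s1 : ∀ x y z p q r, slackPPP x y z p q r = slackPPP y x z q p r := by
    intros; unfold slackPPP; ring
  have s2 : ∀ x y z p q r, slackPPP x y z p q r = slackPPP x z y p r q := by
    intros; unfold slackPPP; ring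
  rcases le_total x y with h1 | h1 <;> rcases le_total y z with h2 | h2 <;>
    rcases le_total x z with h3 | h3
  · exact slackPPP_sorted hx h1 h2 hxy
  · exact slackPPP_sorted hx h1 h2 hxy
  · rw [s2]; exact slackPPP_sorted hx h3 h2 hxz
  · rw [s2, s1]; exact slackPPP_sorted hz h3 h1 (by linarith)
  · rw [s1]; exact slackPPP_sorted hy h1 h3 (by linarith)
  · rw [s1, s2]; exact slackPPP_sorted hy h2 h3 (by linarith)
  · rw [s1, s2, s1]; exact slackPPP_sorted hz h2 h1 (by linarith)
  · rw [s1, s2, s1]; exact slackPPP_sorted hz h2 h1 (by linarith)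

/-! ### The inequality for triangles with negative edges -/

theorem slackPPN_comm (x y z p q : ℝ) : slackPPN x y z p q = slackPPN y x z q p := by
  unfold slackPPN; ring

theorem concave_quadratic_nonneg {A B κ l u x : ℝ} (hκ : 0 ≤ κ) (hl : l ≤ x) (hu : x ≤ u)
    (h0 : 0 ≤ A + B * l - κ * l ^ 2) (h1 : 0 ≤ A + B * u - κ * u ^ 2) :
    0 ≤ A + B * x - κ * x ^ 2 := by
  rcases (hl.trans hu).eq_or_lt with h | h
  · have : x = l := by linarith
    rw [this]; exact h0
  refine nonneg_of_mul_nonneg_right (a := u - l) ?_ (by linarith)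
  have key : (u - l) * (A + B * x - κ * x ^ 2) = (u - x) * (A + B * l - κ * l ^ 2)
      + (x - l) * (A + B * u - κ * u ^ 2) + κ * ((x - l) * (u - x) * (u - l)) := by ring
  rw [key]
  exact add_nonneg (add_nonneg (mul_nonneg (by linarith) h0) (mul_nonneg (by linarith) h1))
    (mul_nonneg hκ (mul_nonneg (mul_nonneg (by linarith) (by linarith)) (by linarith)))

/-- A negative edge of length `1`. -/
theorem slackPPN_of_one {x y : ℝ} (hxy : x ≤ y) (h : 1 ≤ x + y) :
    0 ≤ slackPPN x y 1 (piecewiseQuadratic 0.19 0.5095 x) (piecewiseQuadratic 0.19 0.5095 y) := by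
  have hp := piecewiseQuadratic_mem 0.19 0.5095 x
  rcases piecewiseQuadratic_cases y with ⟨hya, h'⟩ | ⟨s, hs0, hs1, hys, h'⟩ | ⟨hyb, h'⟩
  · linarith
  · rcases piecewiseQuadratic_cases x with ⟨hxa, h''⟩ | ⟨t, ht0, ht1, hxt, h''⟩ | ⟨hxb, h''⟩
    · linarith
    · rw [h', h'', hys, hxt]
      -- in terms of the distances `g, k` of `t, s` from `1`, whose sum `τ` is small
      obtain ⟨g, rfl⟩ : ∃ g, t = 1 - g := ⟨1 - t, by ring⟩
      obtain ⟨k, rfl⟩ : ∃ k, s = 1 - k := ⟨1 - s, by ring⟩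
      have hg : 0 ≤ g := by linarith
      have hk : 0 ≤ k := by linarith
      set τ := g + k with hτ
      have hτ0 : 0 ≤ τ := by positivity
      have hτ1 : τ ≤ 0.05947 := by linarith
      have hπ0 : 0 ≤ g * k := mul_nonneg hg hk
      have hπ : g * k ≤ τ ^ 2 / 4 := by rw [hτ]; nlinarith [sq_nonneg (g - k)]
      have key : slackPPN (0.19 + 0.3195 * (1 - g)) (0.19 + 0.3195 * (1 - k)) 1
          ((1 - g) ^ 2) ((1 - k) ^ 2) =
          (2.0599 * 0.5095 - 1) * (2 * τ - τ ^ 2)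
          + g * k * (2 * (2.0599 * 0.5095 - 1) - 4 * (2.0599 * 0.3195) - 4
            + (2.0599 * 0.3195 + 2) * τ - g * k) := by
        rw [hτ]; unfold slackPPN; ring
      rw [key]
      have h2 : g * k ≤ 0.001 := by
        have : τ ^ 2 ≤ 0.05947 ^ 2 := pow_le_pow_left₀ hτ0 hτ1 2
        linarith
      have h1 : g * k * (6.601 - 2.658 * τ) ≤ τ ^ 2 / 4 * (6.601 - 2.658 * τ) :=
        mul_le_mul_of_nonneg_right hπ (by linarith)
      have h3 : 0 ≤ 2 * (2.0599 * 0.5095 - 1) - (2.0599 * 0.5095 - 1) * τ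
          - (6.601 - 2.658 * τ) / 4 * τ := by
        nlinarith [sq_nonneg (τ - 0.0594)]
      have h4 := mul_nonneg hτ0 h3
      have h5 : 0 ≤ g * k * (0.001 - g * k) := mul_nonneg hπ0 (by linarith)
      have h6 : 0 ≤ g * k * τ := mul_nonneg hπ0 hτ0
      linarith
    · linarith
  · rw [h']
    have e : slackPPN x y 1 (piecewiseQuadratic 0.19 0.5095 x) 1 =
        (1 - piecewiseQuadratic 0.19 0.5095 x) * (2.0599 * y - 1) := by
      unfold slackPPN; ring
    rw [e]
    exact mul_nonneg (by linarith [hp.2]) (by linarith)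

/-- The degenerate triangle with two edges of equal length. -/
theorem slackPPN_of_eq {t : ℝ} (ht : 0 ≤ t) (h : 2 * (0.19 + 0.3195 * t) ≤ 1) :
    0 ≤ slackPPN (0.19 + 0.3195 * t) (0.19 + 0.3195 * t) (2 * (0.19 + 0.3195 * t))
      (t ^ 2) (t ^ 2) := by
  -- nonnegative combinations of the products of powers of the distances from the ends
  have bernstein : ∀ l u : ℝ, l ≤ t → t ≤ u → ∀ i j : ℕ, 0 ≤ (t - l) ^ i * (u - t) ^ j :=
    fun l u h1 h2 i j => mul_nonneg (pow_nonneg (by linarith) i) (pow_nonneg (by linarith) j)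
  have e : slackPPN (0.19 + 0.3195 * t) (0.19 + 0.3195 * t) (2 * (0.19 + 0.3195 * t))
      (t ^ 2) (t ^ 2) = 0.2999 - 1.278 * t + 1.22255044 * t ^ 2 + 1.555630164 * t ^ 3
        - 3.1182384279 * t ^ 4 + 1.3162761 * t ^ 5 := by
    unfold slackPPN; ring
  rw [e]
  rcases le_total t (0.31 / 0.639) with hc | hc
  · have B := bernstein 0 (0.31 / 0.639) ht hc
    linarith [B 0 5, B 1 4, B 2 3, B 3 2, B 4 1, B 5 0]
  · have B := bernstein (0.31 / 0.639) (0.31 / 0.3195) hc (by linarith)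
    linarith [B 0 5, B 1 4, B 2 3, B 3 2, B 4 1, B 5 0]

/-- The degenerate triangle with a positive edge of length `0.5095`. -/
theorem slackPPN_of_top {t : ℝ} (ht : 0 ≤ t) (h : (0.19 + 0.3195 * t) + 0.5095 ≤ 1) :
    0 ≤ slackPPN (0.19 + 0.3195 * t) 0.5095 ((0.19 + 0.3195 * t) + 0.5095) (t ^ 2) 1 := by
  have bernstein : ∀ i j : ℕ, 0 ≤ t ^ i * (0.3005 / 0.3195 - t) ^ j :=
    fun i j => mul_nonneg (pow_nonneg ht i) (pow_nonneg (by linarith) j)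
  unfold slackPPN
  linarith [bernstein 0 3, bernstein 1 2, bernstein 2 1, bernstein 3 0]

/-- The degenerate triangle with a positive edge of length at most `0.19`. -/
theorem slackPPN_of_zero {x y : ℝ} (hx : 0 ≤ x) (hxa : x ≤ 0.19) (h : x + y ≤ 1) :
    0 ≤ slackPPN x y (x + y) 0 (piecewiseQuadratic 0.19 0.5095 y) := by
  have e : ∀ q, slackPPN x y (x + y) 0 q = 1.0599 - (x + y) * (2 - q * (2 - 2.0599 * x)) := by
    intro q; unfold slackPPN; ring
  rw [e]
  rcases piecewiseQuadratic_cases y with ⟨hya, h'⟩ | ⟨s, hs0, hs1, hys, h'⟩ | ⟨hyb, h'⟩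
  · rw [h']; linarith
  · rw [h']
    have hs2 : s ^ 2 ≤ 1 := by nlinarith
    have h1 : 2 - s ^ 2 * (2 - 2.0599 * x) ≤ 2 - s ^ 2 * (2 - 2.0599 * 0.19) := by nlinarith
    have h2 : (x + y) * (2 - s ^ 2 * (2 - 2.0599 * x)) ≤
        (0.19 + y) * (2 - s ^ 2 * (2 - 2.0599 * 0.19)) := by
      refine mul_le_mul (by linarith) h1 ?_ (by linarith)
      nlinarith
    have h3 : 0 ≤ 1.0599 - (0.19 + y) * (2 - s ^ 2 * (2 - 2.0599 * 0.19)) := by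
      rw [hys]
      nlinarith [mul_nonneg hs0 (sq_nonneg (s - 0.35)), sq_nonneg (s - 0.35)]
    linarith
  · rw [h']; nlinarith

/-- The degenerate triangle whose longest edge is the negative one. -/
theorem slackPPN_of_sum {x y : ℝ} (hx : 0 ≤ x) (hxy : x ≤ y) (h : x + y ≤ 1) :
    0 ≤ slackPPN x y (x + y) (piecewiseQuadratic 0.19 0.5095 x)
      (piecewiseQuadratic 0.19 0.5095 y) := by
  rcases piecewiseQuadratic_cases x with ⟨hxa, h'⟩ | ⟨t, ht0, ht1, hxt, h'⟩ | ⟨hxb, h'⟩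
  · rw [h']; exact slackPPN_of_zero hx hxa.le h
  · rcases piecewiseQuadratic_cases y with ⟨hya, h''⟩ | ⟨s, hs0, hs1, hys, h''⟩ | ⟨hyb, h''⟩
    · linarith
    · rw [h', h'', hxt, hys]
      have hts : t ≤ s := by linarith
      set τ := t + s with hτ
      have hτ0 : 0 ≤ τ := by positivity
      -- for a fixed sum `τ` the slack is a concave quadratic function of the product of `t` and `s`
      set B := -4 * (0.38 + 0.3195 * τ)
        + 2.0599 * (0.38 + 0.3195 * τ) * (0.38 - 0.3195 * τ) with hB
      set C := 1.0599 - 2 * (0.38 + 0.3195 * τ) + 2 * (0.38 + 0.3195 * τ) * τ ^ 2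
        - 2.0599 * (0.38 + 0.3195 * τ) * (0.19 * τ ^ 2) with hC
      set κ := 1 + 2.0599 * (1 - (0.38 + 0.3195 * τ)) with hκ
      have key : ∀ t' s', t' + s' = τ →
          slackPPN (0.19 + 0.3195 * t') (0.19 + 0.3195 * s')
            (0.19 + 0.3195 * t' + (0.19 + 0.3195 * s')) (t' ^ 2) (s' ^ 2) =
            C + B * (t' * s') - κ * (t' * s') ^ 2 := by
        intro t' s' h
        rw [hκ, hB, hC, ← h]; unfold slackPPN; ring
      rw [key t s hτ.symm]
      have hu : 0 ≤ C + B * (τ / 2 * (τ / 2)) - κ * (τ / 2 * (τ / 2)) ^ 2 := by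
        rw [← key _ _ (by ring), ← two_mul]
        exact slackPPN_of_eq (by positivity) (by linarith)
      have hκ0 : 0 ≤ κ := by rw [hκ]; linarith
      have hsq : t * s ≤ τ / 2 * (τ / 2) := by rw [hτ]; nlinarith [sq_nonneg (t - s)]
      rcases le_total τ 1 with h1 | h1
      · refine concave_quadratic_nonneg hκ0 (mul_nonneg ht0 hs0) hsq (l := 0) ?_ hu
        have := key 0 τ (by ring)
        rw [zero_mul] at this
        rw [← this]
        have h3 := slackPPN_of_zero (x := 0.19) (y := 0.19 + 0.3195 * τ) (by norm_num) le_rfl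
          (by linarith)
        have h4 : piecewiseQuadratic 0.19 0.5095 (0.19 + 0.3195 * τ) = τ ^ 2 := by
          unfold piecewiseQuadratic
          rw [if_neg (by linarith), if_pos (by linarith)]
          congr 1; ring
        rw [h4] at h3
        simpa using h3
      · refine concave_quadratic_nonneg hκ0 (l := (τ - 1) * 1) ?_ hsq ?_ hu
        · nlinarith [mul_nonneg (sub_nonneg.2 ht1) (sub_nonneg.2 hs1)]
        · rw [← key (τ - 1) 1 (by ring)]
          have := slackPPN_of_top (t := τ - 1) (by linarith) (by linarith)
          norm_num at this ⊢
          exact this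
    · rw [h', h'']
      -- concavity in `y`: compare with `y = 0.5095` and `y = 1 - x`
      have h0 := slackPPN_of_top ht0 (by linarith)
      have h1 := slackPPN_of_one (x := x) (y := 1 - x) (by linarith) (by linarith)
      have h2 : piecewiseQuadratic 0.19 0.5095 (1 - x) = 1 := by
        unfold piecewiseQuadratic
        rw [if_neg (by linarith), if_neg (by linarith)]
      rw [h', h2] at h1
      rw [← hxt] at h0
      have key : (1 - x - 0.5095) * slackPPN x y (x + y) (t ^ 2) 1 =
          (1 - x - y) * slackPPN x 0.5095 (x + 0.5095) (t ^ 2) 1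
          + (y - 0.5095) * slackPPN x (1 - x) 1 (t ^ 2) 1
          + 2.0599 * t ^ 2 * ((y - 0.5095) * (1 - x - y) * (1 - x - 0.5095)) := by
        unfold slackPPN; ring
      refine nonneg_of_mul_nonneg_right (a := 1 - x - 0.5095) ?_ (by linarith)
      rw [key]
      exact add_nonneg (add_nonneg (mul_nonneg (by linarith) h0) (mul_nonneg (by linarith) h1))
        (mul_nonneg (by positivity)
          (mul_nonneg (mul_nonneg (by linarith) (by linarith)) (by linarith)))
  · linarith

theorem slackPPN_nonneg {x y z : ℝ} (hx : 0 ≤ x) (hy : 0 ≤ y) (hz : 0 ≤ z) (hz1 : z ≤ 1)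
    (h : z ≤ x + y) :
    0 ≤ slackPPN x y z (piecewiseQuadratic 0.19 0.5095 x)
      (piecewiseQuadratic 0.19 0.5095 y) := by
  wlog hxy : x ≤ y generalizing x y with H
  · rw [slackPPN_comm]; exact H hy hx (by linarith) (by linarith)
  have hp := piecewiseQuadratic_mem 0.19 0.5095 x
  have hq := piecewiseQuadratic_mem 0.19 0.5095 y
  have hpx := piecewiseQuadratic_le x hx
  have hqy := piecewiseQuadratic_le y hy
  obtain ⟨Z, hzZ, hZ⟩ : ∃ Z, z ≤ Z ∧ 0 ≤ slackPPN x y Z (piecewiseQuadratic 0.19 0.5095 x)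
      (piecewiseQuadratic 0.19 0.5095 y) := by
    rcases le_total 1 (x + y) with h1 | h1
    · exact ⟨1, hz1, slackPPN_of_one hxy h1⟩
    · exact ⟨x + y, h, slackPPN_of_sum hx hxy h1⟩
  set p := piecewiseQuadratic 0.19 0.5095 x
  set q := piecewiseQuadratic 0.19 0.5095 y
  have h0 : 0 ≤ slackPPN x y 0 p q := by
    have h1 : p * q ≤ p := mul_le_of_le_one_right hp.1 hq.2
    have h2 : p * q ≤ q := mul_le_of_le_one_left hq.1 hp.2
    unfold slackPPN
    nlinarith [hp.2, hq.2]
  rcases (hz.trans hzZ).eq_or_lt with hZ0 | hZ0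
  · have : z = 0 := by linarith
    rw [this]; exact h0
  have key : Z * slackPPN x y z p q = (Z - z) * slackPPN x y 0 p q + z * slackPPN x y Z p q := by
    unfold slackPPN; ring
  refine nonneg_of_mul_nonneg_right (a := Z) ?_ hZ0
  rw [key]
  exact add_nonneg (mul_nonneg (by linarith) h0) (mul_nonneg hz hZ)

/-- Triangles with a single positive edge. The triangle inequality plays no role. -/
theorem slackPNN_nonneg {x y z p : ℝ} (hy1 : y ≤ 1) (hz1 : z ≤ 1) (hy : 0 ≤ y) (hz : 0 ≤ z)
    (hp : 0 ≤ p) (hp1 : p ≤ 1) (hpx : 0.5095 * p ≤ x) :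
    0 ≤ 2.0599 * (x * (1 - y * z) + (1 - y) * (1 - p * z) + (1 - z) * (1 - p * y))
      - ((y + z - 2 * y * z) + (1 - p) * (1 - z) + (1 - p) * (1 - y)) := by
  obtain ⟨Y, rfl⟩ : ∃ Y, y = 1 - Y := ⟨1 - y, by ring⟩
  obtain ⟨Z, rfl⟩ : ∃ Z, z = 1 - Z := ⟨1 - z, by ring⟩
  have hY : 0 ≤ Y := by linarith
  have hZ : 0 ≤ Z := by linarith
  have h1 : 0 ≤ Y + Z - Y * Z := by nlinarith
  have h2 : 0.5 * p * (Y + Z - Y * Z) ≤ x * (Y + Z - Y * Z) :=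
    mul_le_mul_of_nonneg_right (by linarith) h1
  have h3 : 0 ≤ p * (Y * Z) := mul_nonneg hp (mul_nonneg hY hZ)
  have h4 : 0 ≤ Y * (1 - p * (1 - Z)) := mul_nonneg hY (by nlinarith)
  have h5 : 0 ≤ Z * (1 - p * (1 - Y)) := mul_nonneg hZ (by nlinarith)
  have h6 : 0 ≤ p * (Y + Z - Y * Z) := mul_nonneg hp h1
  nlinarith [mul_nonneg hY hZ]

theorem slackNNN_nonneg {x y z : ℝ} (hx : 0 ≤ x) (hy : 0 ≤ y) (hz : 0 ≤ z)
    (hx1 : x ≤ 1) (hy1 : y ≤ 1) (hz1 : z ≤ 1) :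
    0 ≤ 2.0599 * ((1 - x) * (1 - y * z) + (1 - y) * (1 - x * z) + (1 - z) * (1 - x * y))
      - ((1 - y) * (1 - z) + (1 - x) * (1 - z) + (1 - x) * (1 - y)) := by
  have : ∀ {a b c : ℝ}, 0 ≤ b → 0 ≤ c → a ≤ 1 → b ≤ 1 → c ≤ 1 →
      (1 - a) * ((1 - b) + (1 - c)) / 2 ≤ (1 - a) * (1 - b * c) := fun hb hc ha hb' hc' => by
    rw [mul_div_assoc]
    exact mul_le_mul_of_nonneg_left (by nlinarith) (by linarith)
  have h1 := this hy hz hx1 hy1 hz1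
  have h2 := this hx hz hy1 hx1 hz1
  have h3 := this hx hy hz1 hx1 hy1
  have h4 := mul_nonneg (sub_nonneg.2 hx1) (sub_nonneg.2 hy1)
  have h5 := mul_nonneg (sub_nonneg.2 hx1) (sub_nonneg.2 hz1)
  have h6 := mul_nonneg (sub_nonneg.2 hy1) (sub_nonneg.2 hz1)
  linarith

/-! ### Sums over pairs of vertices -/

section Pairs

variable {V : Type u} [DecidableEq V]

/-- The sum of `f u v` over the ordered pairs of distinct elements of `A`. -/
def pairSum (A : Finset V) (f : V → V → ℝ) : ℝ :=
  ∑ u ∈ A, ∑ v ∈ A, if u = v then 0 else f u v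

theorem pairSum_congr {A : Finset V} {f g : V → V → ℝ}
    (h : ∀ u ∈ A, ∀ v ∈ A, u ≠ v → f u v = g u v) : pairSum A f = pairSum A g := by
  refine Finset.sum_congr rfl fun u hu => Finset.sum_congr rfl fun v hv => ?_
  split_ifs with huv
  · rfl
  · exact h u hu v hv huv

theorem pairSum_add (A : Finset V) (f g : V → V → ℝ) :
    pairSum A (fun u v => f u v + g u v) = pairSum A f + pairSum A g := by
  simp only [pairSum, ← Finset.sum_add_distrib]
  refine Finset.sum_congr rfl fun u _ => Finset.sum_congr rfl fun v _ => ?_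
  split_ifs <;> simp

theorem pairSum_sub (A : Finset V) (f g : V → V → ℝ) :
    pairSum A (fun u v => f u v - g u v) = pairSum A f - pairSum A g := by
  simp only [pairSum, ← Finset.sum_sub_distrib]
  refine Finset.sum_congr rfl fun u _ => Finset.sum_congr rfl fun v _ => ?_
  split_ifs <;> simp

theorem pairSum_mul_left (A : Finset V) (c : ℝ) (f : V → V → ℝ) :
    pairSum A (fun u v => c * f u v) = c * pairSum A f := by
  simp only [pairSum, Finset.mul_sum]
  refine Finset.sum_congr rfl fun u _ => Finset.sum_congr rfl fun v _ => ?_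
  split_ifs <;> simp

theorem pairSum_nonneg {A : Finset V} {f : V → V → ℝ}
    (h : ∀ u ∈ A, ∀ v ∈ A, u ≠ v → 0 ≤ f u v) : 0 ≤ pairSum A f := by
  refine Finset.sum_nonneg fun u hu => Finset.sum_nonneg fun v hv => ?_
  split_ifs with huv
  · exact le_rfl
  · exact h u hu v hv huv

/-- The pairs inside a subset. -/
theorem pairSum_subset {A B : Finset V} (h : B ⊆ A) (f : V → V → ℝ) :
    pairSum B f = pairSum A fun u v => if u ∈ B ∧ v ∈ B then f u v else 0 := by
  unfold pairSum
  rw [← Finset.sum_subset h]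
  · refine Finset.sum_congr rfl fun u hu => ?_
    rw [← Finset.sum_subset h]
    · refine Finset.sum_congr rfl fun v hv => ?_
      simp [hu, hv]
    · intro v _ hv; simp [hv]
  · intro u _ hu; simp [hu]

/-- Every edge is counted twice among the ordered pairs of adjacent vertices. -/
theorem two_mul_sum_edgeFinset [Fintype V] (G : SimpleGraph V) [DecidableRel G.Adj]
    (f : Sym2 V → ℝ) :
    2 * ∑ e ∈ G.edgeFinset, f e = ∑ u, ∑ v, if G.Adj u v then f s(u, v) else 0 := by
  have h1 : ∑ u, ∑ v, (if G.Adj u v then f s(u, v) else 0) =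
      ∑ z ∈ (Finset.univ : Finset (V × V)).filter (fun z => G.Adj z.1 z.2), f s(z.1, z.2) := by
    rw [Finset.sum_filter, ← Finset.univ_product_univ, Finset.sum_product]
  have h2 : ∀ z ∈ (Finset.univ : Finset (V × V)).filter (fun z => G.Adj z.1 z.2),
      s(z.1, z.2) ∈ G.edgeFinset := by
    intro z hz
    simpa using hz
  rw [h1, ← Finset.sum_fiberwise_of_maps_to h2, Finset.mul_sum]
  refine Finset.sum_congr rfl fun e => Sym2.ind (fun a b hab => ?_) e
  have hadj : G.Adj a b := by simpa using hab
  have h3 : ((Finset.univ : Finset (V × V)).filter (fun z => G.Adj z.1 z.2)).filter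
      (fun z => s(z.1, z.2) = s(a, b)) = {(a, b), (b, a)} := by
    ext ⟨c, d⟩
    simp only [Finset.mem_filter, Finset.mem_univ, true_and, Finset.mem_insert,
      Finset.mem_singleton, Prod.mk.injEq, Sym2.eq_iff]
    constructor
    · exact fun h => h.2
    · rintro (⟨rfl, rfl⟩ | ⟨rfl, rfl⟩)
      · exact ⟨hadj, Or.inl ⟨rfl, rfl⟩⟩
      · exact ⟨hadj.symm, Or.inr ⟨rfl, rfl⟩⟩
  rw [h3, Finset.sum_pair]
  · simp only [Sym2.eq_swap (a := b) (b := a)]; ring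
  · intro h
    exact hadj.ne (Prod.mk.inj h).1

variable (G : SimpleGraph V) [DecidableRel G.Adj]

/-- The term of the objective function for the pair `u, v`. -/
def pairLP (x : Sym2 V → I) (u v : V) : ℝ :=
  if G.Adj u v then (x s(u, v) : ℝ) else 1 - (x s(u, v) : ℝ)

/-- The probability that the pair `u, v` is violated in a step that leaves `u` and `v` outside the
cluster with probabilities `a` and `b`, independently. -/
def pairCost (u v : V) (a b : ℝ) : ℝ :=
  if G.Adj u v then a + b - 2 * (a * b) else (1 - a) * (1 - b)

/-- The expected cost of a step minus `2.0599` times the expected contribution to the objective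
function of the pairs that it removes, summed over the ordered pairs in `A`, when each `u ∈ A`
stays outside the cluster with probability `q u`. -/
def stepSlack (x : Sym2 V → I) (A : Finset V) (q : V → ℝ) : ℝ :=
  pairSum A fun u v => pairCost G u v (q u) (q v) - 2.0599 * (pairLP G x u v * (1 - q u * q v))

theorem pairLP_nonneg (x : Sym2 V → I) (u v : V) : 0 ≤ pairLP G x u v := by
  unfold pairLP
  split_ifs
  · exact (x _).2.1
  · exact sub_nonneg.2 (x _).2.2

theorem pairLP_comm (x : Sym2 V → I) (u v : V) : pairLP G x u v = pairLP G x v u := by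
  unfold pairLP
  rw [Sym2.eq_swap]
  simp only [G.adj_comm]

theorem two_mul_lpCost [Fintype V] (x : Sym2 V → I) :
    2 * lpCost G x = pairSum Finset.univ (pairLP G x) := by
  unfold lpCost pairSum
  rw [mul_add, two_mul_sum_edgeFinset G (fun e => (x e : ℝ)),
    two_mul_sum_edgeFinset Gᶜ (fun e => 1 - (x e : ℝ)), ← Finset.sum_add_distrib]
  refine Finset.sum_congr rfl fun u _ => ?_
  rw [← Finset.sum_add_distrib]
  refine Finset.sum_congr rfl fun v _ => ?_
  by_cases h : u = v
  · subst h; simp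
  · by_cases h' : G.Adj u v <;> simp [pairLP, SimpleGraph.compl_adj, h, h']

theorem lpCost_nonneg [Fintype V] (x : Sym2 V → I) : 0 ≤ lpCost G x := by
  have h1 := two_mul_lpCost G x
  have h2 := pairSum_nonneg (A := Finset.univ) (f := pairLP G x)
    fun u _ v _ _ => pairLP_nonneg G x u v
  linarith

open scoped Classical in
/-- The indicator of a violated constraint on the pair `u, v`. -/
def pairViolated (together : Sym2 V → Prop) (u v : V) : ℝ :=
  if G.Adj u v then (if together s(u, v) then 0 else 1) else (if together s(u, v) then 1 else 0)

theorem pairViolated_nonneg (together : Sym2 V → Prop) (u v : V) :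
    0 ≤ pairViolated G together u v := by
  unfold pairViolated
  split_ifs <;> norm_num

theorem two_mul_numViolated [Fintype V] (together : Sym2 V → Prop) :
    2 * (numViolated G together : ℝ) = pairSum Finset.univ (pairViolated G together) := by
  classical
  unfold numViolated pairSum
  rw [Nat.cast_add, Finset.card_filter, Finset.card_filter, Nat.cast_sum, Nat.cast_sum, mul_add,
    two_mul_sum_edgeFinset G, two_mul_sum_edgeFinset Gᶜ, ← Finset.sum_add_distrib]
  refine Finset.sum_congr rfl fun u _ => ?_
  rw [← Finset.sum_add_distrib]
  refine Finset.sum_congr rfl fun v _ => ?_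
  by_cases h : u = v
  · subst h; simp
  · by_cases h' : G.Adj u v <;> by_cases h'' : together s(u, v) <;>
      simp [pairViolated, SimpleGraph.compl_adj, h, h', h'']

/-! ### The expected progress of one step of the rounding algorithm -/

theorem coe_fPlus (x : I) : (fPlus x : ℝ) = piecewiseQuadratic 0.19 0.5095 x := rfl

theorem cutProb_comm (fp fm : I → I) (x : Sym2 V → I) (u w : V) :
    cutProb G fp fm x u w = cutProb G fp fm x w u := by
  unfold cutProb
  rw [Sym2.eq_swap]
  simp only [G.adj_comm u w, eq_comm (a := u)]

theorem fPlus_zero : fPlus 0 = 0 := by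
  apply Subtype.ext
  rw [coe_fPlus]
  unfold piecewiseQuadratic
  norm_num

theorem cutProb_self {x : Sym2 V → I} (hx : IsFeasible x) (w : V) :
    cutProb G fPlus fMinus x w w = 0 := by
  unfold cutProb
  rw [if_pos (Or.inl rfl), hx.diag, fPlus_zero]

theorem cutProb_of_adj (x : Sym2 V → I) {u w : V} (h : G.Adj u w) :
    (cutProb G fPlus fMinus x u w : ℝ) = piecewiseQuadratic 0.19 0.5095 (x s(u, w)) := by
  unfold cutProb
  rw [if_pos (Or.inr h), coe_fPlus]

theorem cutProb_of_not_adj (x : Sym2 V → I) {u w : V} (h : ¬ G.Adj u w) (hne : u ≠ w) :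
    (cutProb G fPlus fMinus x u w : ℝ) = x s(u, w) := by
  unfold cutProb
  rw [if_neg (by tauto)]
  rfl

/-- The term of the pair `u, v` in `stepSlack` for the pivot `w`. -/
def tripleTerm (x : Sym2 V → I) (w u v : V) : ℝ :=
  if u = v then 0 else
    pairCost G u v (cutProb G fPlus fMinus x u w) (cutProb G fPlus fMinus x v w)
    - 2.0599 * (pairLP G x u v *
      (1 - (cutProb G fPlus fMinus x u w : ℝ) * cutProb G fPlus fMinus x v w))

theorem tripleTerm_comm (x : Sym2 V → I) (w u v : V) :
    tripleTerm G x w u v = tripleTerm G x w v u := by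
  unfold tripleTerm pairCost
  rw [pairLP_comm]
  simp only [G.adj_comm u v, eq_comm (a := u)]
  split_ifs <;> ring

theorem tripleTerm_self {x : Sym2 V → I} (hx : IsFeasible x) (u v : V) :
    tripleTerm G x u u v ≤ 0 := by
  unfold tripleTerm
  split_ifs with huv
  · exact le_rfl
  · rw [cutProb_self G hx]
    unfold pairCost pairLP
    split_ifs with h
    · rw [cutProb_of_adj G x h.symm, Sym2.eq_swap (a := u)]
      have := piecewiseQuadratic_le (x s(v, u)) (x s(v, u)).2.1
      have := (piecewiseQuadratic_mem 0.19 0.5095 (x s(v, u))).1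
      simp only [Set.Icc.coe_zero]
      nlinarith
    · rw [cutProb_of_not_adj G x (fun h' => h h'.symm) (Ne.symm huv), Sym2.eq_swap (a := u)]
      have := (x s(v, u)).2.2
      simp only [Set.Icc.coe_zero]
      nlinarith

/-- The heart of the analysis: the three choices of the pivot in a triangle. -/
theorem tripleTerm_add_le {x : Sym2 V → I} (hx : IsFeasible x) (w u v : V) :
    tripleTerm G x w u v + tripleTerm G x u v w + tripleTerm G x v w u ≤ 0 := by
  by_cases huv : u = v
  · subst huv
    have h0 : tripleTerm G x w u u = 0 := if_pos rfl
    rw [h0, tripleTerm_comm G x u w u]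
    have := tripleTerm_self G hx u w
    linarith
  by_cases hvw : v = w
  · subst hvw
    have h0 : tripleTerm G x u v v = 0 := if_pos rfl
    rw [h0, tripleTerm_comm G x v u v]
    have := tripleTerm_self G hx v u
    linarith
  by_cases huw : u = w
  · subst huw
    have h0 : tripleTerm G x v u u = 0 := if_pos rfl
    rw [h0, tripleTerm_comm G x u v u]
    have := tripleTerm_self G hx u v
    linarith
  have t1 := hx.triangle u v w
  have t2 := hx.triangle u w v
  have t3 := hx.triangle v u w
  rw [Sym2.eq_swap (a := w) (b := v)] at t2
  rw [Sym2.eq_swap (a := v) (b := u)] at t3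
  have a0 := (x s(u, v)).2
  have b0 := (x s(v, w)).2
  have c0 := (x s(u, w)).2
  unfold tripleTerm pairCost pairLP
  rw [if_neg huv, if_neg hvw, if_neg (Ne.symm huw), cutProb_comm G fPlus fMinus x v u,
    cutProb_comm G fPlus fMinus x w u, cutProb_comm G fPlus fMinus x w v,
    Sym2.eq_swap (a := w) (b := u)]
  simp only [G.adj_comm w u]
  by_cases h1 : G.Adj u v <;> by_cases h2 : G.Adj v w <;> by_cases h3 : G.Adj u w <;>
    simp only [h1, h2, h3, if_true, if_false, cutProb_of_adj, cutProb_of_not_adj,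
      not_false_eq_true, ne_eq, huv, hvw, huw] <;>
    generalize (x s(u, v) : ℝ) = a at * <;> generalize (x s(v, w) : ℝ) = b at * <;>
    generalize (x s(u, w) : ℝ) = c at *
  · have := slackPPP_nonneg a0.1 b0.1 c0.1 t1 (by linarith) (by linarith)
    unfold slackPPP at this
    linarith
  · have := slackPPN_nonneg a0.1 b0.1 c0.1 c0.2 t1
    unfold slackPPN at this
    linarith
  · have := slackPPN_nonneg a0.1 c0.1 b0.1 b0.2 t3
    unfold slackPPN at this
    linarith
  · have := slackPNN_nonneg b0.2 c0.2 b0.1 c0.1 (piecewiseQuadratic_mem 0.19 0.5095 a).1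
      (piecewiseQuadratic_mem 0.19 0.5095 a).2 (piecewiseQuadratic_le a a0.1)
    linarith
  · have := slackPPN_nonneg b0.1 c0.1 a0.1 a0.2 (by linarith)
    unfold slackPPN at this
    linarith
  · have := slackPNN_nonneg a0.2 c0.2 a0.1 c0.1 (piecewiseQuadratic_mem 0.19 0.5095 b).1
      (piecewiseQuadratic_mem 0.19 0.5095 b).2 (piecewiseQuadratic_le b b0.1)
    linarith
  · have := slackPNN_nonneg a0.2 b0.2 a0.1 b0.1 (piecewiseQuadratic_mem 0.19 0.5095 c).1
      (piecewiseQuadratic_mem 0.19 0.5095 c).2 (piecewiseQuadratic_le c c0.1)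
    linarith
  · have := slackNNN_nonneg a0.1 b0.1 c0.1 a0.2 b0.2 c0.2
    linarith

/-- A step with a uniformly random pivot pays for itself on average. -/
theorem sum_stepSlack_nonpos {x : Sym2 V → I} (hx : IsFeasible x) (A : Finset V) :
    ∑ w ∈ A, stepSlack G x A (fun u => (cutProb G fPlus fMinus x u w : ℝ)) ≤ 0 := by
  have e : ∑ w ∈ A, stepSlack G x A (fun u => (cutProb G fPlus fMinus x u w : ℝ)) =
      ∑ w ∈ A, ∑ u ∈ A, ∑ v ∈ A, tripleTerm G x w u v := rfl
  have e1 : ∑ w ∈ A, ∑ u ∈ A, ∑ v ∈ A, tripleTerm G x u v w =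
      ∑ w ∈ A, ∑ u ∈ A, ∑ v ∈ A, tripleTerm G x w u v := by
    rw [Finset.sum_comm]
    exact Finset.sum_congr rfl fun u _ => Finset.sum_comm
  have e2 : ∑ w ∈ A, ∑ u ∈ A, ∑ v ∈ A, tripleTerm G x v w u =
      ∑ w ∈ A, ∑ u ∈ A, ∑ v ∈ A, tripleTerm G x w u v := by
    exact (Finset.sum_congr rfl fun w _ => Finset.sum_comm).trans Finset.sum_comm
  have h : ∑ w ∈ A, ∑ u ∈ A, ∑ v ∈ A,
      (tripleTerm G x w u v + tripleTerm G x u v w + tripleTerm G x v w u) ≤ 0 :=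
    Finset.sum_nonpos fun w _ => Finset.sum_nonpos fun u _ => Finset.sum_nonpos fun v _ =>
      tripleTerm_add_le G hx w u v
  simp only [Finset.sum_add_distrib] at h
  rw [e]
  linarith

end Pairs

section Expectation

variable {V : Type u} [DecidableEq V]

/-! ### The expected cost of the rounding algorithm -/

/-- The indicator function of the complement of `S`. -/
def outside (S : Finset V) (u : V) : ℝ := if u ∈ S then 0 else 1

/-- The probability that `randomSubset A q` is `S`. -/
def subsetWeight (A : Finset V) (q : V → I) (S : Finset V) : ℝ :=
  (∏ u ∈ S, (q u : ℝ)) * ∏ u ∈ A \ S, (1 - (q u : ℝ))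

theorem subsetWeight_nonneg (A : Finset V) (q : V → I) (S : Finset V) :
    0 ≤ subsetWeight A q S :=
  mul_nonneg (Finset.prod_nonneg fun u _ => (q u).2.1)
    (Finset.prod_nonneg fun u _ => sub_nonneg.2 (q u).2.2)

theorem randomSubset_apply (A : Finset V) (q : V → I) {S : Finset V} (hS : S ⊆ A) :
    randomSubset A q S = ENNReal.ofReal (subsetWeight A q S) := by
  unfold randomSubset
  rw [PMF.ofFinset_apply, if_pos hS, ENNReal.ofReal]
  congr 1
  apply NNReal.eq
  rw [Real.coe_toNNReal _ (subsetWeight_nonneg A q S)]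
  simp [subsetWeight]

theorem randomSubset_apply_of_not_subset (A : Finset V) (q : V → I) {S : Finset V}
    (hS : ¬ S ⊆ A) : randomSubset A q S = 0 := by
  unfold randomSubset
  rw [PMF.ofFinset_apply, if_neg hS]

theorem mem_of_randomSubset_ne_zero {A : Finset V} {q : V → I} {S : Finset V} {w : V}
    (hw : w ∈ A) (hq : q w = 1) (hS : randomSubset A q S ≠ 0) : w ∈ S := by
  by_contra h
  have hSA : S ⊆ A := by
    by_contra h'
    exact hS (randomSubset_apply_of_not_subset A q h')
  apply hS
  rw [randomSubset_apply A q hSA, subsetWeight,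
    Finset.prod_eq_zero (i := w) (s := A \ S) (by simp [hw, h]) (by simp [hq])]
  simp

theorem sum_subsetWeight_disjoint (A : Finset V) (q : V → I) {D : Finset V} (hD : D ⊆ A) :
    ∑ S ∈ A.powerset, (subsetWeight A q S * if Disjoint S D then 1 else 0) =
      ∏ u ∈ D, (1 - (q u : ℝ)) := by
  have h := Finset.prod_add (fun u => if u ∈ D then (0 : ℝ) else q u) (fun u => 1 - (q u : ℝ)) A
  have h1 : ∏ u ∈ A, ((if u ∈ D then (0 : ℝ) else q u) + (1 - (q u : ℝ))) =
      ∏ u ∈ D, (1 - (q u : ℝ)) := by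
    rw [← Finset.prod_subset hD]
    · exact Finset.prod_congr rfl fun u hu => by simp [hu]
    · intro u _ hu; simp [hu]
  rw [← h1, h]
  refine Finset.sum_congr rfl fun S _ => ?_
  unfold subsetWeight
  by_cases hd : Disjoint S D
  · rw [if_pos hd, mul_one]
    congr 1
    refine Finset.prod_congr rfl fun u hu => ?_
    rw [if_neg (Finset.disjoint_left.1 hd hu)]
  · rw [if_neg hd]
    obtain ⟨u, hu, hu'⟩ := Finset.not_disjoint_iff.1 hd
    have h0 : ∏ u ∈ S, (if u ∈ D then (0 : ℝ) else q u) = 0 := Finset.prod_eq_zero hu (if_pos hu')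
    rw [h0, zero_mul, mul_zero]

theorem sum_subsetWeight (A : Finset V) (q : V → I) :
    ∑ S ∈ A.powerset, subsetWeight A q S = 1 := by
  simpa using sum_subsetWeight_disjoint A q (Finset.empty_subset A)

theorem sum_subsetWeight_outside (A : Finset V) (q : V → I) {u : V} (hu : u ∈ A) :
    ∑ S ∈ A.powerset, subsetWeight A q S * outside S u = 1 - (q u : ℝ) := by
  have h := sum_subsetWeight_disjoint A q (Finset.singleton_subset_iff.2 hu)
  rw [Finset.prod_singleton] at h
  rw [← h]
  refine Finset.sum_congr rfl fun S _ => ?_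
  simp only [Finset.disjoint_singleton_right, outside]
  split_ifs <;> simp_all

theorem sum_subsetWeight_outside_mul (A : Finset V) (q : V → I) {u v : V} (hu : u ∈ A)
    (hv : v ∈ A) (huv : u ≠ v) :
    ∑ S ∈ A.powerset, subsetWeight A q S * (outside S u * outside S v) =
      (1 - (q u : ℝ)) * (1 - (q v : ℝ)) := by
  have h := sum_subsetWeight_disjoint A q (D := {u, v}) (by
    intro a ha
    rcases Finset.mem_insert.1 ha with rfl | ha
    · exact hu
    · rw [Finset.mem_singleton.1 ha]; exact hv)
  rw [Finset.prod_pair huv] at h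
  rw [← h]
  refine Finset.sum_congr rfl fun S _ => ?_
  simp only [Finset.disjoint_insert_right, Finset.disjoint_singleton_right, outside]
  split_ifs <;> simp_all

variable (G : SimpleGraph V) [DecidableRel G.Adj]

/-- `stepSlack` is affine in each probability, so its expectation over independent choices is its
value at the probabilities. -/
theorem sum_subsetWeight_stepSlack (x : Sym2 V → I) (A : Finset V) (p : V → I) :
    ∑ S ∈ A.powerset, subsetWeight A (fun u => σ (p u)) S * stepSlack G x A (outside S) =
      stepSlack G x A fun u => (p u : ℝ) := by
  have h1 := sum_subsetWeight A fun u => σ (p u)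
  unfold stepSlack pairSum
  simp only [Finset.mul_sum]
  rw [Finset.sum_comm]
  refine Finset.sum_congr rfl fun u hu => ?_
  rw [Finset.sum_comm]
  refine Finset.sum_congr rfl fun v hv => ?_
  by_cases huv : u = v
  · simp [huv]
  have h2 := sum_subsetWeight_outside A (fun u => σ (p u)) hu
  have h3 := sum_subsetWeight_outside A (fun u => σ (p u)) hv
  have h4 := sum_subsetWeight_outside_mul A (fun u => σ (p u)) hu hv huv
  simp only [coe_symm_eq, sub_sub_cancel] at h2 h3 h4
  simp only [if_neg huv, pairCost]
  split_ifs with hadj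
  · rw [← h4, ← h2, ← h3, Finset.mul_sum]
    have e : ∀ S ∈ A.powerset, subsetWeight A (fun u => σ (p u)) S *
        (outside S u + outside S v - 2 * (outside S u * outside S v) -
          2.0599 * (pairLP G x u v * (1 - outside S u * outside S v))) =
        subsetWeight A (fun u => σ (p u)) S * outside S u
        + subsetWeight A (fun u => σ (p u)) S * outside S v
        - 2 * (subsetWeight A (fun u => σ (p u)) S * (outside S u * outside S v))
        - 2.0599 * pairLP G x u v * subsetWeight A (fun u => σ (p u)) S
        + 2.0599 * pairLP G x u v *
          (subsetWeight A (fun u => σ (p u)) S * (outside S u * outside S v)) :=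
      fun S _ => by ring
    rw [Finset.sum_congr rfl e]
    simp only [Finset.sum_add_distrib, Finset.sum_sub_distrib, ← Finset.mul_sum, h1, h2, h3, h4]
    ring
  · have e : ∀ S ∈ A.powerset, subsetWeight A (fun u => σ (p u)) S *
        ((1 - outside S u) * (1 - outside S v) -
          2.0599 * (pairLP G x u v * (1 - outside S u * outside S v))) =
        subsetWeight A (fun u => σ (p u)) S
        - subsetWeight A (fun u => σ (p u)) S * outside S u
        - subsetWeight A (fun u => σ (p u)) S * outside S v
        + (subsetWeight A (fun u => σ (p u)) S * (outside S u * outside S v))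
        - 2.0599 * pairLP G x u v * subsetWeight A (fun u => σ (p u)) S
        + 2.0599 * pairLP G x u v *
          (subsetWeight A (fun u => σ (p u)) S * (outside S u * outside S v)) :=
      fun S _ => by ring
    rw [Finset.sum_congr rfl e]
    simp only [Finset.sum_add_distrib, Finset.sum_sub_distrib, ← Finset.mul_sum, h1, h2, h3, h4]
    ring

/-- Every output of the main loop is a partition of the active vertices. -/
theorem pivotLoop_support {p : V → V → I} (hp : ∀ w, p w w = 0) (k : ℕ) :
    ∀ A : Finset V, A.card ≤ k → ∀ L ∈ (pivotLoop p k A).support,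
      L.Pairwise Disjoint ∧ (∀ S ∈ L, S.Nonempty) ∧ (∀ S ∈ L, S ⊆ A) ∧ ∀ v ∈ A, ∃ S ∈ L, v ∈ S := by
  induction k with
  | zero =>
    intro A hA L hL
    have hA' : A = ∅ := Finset.card_eq_zero.1 (Nat.le_zero.1 hA)
    have hL' : L = [] := by simpa [pivotLoop] using hL
    subst hA' hL'
    simp
  | succ k ih =>
    intro A hA L hL
    by_cases hne : A.Nonempty
    · simp only [pivotLoop, hne, dif_pos, PMF.mem_support_bind_iff, PMF.mem_support_map_iff] at hL
      obtain ⟨w, hw, S, hS, L', hL', rfl⟩ := hL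
      have hwA : w ∈ A := by simpa using hw
      have hwS : w ∈ S := mem_of_randomSubset_ne_zero hwA (by simp [hp]) hS
      have hSA : S ⊆ A := by
        by_contra h'
        exact hS (randomSubset_apply_of_not_subset A _ h')
      have hcard : (A \ S).card ≤ k := by
        have : (A \ S).card < A.card :=
          Finset.card_lt_card ⟨Finset.sdiff_subset, fun h => (Finset.mem_sdiff.1 (h hwA)).2 hwS⟩
        omega
      obtain ⟨h1, h2, h3, h4⟩ := ih _ hcard L' hL'
      refine ⟨List.pairwise_cons.2 ⟨fun T hT => ?_, h1⟩, ?_, ?_, ?_⟩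
      · exact Finset.disjoint_left.2 fun a ha ha' => (Finset.mem_sdiff.1 (h3 T hT ha')).2 ha
      · intro T hT
        rcases List.mem_cons.1 hT with rfl | hT
        · exact ⟨w, hwS⟩
        · exact h2 T hT
      · intro T hT
        rcases List.mem_cons.1 hT with rfl | hT
        · exact hSA
        · exact (h3 T hT).trans Finset.sdiff_subset
      · intro v hv
        by_cases hvS : v ∈ S
        · exact ⟨S, List.mem_cons_self, hvS⟩
        · obtain ⟨T, hT, hvT⟩ := h4 v (Finset.mem_sdiff.2 ⟨hv, hvS⟩)
          exact ⟨T, List.mem_cons_of_mem _ hT, hvT⟩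
    · have hA' : A = ∅ := Finset.not_nonempty_iff_eq_empty.1 hne
      have hL' : L = [] := by simpa [pivotLoop, hne] using hL
      subst hA' hL'
      simp

theorem togetherInList_mk {L : List (Finset V)} {u v : V} :
    TogetherInList L s(u, v) ↔ ∃ S ∈ L, u ∈ S ∧ v ∈ S := by
  simp [TogetherInList]

/-- The violated pairs are those of the first cluster and those of the rest. -/
theorem pairSum_violated_cons {A S : Finset V} {L : List (Finset V)}
    (hL : ∀ T ∈ L, T ⊆ A \ S) :
    pairSum A (pairViolated G (TogetherInList (S :: L))) =
      pairSum A (fun u v => pairCost G u v (outside S u) (outside S v))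
        + pairSum (A \ S) (pairViolated G (TogetherInList L)) := by
  rw [pairSum_subset Finset.sdiff_subset, ← pairSum_add]
  refine pairSum_congr fun u hu v hv _ => ?_
  have hL' : ∀ T ∈ L, ∀ a ∈ T, a ∉ S := fun T hT a ha => (Finset.mem_sdiff.1 (hL T hT ha)).2
  unfold pairViolated pairCost outside
  simp only [togetherInList_mk, List.mem_cons, exists_eq_or_imp, Finset.mem_sdiff]
  by_cases h1 : u ∈ S
  · have : ¬ ∃ T ∈ L, u ∈ T ∧ v ∈ T := fun ⟨T, hT, h, _⟩ => hL' T hT u h h1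
    by_cases h2 : v ∈ S <;> simp [h1, h2, this]
  · by_cases h2 : v ∈ S
    · have : ¬ ∃ T ∈ L, u ∈ T ∧ v ∈ T := fun ⟨T, hT, _, h⟩ => hL' T hT v h h2
      simp [h1, h2, this]
    · simp [h1, h2, hu, hv]
      norm_num

theorem stepSlack_outside (x : Sym2 V → I) {A S : Finset V} :
    stepSlack G x A (outside S) + 2.0599 * pairSum A (pairLP G x) =
      pairSum A (fun u v => pairCost G u v (outside S u) (outside S v))
        + 2.0599 * pairSum (A \ S) (pairLP G x) := by
  rw [pairSum_subset Finset.sdiff_subset, ← pairSum_mul_left, ← pairSum_mul_left, ← pairSum_add]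
  unfold stepSlack
  rw [← pairSum_add]
  refine pairSum_congr fun u hu v hv _ => ?_
  unfold outside
  by_cases h1 : u ∈ S <;> by_cases h2 : v ∈ S <;> simp [h1, h2, hu, hv]

theorem pairCost_nonneg (u v : V) {a b : ℝ} (ha : 0 ≤ a) (ha1 : a ≤ 1) (hb : 0 ≤ b) (hb1 : b ≤ 1) :
    0 ≤ pairCost G u v a b := by
  unfold pairCost
  split_ifs
  · nlinarith
  · exact mul_nonneg (by linarith) (by linarith)

theorem outside_mem (S : Finset V) (u : V) : 0 ≤ outside S u ∧ outside S u ≤ 1 := by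
  unfold outside
  split_ifs <;> norm_num

theorem tsum_map_mul {α β : Type*} (D : PMF α) (f : α → β) (g : β → ℝ≥0∞) :
    ∑' b, (D.map f) b * g b = ∑' a, D a * g (f a) := by
  classical
  simp only [PMF.map_apply, ← ENNReal.tsum_mul_right]
  rw [ENNReal.tsum_comm]
  refine tsum_congr fun a => ?_
  rw [tsum_eq_single (f a) (by intro b hb; simp [hb])]
  simp

theorem tsum_bind_mul {α β : Type*} (D : PMF α) (f : α → PMF β) (g : β → ℝ≥0∞) :
    ∑' b, (D.bind f) b * g b = ∑' a, D a * ∑' b, f a b * g b := by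
  simp only [PMF.bind_apply, ← ENNReal.tsum_mul_right, ← ENNReal.tsum_mul_left]
  rw [ENNReal.tsum_comm]
  simp only [mul_assoc]

theorem expected_pairViolated_le {x : Sym2 V → I} (hx : IsFeasible x) (k : ℕ) :
    ∀ A : Finset V, A.card ≤ k →
      ∑' L, pivotLoop (cutProb G fPlus fMinus x) k A L *
        ENNReal.ofReal (pairSum A (pairViolated G (TogetherInList L))) ≤
      ENNReal.ofReal (2.0599 * pairSum A (pairLP G x)) := by
  induction k with
  | zero =>
    intro A hA
    have hA' : A = ∅ := Finset.card_eq_zero.1 (Nat.le_zero.1 hA)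
    subst hA'
    simp [pairSum]
  | succ k ih =>
    intro A hA
    by_cases hne : A.Nonempty
    swap
    · have hA' : A = ∅ := Finset.not_nonempty_iff_eq_empty.1 hne
      subst hA'
      simp [pairSum]
    set p := cutProb G fPlus fMinus x with hp
    have hpself : ∀ w, p w w = 0 := cutProb_self G hx
    set c := 2.0599 * pairSum A (pairLP G x) with hc
    have hlp : ∀ B : Finset V, 0 ≤ pairSum B (pairLP G x) := fun B =>
      pairSum_nonneg fun u _ v _ _ => pairLP_nonneg G x u v
    have hcost : ∀ S : Finset V,
        0 ≤ pairSum A (fun u v => pairCost G u v (outside S u) (outside S v)) := fun S =>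
      pairSum_nonneg fun u _ v _ _ => pairCost_nonneg G u v (outside_mem S u).1 (outside_mem S u).2
        (outside_mem S v).1 (outside_mem S v).2
    have hpos : ∀ S, 0 ≤ stepSlack G x A (outside S) + c := fun S => by
      rw [hc, stepSlack_outside]
      exact add_nonneg (hcost S) (mul_nonneg (by norm_num) (hlp _))
    -- the expected cost after the choice of the pivot
    have hpivot : ∀ w ∈ A, ∑' S, randomSubset A (fun u => σ (p u w)) S *
        (∑' L, ((pivotLoop p k (A \ S)).map fun L => S :: L) L *
          ENNReal.ofReal (pairSum A (pairViolated G (TogetherInList L)))) ≤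
        ENNReal.ofReal (stepSlack G x A (fun u => (p u w : ℝ)) + c) := by
      intro w hw
      have h1 : ∀ S, randomSubset A (fun u => σ (p u w)) S *
          (∑' L, ((pivotLoop p k (A \ S)).map fun L => S :: L) L *
            ENNReal.ofReal (pairSum A (pairViolated G (TogetherInList L)))) ≤
          randomSubset A (fun u => σ (p u w)) S *
            ENNReal.ofReal (stepSlack G x A (outside S) + c) := by
        intro S
        by_cases h0 : randomSubset A (fun u => σ (p u w)) S = 0
        · simp [h0]
        refine mul_le_mul_right ?_ _
        have hwS : w ∈ S := mem_of_randomSubset_ne_zero hw (by simp [hpself]) h0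
        have hSA : S ⊆ A := by
          by_contra h'
          exact h0 (randomSubset_apply_of_not_subset A _ h')
        have hcard : (A \ S).card ≤ k := by
          have : (A \ S).card < A.card :=
            Finset.card_lt_card ⟨Finset.sdiff_subset, fun h => (Finset.mem_sdiff.1 (h hw)).2 hwS⟩
          omega
        rw [tsum_map_mul]
        have h2 : ∀ L, pivotLoop p k (A \ S) L *
            ENNReal.ofReal (pairSum A (pairViolated G (TogetherInList (S :: L)))) =
            pivotLoop p k (A \ S) L *
              ENNReal.ofReal (pairSum A fun u v => pairCost G u v (outside S u) (outside S v))
            + pivotLoop p k (A \ S) L *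
              ENNReal.ofReal (pairSum (A \ S) (pairViolated G (TogetherInList L))) := by
          intro L
          by_cases hL0 : pivotLoop p k (A \ S) L = 0
          · simp [hL0]
          have hL := (pivotLoop_support hpself k _ hcard L
            ((PMF.mem_support_iff _ _).2 hL0)).2.2.1
          rw [pairSum_violated_cons G hL, ENNReal.ofReal_add (hcost S)
            (pairSum_nonneg fun u _ v _ _ => pairViolated_nonneg G _ u v), mul_add]
        rw [tsum_congr h2, ENNReal.tsum_add, ENNReal.tsum_mul_right, PMF.tsum_coe, one_mul, hc,
          stepSlack_outside, ENNReal.ofReal_add (hcost S) (mul_nonneg (by norm_num) (hlp _))]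
        exact add_le_add le_rfl (ih _ hcard)
      refine (ENNReal.tsum_le_tsum h1).trans ?_
      rw [tsum_eq_sum (s := A.powerset)]
      · have h3 : ∀ S ∈ A.powerset, randomSubset A (fun u => σ (p u w)) S *
            ENNReal.ofReal (stepSlack G x A (outside S) + c) =
            ENNReal.ofReal (subsetWeight A (fun u => σ (p u w)) S *
              (stepSlack G x A (outside S) + c)) := by
          intro S hS
          rw [randomSubset_apply _ _ (Finset.mem_powerset.1 hS),
            ENNReal.ofReal_mul (subsetWeight_nonneg _ _ _)]
        rw [Finset.sum_congr rfl h3, ← ENNReal.ofReal_sum_of_nonneg]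
        · refine ENNReal.ofReal_le_ofReal (le_of_eq ?_)
          simp only [mul_add, Finset.sum_add_distrib, ← Finset.sum_mul, sum_subsetWeight, one_mul]
          rw [sum_subsetWeight_stepSlack G x A fun u => p u w]
        · exact fun S _ => mul_nonneg (subsetWeight_nonneg _ _ _) (hpos S)
      · intro S hS
        rw [randomSubset_apply_of_not_subset _ _ fun h => hS (Finset.mem_powerset.2 h), zero_mul]
    simp only [pivotLoop, hne, dif_pos]
    rw [tsum_bind_mul]
    simp only [tsum_bind_mul]
    rw [tsum_eq_sum (s := A)]
    swap
    · intro w hw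
      simp [PMF.uniformOfFinset_apply, hw]
    have h4 : ∀ w ∈ A, 0 ≤ stepSlack G x A (fun u => (p u w : ℝ)) + c := by
      intro w _
      have h := sum_subsetWeight_stepSlack G x A fun u => p u w
      have h' := sum_subsetWeight A fun u => σ (p u w)
      rw [← h]
      have : c = ∑ S ∈ A.powerset, subsetWeight A (fun u => σ (p u w)) S * c := by
        rw [← Finset.sum_mul, h', one_mul]
      rw [this, ← Finset.sum_add_distrib]
      refine Finset.sum_nonneg fun S _ => ?_
      rw [← mul_add]
      exact mul_nonneg (subsetWeight_nonneg _ _ _) (hpos S)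
    have hcard0 : (A.card : ℝ≥0∞) ≠ 0 := by simpa using hne.ne_empty
    calc _ ≤ ∑ w ∈ A, (A.card : ℝ≥0∞)⁻¹ *
          ENNReal.ofReal (stepSlack G x A (fun u => (p u w : ℝ)) + c) := by
          refine Finset.sum_le_sum fun w hw => ?_
          rw [PMF.uniformOfFinset_apply_of_mem _ hw]
          exact mul_le_mul_right (hpivot w hw) _
      _ = (A.card : ℝ≥0∞)⁻¹ *
          ENNReal.ofReal (∑ w ∈ A, (stepSlack G x A (fun u => (p u w : ℝ)) + c)) := by
          rw [ENNReal.ofReal_sum_of_nonneg h4, Finset.mul_sum]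
      _ ≤ (A.card : ℝ≥0∞)⁻¹ * ENNReal.ofReal (A.card * c) := by
          refine mul_le_mul_right (ENNReal.ofReal_le_ofReal ?_) _
          rw [Finset.sum_add_distrib, Finset.sum_const, nsmul_eq_mul]
          linarith [sum_stepSlack_nonpos G hx A]
      _ = ENNReal.ofReal c := by
          rw [ENNReal.ofReal_mul (by positivity), ENNReal.ofReal_natCast, ← mul_assoc,
            ENNReal.inv_mul_cancel hcard0 (ENNReal.natCast_ne_top _), one_mul]

variable [Fintype V]

theorem isClustering_of_mem_support {x : Sym2 V → I} (hx : IsFeasible x) {L : List (Finset V)}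
    (hL : L ∈ (pivotRounding G fPlus fMinus x).support) : IsClustering L := by
  obtain ⟨h1, h2, _, h3⟩ := pivotLoop_support (cutProb_self G hx) _ Finset.univ
    (le_of_eq (Finset.card_univ)) L hL
  exact ⟨h1, h2, fun v => h3 v (Finset.mem_univ v)⟩

theorem expectedViolated_le {x : Sym2 V → I} (hx : IsFeasible x) :
    expectedViolated G (pivotRounding G fPlus fMinus x) ≤ ENNReal.ofReal (2.0599 * lpCost G x) := by
  have h := expected_pairViolated_le G hx (Fintype.card V) Finset.univ (le_of_eq Finset.card_univ)
  have e : ∀ L, (numViolated G (TogetherInList L) : ℝ≥0∞) = ENNReal.ofReal (1 / 2) *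
      ENNReal.ofReal (pairSum Finset.univ (pairViolated G (TogetherInList L))) := by
    intro L
    rw [← two_mul_numViolated, ← ENNReal.ofReal_mul (by norm_num), ← ENNReal.ofReal_natCast]
    congr 1
    ring
  unfold expectedViolated
  have e1 : ∀ L, pivotRounding G fPlus fMinus x L * (numViolated G (TogetherInList L) : ℝ≥0∞) =
      ENNReal.ofReal (1 / 2) * (pivotLoop (cutProb G fPlus fMinus x) (Fintype.card V) Finset.univ L *
      ENNReal.ofReal (pairSum Finset.univ (pairViolated G (TogetherInList L)))) := by
    intro L
    rw [e L, mul_left_comm]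
    rfl
  rw [tsum_congr e1, ENNReal.tsum_mul_left]
  refine (mul_le_mul_right h _).trans (le_of_eq ?_)
  rw [← ENNReal.ofReal_mul (by norm_num), ← two_mul_lpCost]
  congr 1
  ring

theorem togetherInLabels_mk {c : V → ℕ} {u v : V} :
    TogetherInLabels c s(u, v) ↔ c u = c v := by
  constructor
  · intro h
    exact h u (Sym2.mem_mk_left u v) v (Sym2.mem_mk_right u v)
  · intro h a ha b hb
    rcases Sym2.mem_iff.1 ha with rfl | rfl <;> rcases Sym2.mem_iff.1 hb with rfl | rfl <;>
      simp [h]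

/-- Every clustering is an integral solution of the linear program. -/
theorem exists_feasible_of_labels (c : V → ℕ) :
    ∃ y : Sym2 V → I, IsFeasible y ∧ lpCost G y = numViolated G (TogetherInLabels c) := by
  classical
  refine ⟨fun e => if TogetherInLabels c e then 0 else 1, ⟨?_, ?_⟩, ?_⟩
  · intro u
    rw [if_pos (togetherInLabels_mk.2 rfl)]
  · intro u v w
    simp only [togetherInLabels_mk]
    by_cases h1 : c u = c v <;> by_cases h2 : c v = c w
    · simp [h1, h2]
    · simp [h1, h2]
    · rw [if_neg h1, if_pos h2, ← h2, if_neg h1]; simp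
    · rw [if_neg h1, if_neg h2]
      split_ifs <;> norm_num
  · have h1 := two_mul_lpCost G (fun e => if TogetherInLabels c e then (0 : I) else 1)
    have h2 := two_mul_numViolated G (TogetherInLabels c)
    have h3 : pairSum Finset.univ (pairLP G fun e => if TogetherInLabels c e then (0 : I) else 1) =
        pairSum Finset.univ (pairViolated G (TogetherInLabels c)) := by
      refine pairSum_congr fun u _ v _ _ => ?_
      unfold pairLP pairViolated
      by_cases h : TogetherInLabels c s(u, v) <;> simp [h]
    linarith

end Expectation

/-! ### Arithmetic expressions and their compilation -/

theorem Store.reg_setReg (s : Store) (r v q : ℕ) :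
    (s.setReg r v).reg q = if q = r then v else s.reg q := by
  simp [Store.setReg, Function.update_apply]

@[simp] theorem Store.arr_setReg (s : Store) (r v : ℕ) : (s.setReg r v).arr = s.arr := rfl

@[simp] theorem Store.reg_setArr (s : Store) (k i v : ℕ) : (s.setArr k i v).reg = s.reg := rfl

/-- Arithmetic expressions over the registers and the arrays. In `sum r b e` the register `r` is
the summation variable, which runs through the numbers less than `b`. -/
inductive Expr : Type
  | const (c : ℕ)
  | var (r : ℕ)
  | read (k : ℕ) (e : Expr)
  | add (a b : Expr)
  | sub (a b : Expr)
  | mul (a b : Expr)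
  | sum (r : ℕ) (b e : Expr)

namespace Expr

/-- The value of an expression. -/
def eval : Expr → Store → ℕ
  | const c, _ => c
  | var r, s => s.reg r
  | read k e, s => s.arr k (e.eval s)
  | add a b, s => a.eval s + b.eval s
  | sub a b, s => a.eval s - b.eval s
  | mul a b, s => a.eval s * b.eval s
  | sum r b e, s => ∑ i ∈ Finset.range (b.eval s), e.eval (s.setReg r i)

/-- All registers mentioned in the expression are less than `d`. -/
def Below (d : ℕ) : Expr → Prop
  | const _ => True
  | var r => r < d
  | read _ e => e.Below d
  | add a b => a.Below d ∧ b.Below d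
  | sub a b => a.Below d ∧ b.Below d
  | mul a b => a.Below d ∧ b.Below d
  | sum r b e => r < d ∧ b.Below d ∧ e.Below d

instance decidableBelow (d : ℕ) : (e : Expr) → Decidable (e.Below d)
  | const _ => .isTrue trivial
  | var r => inferInstanceAs (Decidable (r < d))
  | read _ e => decidableBelow d e
  | add a b => @instDecidableAnd _ _ (decidableBelow d a) (decidableBelow d b)
  | sub a b => @instDecidableAnd _ _ (decidableBelow d a) (decidableBelow d b)
  | mul a b => @instDecidableAnd _ _ (decidableBelow d a) (decidableBelow d b)
  | sum r b e => @instDecidableAnd (r < d) _ _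
      (@instDecidableAnd _ _ (decidableBelow d b) (decidableBelow d e))

theorem eval_congr {d : ℕ} : ∀ {e : Expr}, e.Below d → ∀ {s s' : Store},
    (∀ r < d, s'.reg r = s.reg r) → s'.arr = s.arr → e.eval s' = e.eval s
  | const _, _, _, _, _, _ => rfl
  | var r, he, _, _, h, _ => h r he
  | read k e, he, s, s', h, ha => by
    simp only [eval]
    rw [eval_congr (e := e) he h ha, ha]
  | add a b, he, _, _, h, ha => by
    simp only [eval]
    rw [eval_congr he.1 h ha, eval_congr he.2 h ha]
  | sub a b, he, _, _, h, ha => by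
    simp only [eval]
    rw [eval_congr he.1 h ha, eval_congr he.2 h ha]
  | mul a b, he, _, _, h, ha => by
    simp only [eval]
    rw [eval_congr he.1 h ha, eval_congr he.2 h ha]
  | sum r b e, he, s, s', h, ha => by
    simp only [eval]
    rw [eval_congr he.2.1 h ha]
    refine Finset.sum_congr rfl fun i _ => eval_congr he.2.2 (fun q hq => ?_) ha
    rw [Store.reg_setReg, Store.reg_setReg, h q hq]

/-- The program that puts the value of an expression into register `d`, using the registers from
`d` on for intermediate results. Products are computed by repeated addition. In a sum, register `d + 1`
runs through the values of the summation variable in decreasing order, and register `d + 2` saves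
the old content of the register of that variable. -/
def compile : ℕ → Expr → Program
  | d, const c => .const d c
  | d, var r => .seq (.const d 0) (.add d r d)
  | d, read k e => .seq (compile d e) (.read d k d)
  | d, add a b => .seq (compile d a) (.seq (compile (d + 1) b) (.add d d (d + 1)))
  | d, sub a b => .seq (compile d a) (.seq (compile (d + 1) b) (.sub d d (d + 1)))
  | d, mul a b =>
    .seq (compile (d + 1) a) (.seq (compile (d + 2) b) (.seq (.const d 0) (.seq (.const (d + 3) 1)
      (.while (d + 1) (.seq (.sub (d + 1) (d + 1) (d + 3)) (.add d d (d + 2)))))))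
  | d, sum r b e =>
    .seq (compile (d + 1) b) (.seq (.const (d + 3) 0) (.seq (.add (d + 2) r (d + 3))
      (.seq (.const d 0)
      (.seq (.while (d + 1) (.seq (.const (d + 3) 1) (.seq (.sub (d + 1) (d + 1) (d + 3))
          (.seq (.const (d + 3) 0) (.seq (.add r (d + 1) (d + 3))
            (.seq (compile (d + 3) e) (.add d d (d + 3))))))))
        (.seq (.const (d + 3) 0) (.add r (d + 2) (d + 3)))))))

/-- A polynomial that bounds both the value of an expression and the running time of its program
in terms of a bound on the contents of the memory. -/
def bound : Expr → Polynomial ℕ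
  | const c => Polynomial.C (c + 1)
  | var _ => Polynomial.X + 2
  | read _ e => Polynomial.X + e.bound + 1
  | add a b => a.bound + b.bound + 1
  | sub a b => a.bound + b.bound + 1
  | mul a b => a.bound * b.bound + 4 * a.bound + b.bound + 3
  | sum _ b e => b.bound * (e.bound.comp (Polynomial.X + b.bound) + 6) + b.bound + 6

end Expr

/-- The registers below `d` and all memory cells contain numbers that are at most `B`. -/
structure Bounded (d B : ℕ) (s : Store) : Prop where
  reg : ∀ r < d, s.reg r ≤ B
  arr : ∀ k i, s.arr k i ≤ B

theorem Bounded.congr {d B : ℕ} {s s' : Store} (h : Bounded d B s)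
    (hr : ∀ r < d, s'.reg r = s.reg r) (ha : s'.arr = s.arr) : Bounded d B s' :=
  ⟨fun r hrd => by rw [hr r hrd]; exact h.reg r hrd, fun k i => by rw [ha]; exact h.arr k i⟩

/-- In a sum the summation variable may exceed the old bound on the memory, but it is less than the
bound on the number of terms. -/
theorem Expr.eval_le_bound {d : ℕ} : ∀ {e : Expr}, e.Below d → ∀ {B : ℕ} {s : Store},
    Bounded d B s → e.eval s ≤ e.bound.eval B
  | const c, _, _, _, _ => by simp [eval, bound]
  | var r, he, _, _, h => by
    have := h.reg r he
    simp [eval, bound]; omega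
  | read k e, _, _, s, h => by
    have := h.arr k (e.eval s)
    simp [eval, bound]; omega
  | add a b, he, _, _, h => by
    have h1 := eval_le_bound he.1 h
    have h2 := eval_le_bound he.2 h
    simp [eval, bound]; omega
  | sub a b, he, _, _, h => by
    have h1 := eval_le_bound he.1 h
    simp [eval, bound]; omega
  | mul a b, he, _, _, h => by
    have h1 := Nat.mul_le_mul (eval_le_bound he.1 h) (eval_le_bound he.2 h)
    simp [eval, bound]; omega
  | sum r b e, he, B, s, h => by
    have h1 := eval_le_bound he.2.1 h
    have h2 : ∀ i ∈ Finset.range (b.eval s), e.eval (s.setReg r i) ≤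
        e.bound.eval (B + b.bound.eval B) := by
      intro i hi
      refine eval_le_bound he.2.2 ⟨fun q hq => ?_, fun k j => (h.arr k j).trans (by omega)⟩
      rw [Store.reg_setReg]
      split_ifs
      · have := Finset.mem_range.1 hi
        omega
      · exact (h.reg q hq).trans (by omega)
    have h3 := Finset.sum_le_card_nsmul _ _ _ h2
    have h4 : (Finset.range (b.eval s)).card • e.bound.eval (B + b.bound.eval B) ≤
        b.bound.eval B * (e.bound.eval (B + b.bound.eval B) + 6) := by
      rw [Finset.card_range, smul_eq_mul]
      exact Nat.mul_le_mul h1 (by omega)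
    simp only [eval, bound, Polynomial.eval_add, Polynomial.eval_mul, Polynomial.eval_comp,
      Polynomial.eval_X, Polynomial.eval_ofNat]
    omega

/-- `HT P T s Q`: the program `P`, started on `s`, halts within `T` steps on a store that
satisfies `Q`. -/
def HT (P : Program) (T : ℕ) (s : Store) (Q : Store → Prop) : Prop :=
  ∃ t s', Runs P s t s' ∧ t ≤ T ∧ Q s'

namespace HT

theorem mono {P : Program} {T T' : ℕ} {s : Store} {Q Q' : Store → Prop} (h : HT P T s Q)
    (hT : T ≤ T') (hQ : ∀ s, Q s → Q' s) : HT P T' s Q' := by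
  obtain ⟨t, s', h1, h2, h3⟩ := h
  exact ⟨t, s', h1, h2.trans hT, hQ _ h3⟩

theorem le {P : Program} {T T' : ℕ} {s : Store} {Q : Store → Prop} (h : HT P T s Q)
    (hT : T ≤ T') : HT P T' s Q :=
  h.mono hT fun _ h => h

theorem seq {P P' : Program} {T T' : ℕ} {s : Store} {Q : Store → Prop}
    (h : HT P T s fun s' => HT P' T' s' Q) : HT (.seq P P') (T + T') s Q := by
  obtain ⟨t, s₁, h1, h2, t', s₂, h1', h2', h3'⟩ := h
  exact ⟨_, s₂, .seq h1 h1', by omega, h3'⟩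

variable {s : Store} {Q : Store → Prop}

theorem const {r c : ℕ} (h : Q (s.setReg r c)) : HT (.const r c) 1 s Q :=
  ⟨_, _, .const r c s, le_rfl, h⟩

theorem add {r a b : ℕ} (h : Q (s.setReg r (s.reg a + s.reg b))) : HT (.add r a b) 1 s Q :=
  ⟨_, _, .add r a b s, le_rfl, h⟩

theorem sub {r a b : ℕ} (h : Q (s.setReg r (s.reg a - s.reg b))) : HT (.sub r a b) 1 s Q :=
  ⟨_, _, .sub r a b s, le_rfl, h⟩

theorem read {r k a : ℕ} (h : Q (s.setReg r (s.arr k (s.reg a)))) : HT (.read r k a) 1 s Q :=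
  ⟨_, _, .read r k a s, le_rfl, h⟩

theorem write {k a b : ℕ} (h : Q (s.setArr k (s.reg a) (s.reg b))) : HT (.write k a b) 1 s Q :=
  ⟨_, _, .write k a b s, le_rfl, h⟩

/-- A loop whose control register contains a number that decreases by `1` in each iteration. -/
theorem countdown {r : ℕ} {P : Program} {T : ℕ} (Inv : ℕ → Store → Prop)
    (hr : ∀ m s, Inv m s → s.reg r = m)
    (h : ∀ m s, Inv (m + 1) s → HT P T s (Inv m)) (m : ℕ) :
    ∀ s, Inv m s → HT (.while r P) (m * (T + 1) + 1) s (Inv 0) := by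
  induction m with
  | zero =>
    intro s hs
    exact ⟨1, s, Runs.while_stop (hr 0 s hs), by omega, hs⟩
  | succ m ih =>
    intro s hs
    obtain ⟨t, s₁, h1, h2, h3⟩ := h m s hs
    obtain ⟨t', s₂, h1', h2', h3'⟩ := ih s₁ h3
    refine ⟨_, s₂, .while_step (by rw [hr _ s hs]; omega) h1 h1', ?_, h3'⟩
    rw [Nat.add_mul]
    omega

end HT

/-- The stores agree in the registers below `d` and in the arrays. -/
def AgreeBelow (d : ℕ) (s s' : Store) : Prop := (∀ r < d, s'.reg r = s.reg r) ∧ s'.arr = s.arr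

namespace AgreeBelow

theorem refl (d : ℕ) (s : Store) : AgreeBelow d s s := ⟨fun _ _ => rfl, rfl⟩

theorem trans {d : ℕ} {s s' s'' : Store} (h : AgreeBelow d s s') (h' : AgreeBelow d s' s'') :
    AgreeBelow d s s'' :=
  ⟨fun r hr => (h'.1 r hr).trans (h.1 r hr), h'.2.trans h.2⟩

theorem of_le {d d' : ℕ} {s s' : Store} (h : AgreeBelow d' s s') (hd : d ≤ d') :
    AgreeBelow d s s' :=
  ⟨fun r hr => h.1 r (lt_of_lt_of_le hr hd), h.2⟩

theorem setReg {d : ℕ} (s : Store) {r : ℕ} (hr : d ≤ r) (v : ℕ) : AgreeBelow d s (s.setReg r v) :=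
  ⟨fun q hq => by rw [Store.reg_setReg, if_neg (by omega)], rfl⟩

end AgreeBelow

theorem Bounded.of_agreeBelow {d B : ℕ} {s s' : Store} (h : Bounded d B s)
    (ha : AgreeBelow d s s') : Bounded d B s' :=
  h.congr ha.1 ha.2

theorem Expr.eval_of_agreeBelow {d : ℕ} {e : Expr} (he : e.Below d) {s s' : Store}
    (ha : AgreeBelow d s s') : e.eval s' = e.eval s :=
  eval_congr he ha.1 ha.2

/-- The compiled program computes the value of the expression, within the time given by `bound`, and
changes nothing but registers for intermediate results. -/
theorem Expr.compile_spec (e : Expr) : ∀ {d D : ℕ}, e.Below d → d ≤ D → ∀ {B : ℕ} {s : Store},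
    Bounded d B s → HT (compile D e) (e.bound.eval B) s
      fun s' => s'.reg D = e.eval s ∧ AgreeBelow D s s' := by
  induction e with
  | const c =>
    intro d D _ _ B s _
    refine HT.le (HT.const ?_) (by simp [bound])
    exact ⟨by simp [Store.reg_setReg, eval], AgreeBelow.setReg s le_rfl _⟩
  | var r =>
    intro d D he hD B s _
    have he' : r < d := he
    refine HT.le (HT.seq (HT.const (HT.add ?_))) (by simp [bound])
    refine ⟨?_, (AgreeBelow.setReg s le_rfl _).trans (AgreeBelow.setReg _ le_rfl _)⟩
    have : r ≠ D := by omega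
    simp [Store.reg_setReg, eval, this]
  | read k e ih =>
    intro d D he hD B s hs
    refine HT.le (HT.seq ((ih he hD hs).mono le_rfl fun s₁ h₁ => HT.read ?_)) (by simp [bound])
    refine ⟨?_, h₁.2.trans (AgreeBelow.setReg _ le_rfl _)⟩
    simp [Store.reg_setReg, eval, h₁.1, h₁.2.2]
  | add a b iha ihb =>
    intro d D he hD B s hs
    refine HT.le (HT.seq ((iha he.1 hD hs).mono le_rfl fun s₁ h₁ => HT.seq
      ((ihb he.2 (D := D + 1) (by omega) (hs.of_agreeBelow (h₁.2.of_le hD))).mono le_rfl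
        fun s₂ h₂ => HT.add ?_))) (by simp [bound]; omega)
    refine ⟨?_, (h₁.2.trans (h₂.2.of_le (by omega))).trans (AgreeBelow.setReg _ le_rfl _)⟩
    simp [Store.reg_setReg, eval, h₂.1, h₂.2.1 D (by omega), h₁.1,
      eval_of_agreeBelow he.2 (h₁.2.of_le hD)]
  | sub a b iha ihb =>
    intro d D he hD B s hs
    refine HT.le (HT.seq ((iha he.1 hD hs).mono le_rfl fun s₁ h₁ => HT.seq
      ((ihb he.2 (D := D + 1) (by omega) (hs.of_agreeBelow (h₁.2.of_le hD))).mono le_rfl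
        fun s₂ h₂ => HT.sub ?_))) (by simp [bound]; omega)
    refine ⟨?_, (h₁.2.trans (h₂.2.of_le (by omega))).trans (AgreeBelow.setReg _ le_rfl _)⟩
    simp [Store.reg_setReg, eval, h₂.1, h₂.2.1 D (by omega), h₁.1,
      eval_of_agreeBelow he.2 (h₁.2.of_le hD)]
  | mul a b iha ihb =>
    intro d D he hD B s hs
    have loop : ∀ (m : ℕ) (s₂ : Store), s₂.reg (D + 1) = m → s₂.reg (D + 3) = 1 →
        HT (.while (D + 1) (.seq (.sub (D + 1) (D + 1) (D + 3)) (.add D D (D + 2))))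
          (m * 3 + 1) s₂ fun s' => s'.reg D = s₂.reg D + m * s₂.reg (D + 2) ∧
            AgreeBelow D s₂ s' := by
      intro m s₂ h1 h3
      refine (HT.countdown (fun j s' => j ≤ m ∧ s'.reg (D + 1) = j ∧ s'.reg (D + 3) = 1 ∧
        s'.reg (D + 2) = s₂.reg (D + 2) ∧ s'.reg D = s₂.reg D + (m - j) * s₂.reg (D + 2) ∧
        AgreeBelow D s₂ s') (fun j s' h => h.2.1) ?_ m s₂
        ⟨le_rfl, h1, h3, rfl, by simp, AgreeBelow.refl _ _⟩).mono le_rfl ?_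
      · rintro j s' ⟨hj, e1, e3, e2, e0, ha⟩
        refine HT.seq (HT.sub (HT.add ⟨by omega, ?_, ?_, ?_, ?_,
          (ha.trans (AgreeBelow.setReg _ (by omega) _)).trans (AgreeBelow.setReg _ le_rfl _)⟩))
        · simp [Store.reg_setReg, e1, e3]
        · simp [Store.reg_setReg, e3]
        · simp [Store.reg_setReg, e2]
        · have : m - j = (m - (j + 1)) + 1 := by omega
          simp [Store.reg_setReg, e0, e2, this, Nat.add_mul, Nat.add_assoc]
      · rintro s' ⟨_, _, _, _, e0, ha⟩
        exact ⟨by simpa using e0, ha⟩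
    refine HT.le (HT.seq ((iha he.1 (D := D + 1) (by omega) hs).mono le_rfl fun s₁ h₁ => HT.seq
      ((ihb he.2 (D := D + 2) (by omega) (hs.of_agreeBelow (h₁.2.of_le (by omega)))).mono le_rfl
        fun s₂ h₂ => HT.seq (HT.const (HT.seq (HT.const
          ((loop (a.eval s) _ ?_ ?_).mono le_rfl ?_))))))) ?_
    · simp [Store.reg_setReg, h₂.2.1 (D + 1) (by omega), h₁.1]
    · simp [Store.reg_setReg]
    · rintro s' ⟨e0, ha⟩
      refine ⟨?_, (((h₁.2.of_le (by omega)).trans (h₂.2.of_le (by omega))).trans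
        ((AgreeBelow.setReg _ le_rfl _).trans (AgreeBelow.setReg _ (by omega) _))).trans ha⟩
      rw [e0]
      simp [Store.reg_setReg, h₂.1, eval, eval_of_agreeBelow he.2 (h₁.2.of_le (by omega : d ≤ D + 1))]
    · have := eval_le_bound he.1 hs
      simp [bound]; omega
  | sum r b e ihb ihe =>
    intro d D he hD B s hs
    have hr : r < d := he.1
    have loop : ∀ (m : ℕ) (s₂ : Store), m ≤ b.bound.eval B → s₂.reg (D + 1) = m → s₂.reg D = 0 →
        AgreeBelow D s s₂ →
        HT (.while (D + 1) (.seq (.const (D + 3) 1) (.seq (.sub (D + 1) (D + 1) (D + 3))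
          (.seq (.const (D + 3) 0) (.seq (.add r (D + 1) (D + 3))
            (.seq (compile (D + 3) e) (.add D D (D + 3))))))))
          (m * ((1 + (1 + (1 + (1 + (e.bound.eval (B + b.bound.eval B) + 1))))) + 1) + 1) s₂
          fun s' => s'.reg D = ∑ i ∈ Finset.range m, e.eval (s.setReg r i) ∧
            (∀ q < D, q ≠ r → s'.reg q = s.reg q) ∧ s'.reg (D + 2) = s₂.reg (D + 2) ∧
            s'.arr = s.arr := by
      intro m s₂ hm h1 h0 h2
      refine (HT.countdown (fun j s' => j ≤ m ∧ s'.reg (D + 1) = j ∧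
        s'.reg D + ∑ i ∈ Finset.range j, e.eval (s.setReg r i) =
          ∑ i ∈ Finset.range m, e.eval (s.setReg r i) ∧
        (∀ q < D, q ≠ r → s'.reg q = s.reg q) ∧ s'.reg (D + 2) = s₂.reg (D + 2) ∧
        s'.arr = s.arr) (fun j s' h => h.2.1) ?_ m s₂
        ⟨le_rfl, h1, by simp [h0], fun q hq _ => h2.1 q hq, rfl, h2.2⟩).mono le_rfl ?_
      · rintro j s' ⟨hj, e1, e2, e3, e4, e5⟩
        refine HT.seq (HT.const (HT.seq (HT.sub (HT.seq (HT.const (HT.seq (HT.add ?_)))))))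
        set s₃ := (((s'.setReg (D + 3) 1).setReg (D + 1) _).setReg (D + 3) 0).setReg r _ with hs₃
        have hrj : s₃.reg r = j := by
          have : r ≠ D + 1 := by omega
          simp [hs₃, Store.reg_setReg, e1]
        have hag : AgreeBelow d (s.setReg r j) s₃ := by
          refine ⟨fun q hq => ?_, by simp [hs₃, e5]⟩
          by_cases hqr : q = r
          · rw [hqr, hrj]; simp [Store.reg_setReg]
          · have h1 : q ≠ D + 1 := by omega
            have h2 : q ≠ D + 3 := by omega
            simp [hs₃, Store.reg_setReg, hqr, h1, h2, e3 q (by omega) hqr]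
        have hB : Bounded d (B + b.bound.eval B) (s.setReg r j) := by
          refine ⟨fun q hq => ?_, fun k i => (hs.arr k i).trans (by omega)⟩
          rw [Store.reg_setReg]
          split_ifs
          · omega
          · exact (hs.reg q hq).trans (by omega)
        refine HT.seq ((ihe he.2.2 (D := D + 3) (by omega) (hB.of_agreeBelow hag)).mono le_rfl
          fun s₄ h₄ => HT.add ?_)
        have e6 := eval_of_agreeBelow he.2.2 hag
        have h5 : ∀ q < D + 3, s₄.reg q = s₃.reg q := h₄.2.1
        refine ⟨by omega, ?_, ?_, ?_, ?_, ?_⟩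
        · have : D + 1 ≠ r := by omega
          simp [Store.reg_setReg, h5, hs₃, this, e1]
        · rw [← e2, Finset.sum_range_succ]
          have : D ≠ r := by omega
          simp only [Store.reg_setReg, if_true, h₄.1, e6, h5 D (by omega)]
          simp [hs₃, Store.reg_setReg, this]
          ring
        · intro q hq hqr
          have h1 : q ≠ D + 1 := by omega
          have h2 : q ≠ D + 3 := by omega
          have h3 : q ≠ D := by omega
          simp [Store.reg_setReg, h3, h5 q (by omega), hs₃, hqr, h1, h2, e3 q hq hqr]
        · have : D + 2 ≠ r := by omega
          simp [Store.reg_setReg, h5, hs₃, this, e4]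
        · simp [h₄.2.2, hs₃, e5]
      · rintro s' ⟨_, _, e2, e3, e4, e5⟩
        exact ⟨by simpa using e2, e3, e4, e5⟩
    refine HT.le (HT.seq ((ihb he.2.1 (D := D + 1) (by omega) hs).mono le_rfl fun s₁ h₁ => HT.seq
      (HT.const (HT.seq (HT.add (HT.seq (HT.const (HT.seq
        ((loop (b.eval s) _ (eval_le_bound he.2.1 hs) ?_ ?_ ?_).mono le_rfl
          fun s₃ h₃ => HT.seq (HT.const (HT.add ?_))))))))))) ?_
    · simp [Store.reg_setReg, h₁.1]
    · simp [Store.reg_setReg]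
    · exact (h₁.2.of_le (by omega)).trans (((AgreeBelow.setReg _ (by omega) _).trans
        (AgreeBelow.setReg _ (by omega) _)).trans (AgreeBelow.setReg _ (by omega) _))
    · obtain ⟨e0, e1, e2, e3⟩ := h₃
      have hrd : r ≠ D := by omega
      have hrd' : D ≠ r := by omega
      have hrd3 : r ≠ D + 3 := by omega
      refine ⟨?_, fun q hq => ?_, by simp [e3]⟩
      · simp [Store.reg_setReg, hrd', e0, eval]
      · by_cases hqr : q = r
        · subst hqr
          simp [Store.reg_setReg, e2, hrd3, h₁.2.1 q (by omega)]
        · have h2 : q ≠ D + 3 := by omega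
          simp [Store.reg_setReg, hqr, h2, e1 q hq hqr]
    · have h1 := eval_le_bound he.2.1 hs
      have h2 := Nat.mul_le_mul_right (e.bound.eval (B + b.bound.eval B) + 6) h1
      simp only [bound, Polynomial.eval_add, Polynomial.eval_mul, Polynomial.eval_comp,
        Polynomial.eval_X, Polynomial.eval_ofNat]
      have h3 : b.eval s * ((1 + (1 + (1 + (1 + (e.bound.eval (B + b.bound.eval B) + 1))))) + 1) =
        b.eval s * (e.bound.eval (B + b.bound.eval B) + 6) := by ring
      rw [h3]
      omega

/-! ### Assignments, loops, and definitions of arrays -/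

/-- `r := e`. Registers below `40` serve as variables, and the registers from `40` on hold
intermediate results. Register `41` is `0`, so that the addition copies register `40`. -/
def assign (r : ℕ) (e : Expr) : Program :=
  .seq (e.compile 40) (.seq (.const 41 0) (.add r 40 41))

/-- `arr k [i] := e`. -/
def storeArr (k : ℕ) (i e : Expr) : Program :=
  .seq (i.compile 40) (.seq (e.compile 41) (.write k 40 41))

/-- Run `P` for all values of register `r` less than `b`, in increasing order. Register `r + 1`
counts the remaining iterations. -/
def forLoop (r : ℕ) (b : Expr) (P : Program) : Program :=
  .seq (assign (r + 1) b) (.seq (.const r 0)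
    (.while (r + 1) (.seq P (.seq (.const 40 1) (.seq (.add r r 40) (.sub (r + 1) (r + 1) 40))))))

/-- `arr k [v] := e` for all `v` less than register `0`. The value of `v` is in register `14`. -/
def fillVector (k : ℕ) (e : Expr) : Program :=
  forLoop 14 (.var 0) (storeArr k (.var 14) e)

/-- `arr k [u * n + v] := e` for all `u, v` less than the content `n` of register `0`, row by row.
The values of `u` and `v` are in registers `12` and `14`. -/
def fillMatrix (k : ℕ) (e : Expr) : Program :=
  forLoop 12 (.var 0) (forLoop 14 (.var 0)
    (storeArr k (.add (.mul (.var 12) (.var 0)) (.var 14)) e))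

/-- The running time of `forLoop` when the body takes time `p`. -/
def loopBound (b : Expr) (p : Polynomial ℕ) : Polynomial ℕ :=
  b.bound + 4 + Polynomial.X * (p + 4)

/-- The running time of `fillVector`. -/
def fillVectorBound (e : Expr) : Polynomial ℕ :=
  loopBound (.var 0) ((Expr.var 14).bound + e.bound + 1)

/-- The running time of `fillMatrix`. -/
def fillMatrixBound (e : Expr) : Polynomial ℕ :=
  loopBound (.var 0) (loopBound (.var 0)
    ((Expr.add (.mul (.var 12) (.var 0)) (.var 14)).bound + e.bound + 1))

/-- The stores agree in the registers below `40` that are not in `R`. -/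
def AgreeOff (R : List ℕ) (s s' : Store) : Prop :=
  ∀ q < 40, q ∉ R → s'.reg q = s.reg q

theorem AgreeOff.mono {R R' : List ℕ} {s s' : Store} (h : AgreeOff R s s') (hR : R ⊆ R') :
    AgreeOff R' s s' :=
  fun q hq hq' => h q hq fun h'' => hq' (hR h'')

theorem AgreeOff.trans {R : List ℕ} {s s' s'' : Store} (h : AgreeOff R s s')
    (h' : AgreeOff R s' s'') : AgreeOff R s s'' :=
  fun q hq hq' => (h' q hq hq').trans (h q hq hq')

theorem AgreeOff.refl (R : List ℕ) (s : Store) : AgreeOff R s s := fun _ _ _ => rfl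

namespace HT

theorem assign {r : ℕ} {e : Expr} (he : e.Below 40) {B : ℕ} {s : Store}
    (hs : Bounded 40 B s) {Q : Store → Prop}
    (h : ∀ s', s'.reg r = e.eval s → AgreeOff [r] s s' → s'.arr = s.arr → Q s') :
    HT (assign r e) (e.bound.eval B + 2) s Q := by
  refine HT.le (HT.seq ((e.compile_spec he le_rfl hs).mono le_rfl fun s₁ h₁ =>
    HT.seq (HT.const (HT.add (h _ ?_ ?_ ?_))))) (by omega)
  · simp [Store.reg_setReg, h₁.1]
  · intro q hq hqr
    have hqr' : q ≠ r := by simpa using hqr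
    have h2 : q ≠ 41 := by omega
    simp [Store.reg_setReg, hqr', h2, h₁.2.1 q hq]
  · simp [h₁.2.2]

theorem storeArr {k : ℕ} {i e : Expr} (hi : i.Below 40) (he : e.Below 40) {B : ℕ} {s : Store}
    (hs : Bounded 40 B s) {Q : Store → Prop}
    (h : ∀ s', AgreeOff [] s s' → s'.arr = (s.setArr k (i.eval s) (e.eval s)).arr → Q s') :
    HT (storeArr k i e) (i.bound.eval B + e.bound.eval B + 1) s Q := by
  refine HT.le (HT.seq ((i.compile_spec hi le_rfl hs).mono le_rfl fun s₁ h₁ =>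
    HT.seq ((e.compile_spec he (D := 41) (by omega) (hs.of_agreeBelow h₁.2)).mono le_rfl
      fun s₂ h₂ => HT.write (h _ ?_ ?_)))) (by omega)
  · intro q hq _
    rw [Store.reg_setArr, h₂.2.1 q (by omega), h₁.2.1 q hq]
  · rw [h₂.2.1 40 (by omega), h₁.1, h₂.1, Expr.eval_of_agreeBelow he h₁.2]
    unfold Store.setArr
    simp [h₂.2.2, h₁.2.2]

/-- The rule for loops: an invariant that does not depend on the loop counters, and a body that
keeps the counters, which have known values during the iteration `i`. -/
theorem forLoop {r : ℕ} {b : Expr} {P : Program} {p : Polynomial ℕ} {N B : ℕ} {s : Store}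
    (Inv : ℕ → Store → Prop) (hr : r + 1 < 40) (hb : b.Below 40) (hs : Bounded 40 B s)
    (hN : b.eval s = N) (hNB : N ≤ B)
    (hInv : ∀ i s s', Inv i s → AgreeOff [r, r + 1] s s' → s'.arr = s.arr → Inv i s')
    (h0 : Inv 0 s)
    (hstep : ∀ i < N, ∀ s, Inv i s → s.reg r = i → s.reg (r + 1) = N - i →
      HT P (p.eval B) s fun s' => Inv (i + 1) s' ∧ s'.reg r = i ∧ s'.reg (r + 1) = N - i) :
    HT (forLoop r b P) ((loopBound b p).eval B) s
      fun s' => Inv N s' ∧ s'.reg r = N ∧ s'.reg (r + 1) = 0 := by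
  refine HT.le (HT.seq (HT.assign hb hs fun s₁ h1 h2 h3 => HT.seq (HT.const
    ((HT.countdown (T := p.eval B + (1 + (1 + 1))) (fun m s' => m ≤ N ∧ s'.reg (r + 1) = m ∧
      s'.reg r = N - m ∧ Inv (N - m) s') (fun m s' h => h.2.1) ?_ N _ ?_).mono le_rfl ?_)))) ?_
  · rintro m s' ⟨hm, e1, e2, e3⟩
    refine HT.seq ((hstep (N - (m + 1)) (by omega) s' e3 e2 (by omega)).mono le_rfl ?_)
    rintro s₂ ⟨i1, i2, i3⟩
    refine HT.seq (HT.const (HT.seq (HT.add (HT.sub ⟨by omega, ?_, ?_, ?_⟩))))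
    · have : r + 1 ≠ 40 := by omega
      have h4 : (40 : ℕ) ≠ r := by omega
      simp [Store.reg_setReg, i3, this, h4]
      omega
    · have : r ≠ 40 := by omega
      simp [Store.reg_setReg, i2, this]
      omega
    · have : N - m = N - (m + 1) + 1 := by omega
      rw [this]
      refine hInv _ s₂ _ i1 ?_ rfl
      intro q hq hqr
      have hq1 : q ≠ r ∧ q ≠ r + 1 := by simpa using hqr
      have hq2 : q ≠ 40 := by omega
      simp [Store.reg_setReg, hq1.1, hq1.2, hq2]
  · refine ⟨le_rfl, ?_, ?_, ?_⟩
    · simp [Store.reg_setReg, h1, hN]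
    · simp [Store.reg_setReg]
    · rw [Nat.sub_self]
      refine hInv 0 s _ h0 ?_ (by simp [h3])
      intro q hq hqr
      have hq1 : q ≠ r ∧ q ≠ r + 1 := by simpa using hqr
      rw [Store.reg_setReg, if_neg hq1.1, h2 q hq (by simp [hq1.2])]
  · rintro s' ⟨_, e1, e2, e3⟩
    exact ⟨by simpa using e3, by simpa using e2, e1⟩
  · have : N * (p.eval B + (1 + (1 + 1)) + 1) ≤ B * (p.eval B + 4) :=
      Nat.mul_le_mul hNB (by omega)
    simp only [loopBound, Polynomial.eval_add, Polynomial.eval_mul, Polynomial.eval_X,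
      Polynomial.eval_ofNat]
    omega

/-- When the entry `i` is computed, the entries before it already have their new values. -/
theorem fillVector {k : ℕ} {e : Expr} (he : e.Below 40) {B n : ℕ} {s : Store}
    (hs : Bounded 40 B s) (hn : s.reg 0 = n) (val : ℕ → ℕ) (hval : ∀ i < n, val i ≤ B)
    (heval : ∀ i < n, ∀ s', AgreeOff [14, 15] s s' → s'.reg 14 = i →
      s'.arr = Function.update s.arr k (fun j => if j < i then val j else s.arr k j) →
      e.eval s' = val i)
    {Q : Store → Prop}
    (h : ∀ s', Bounded 40 B s' → AgreeOff [14, 15] s s' →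
      s'.arr = Function.update s.arr k (fun j => if j < n then val j else s.arr k j) → Q s') :
    HT (fillVector k e) ((fillVectorBound e).eval B) s Q := by
  have hnB : n ≤ B := hn ▸ hs.reg 0 (by omega)
  have harr : ∀ i, i ≤ n → ∀ s' : Store,
      s'.arr = Function.update s.arr k (fun j => if j < i then val j else s.arr k j) →
      ∀ k' j, s'.arr k' j ≤ B := by
    intro i hi s' hs' k' j
    rw [hs', Function.update_apply]
    split_ifs with h1
    · dsimp only
      split_ifs with h2
      · exact hval j (by omega)
      · exact hs.arr k j
    · exact hs.arr k' j
  have hreg : ∀ s', AgreeOff [14, 15] s s' → s'.reg 14 ≤ B → s'.reg 15 ≤ B → ∀ r < 40, s'.reg r ≤ B := by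
    intro s' h1 h2 h3 r hr
    by_cases h4 : r = 14
    · rw [h4]; exact h2
    by_cases h5 : r = 15
    · rw [h5]; exact h3
    rw [h1 r hr (by simp [h4, h5])]
    exact hs.reg r hr
  refine (HT.forLoop (b := .var 0) (p := (Expr.var 14).bound + e.bound + 1) (N := n)
    (fun i s' => AgreeOff [14, 15] s s' ∧
      s'.arr = Function.update s.arr k (fun j => if j < i then val j else s.arr k j))
    (by omega) (by decide) hs hn hnB ?_ ?_ ?_).mono le_rfl ?_
  · rintro i s₁ s₂ ⟨h1, h2⟩ h3 h4
    exact ⟨h1.trans h3, h4.trans h2⟩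
  · exact ⟨AgreeOff.refl _ _, by simp⟩
  · rintro i hi s₁ ⟨h1, h2⟩ h3 h4
    replace h4 : s₁.reg 15 = n - i := h4
    refine HT.le (HT.storeArr (by decide) he (B := B)
      ⟨hreg s₁ h1 (by omega) (by omega), harr i hi.le s₁ h2⟩ fun s₂ h5 h6 => ⟨⟨?_, ?_⟩, ?_, ?_⟩) ?_
    · exact h1.trans (h5.mono (by simp))
    · rw [h6, heval i hi s₁ h1 h3 h2]
      simp only [Store.setArr, h2, Expr.eval, h3]
      rw [Function.update_idem, Function.update_self]
      congr 1
      funext j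
      rw [Function.update_apply]
      by_cases hj : j = i
      · simp [hj]
      · rw [if_neg hj]
        congr 1
        simp only [eq_iff_iff]
        omega
    · rw [h5 14 (by omega) (by simp), h3]
    · rw [h5 15 (by omega) (by simp), h4]
    · simp
  · rintro s' ⟨⟨h1, h2⟩, h3, h4⟩
    replace h4 : s'.reg 15 = 0 := h4
    exact h s' ⟨hreg s' h1 (by omega) (by omega), harr n le_rfl s' h2⟩ h1 h2

/-- When an entry is computed, the entries before it already have their new values. In `val` the
matrix is indexed by the position in the array. -/
theorem fillMatrix {k : ℕ} {e : Expr} (he : e.Below 40) {B n : ℕ} {s : Store}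
    (hs : Bounded 40 B s) (hn : s.reg 0 = n) (val : ℕ → ℕ) (hval : ∀ i < n * n, val i ≤ B)
    (heval : ∀ u < n, ∀ v < n, ∀ s', AgreeOff [12, 13, 14, 15] s s' → s'.reg 12 = u →
      s'.reg 14 = v →
      s'.arr = Function.update s.arr k
        (fun j => if j < u * n + v then val j else s.arr k j) →
      e.eval s' = val (u * n + v))
    {Q : Store → Prop}
    (h : ∀ s', Bounded 40 B s' → AgreeOff [12, 13, 14, 15] s s' →
      s'.arr = Function.update s.arr k (fun j => if j < n * n then val j else s.arr k j) → Q s') :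
    HT (fillMatrix k e) ((fillMatrixBound e).eval B) s Q := by
  have hnB : n ≤ B := hn ▸ hs.reg 0 (by omega)
  have harr : ∀ i, i ≤ n * n → ∀ s' : Store,
      s'.arr = Function.update s.arr k (fun j => if j < i then val j else s.arr k j) →
      ∀ k' j, s'.arr k' j ≤ B := by
    intro i hi s' hs' k' j
    rw [hs', Function.update_apply]
    split_ifs with h1
    · dsimp only
      split_ifs with h2
      · exact hval j (by omega)
      · exact hs.arr k j
    · exact hs.arr k' j
  have hreg : ∀ s', AgreeOff [12, 13, 14, 15] s s' → s'.reg 12 ≤ B → s'.reg 13 ≤ B →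
      s'.reg 14 ≤ B → s'.reg 15 ≤ B → ∀ r < 40, s'.reg r ≤ B := by
    intro s' h1 h2 h3 h4 h5 r hr
    by_cases h6 : r = 12
    · rw [h6]; exact h2
    by_cases h7 : r = 13
    · rw [h7]; exact h3
    by_cases h8 : r = 14
    · rw [h8]; exact h4
    by_cases h9 : r = 15
    · rw [h9]; exact h5
    rw [h1 r hr (by simp [h6, h7, h8, h9])]
    exact hs.reg r hr
  refine (HT.forLoop (b := .var 0) (p := loopBound (.var 0)
      ((Expr.add (.mul (.var 12) (.var 0)) (.var 14)).bound + e.bound + 1)) (N := n)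
    (fun u s' => AgreeOff [12, 13, 14, 15] s s' ∧ s'.reg 14 ≤ B ∧ s'.reg 15 ≤ B ∧
      s'.arr = Function.update s.arr k (fun j => if j < u * n then val j else s.arr k j))
    (by omega) (by decide) hs hn hnB ?_ ?_ ?_).mono le_rfl ?_
  · rintro i s₁ s₂ ⟨h1, h14, h15, h2⟩ h3 h4
    refine ⟨h1.trans (h3.mono (by simp)), ?_, ?_, h4.trans h2⟩
    · rw [h3 14 (by omega) (by simp)]; exact h14
    · rw [h3 15 (by omega) (by simp)]; exact h15
  · exact ⟨AgreeOff.refl _ _, hs.reg 14 (by omega), hs.reg 15 (by omega), by simp⟩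
  · rintro u hu s₁ ⟨h1, h14, h15, h2⟩ h3 h4
    replace h4 : s₁.reg 13 = n - u := h4
    have hun : u * n + n ≤ n * n := by
      rw [← Nat.succ_mul]; exact Nat.mul_le_mul_right n hu
    refine (HT.forLoop (b := .var 0)
      (p := (Expr.add (.mul (.var 12) (.var 0)) (.var 14)).bound + e.bound + 1)
      (N := n) (fun v s' => AgreeOff [14, 15] s₁ s' ∧
      s'.arr = Function.update s.arr k (fun j => if j < u * n + v then val j else s.arr k j))
      (by omega) (by decide) (B := B)
      ⟨hreg s₁ h1 (by omega) (by omega) h14 h15, harr _ (by omega) s₁ h2⟩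
      ((h1 0 (by omega) (by simp)).trans hn) hnB ?_ ⟨AgreeOff.refl _ _, by simpa using h2⟩ ?_).mono
      le_rfl ?_
    · rintro i s₂ s₃ ⟨h5, h6⟩ h7 h8
      exact ⟨h5.trans h7, h8.trans h6⟩
    · rintro v hv s₂ ⟨h5, h6⟩ h7 h8
      replace h8 : s₂.reg 15 = n - v := h8
      have h9 : AgreeOff [12, 13, 14, 15] s s₂ := h1.trans (h5.mono (by simp))
      have h12 : s₂.reg 12 = u := by rw [h5 12 (by omega) (by simp), h3]
      have h13 : s₂.reg 13 = n - u := by rw [h5 13 (by omega) (by simp), h4]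
      have h0 : s₂.reg 0 = n := by rw [h9 0 (by omega) (by simp), hn]
      refine HT.le (HT.storeArr (by decide) he (B := B)
        ⟨hreg s₂ h9 (by omega) (by omega) (by omega) (by omega),
          harr (u * n + v) (by omega) s₂ h6⟩ fun s₃ h10 h11 => ⟨⟨?_, ?_⟩, ?_, ?_⟩) ?_
      · exact h5.trans (h10.mono (by simp))
      · rw [h11, heval u hu v hv s₂ h9 h12 h7 h6]
        simp only [Store.setArr, h6, Expr.eval, h12, h0, h7]
        rw [Function.update_idem, Function.update_self]
        congr 1
        funext j
        rw [Function.update_apply]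
        by_cases hj : j = u * n + v
        · simp [hj]
        · rw [if_neg hj]
          congr 1
          simp only [eq_iff_iff]
          omega
      · rw [h10 14 (by omega) (by simp), h7]
      · rw [h10 15 (by omega) (by simp), h8]
      · simp
    · rintro s' ⟨⟨h5, h6⟩, h7, h8⟩
      replace h8 : s'.reg 15 = 0 := h8
      refine ⟨⟨h1.trans (h5.mono (by simp)), by omega, by omega, ?_⟩, ?_, ?_⟩
      · rw [h6, Nat.succ_mul]
      · rw [h5 12 (by omega) (by simp), h3]
      · rw [h5 13 (by omega) (by simp), h4]
  · rintro s' ⟨⟨h1, h14, h15, h2⟩, h3, h4⟩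
    replace h4 : s'.reg 13 = 0 := h4
    exact h s' ⟨hreg s' h1 (by omega) (by omega) h14 h15, harr _ le_rfl s' h2⟩ h1 h2

end HT

/-! ### An integer subgradient method for the linear program -/

section Subgradient

variable {n : ℕ} (G : SimpleGraph (Fin n)) [DecidableRel G.Adj]

/-- The positive part of the subgradient of `penalized` at `X`. -/
def gradPos (X : Fin n → Fin n → ℕ) (u v : Fin n) : ℕ :=
  (if G.Adj u v then 1 else 0) + n ^ 2 * ∑ w, if X u w + X w v < X u v then 1 else 0

/-- The negative part of the subgradient of `penalized` at `X`. -/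
def gradNeg (X : Fin n → Fin n → ℕ) (u v : Fin n) : ℕ :=
  (if G.Adj u v then 0 else 1) + n ^ 2 * ∑ w,
    ((if X u v + X v w < X u w then 1 else 0) + if X w u + X u v < X w v then 1 else 0)

/-- One step of the projected subgradient method on the matrices with entries in `[0, M]` and zero
diagonal. -/
def lpStep (M : ℕ) (X : Fin n → Fin n → ℕ) (u v : Fin n) : ℕ :=
  if u = v then 0 else min M (X u v + gradNeg G X u v - gradPos G X u v)

/-- The iterates of the subgradient method with step size `1`. On the scale on which `M` stands for
`1`, the step size is small. -/
def lpIter (M : ℕ) : ℕ → Fin n → Fin n → ℕ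
  | 0 => fun _ _ => 0
  | t + 1 => lpStep G M (lpIter M t)

/-- The sum of the first `T` iterates. -/
def lpSum (M T : ℕ) (u v : Fin n) : ℕ := ∑ t ∈ Finset.range T, lpIter G M t u v

/-- The total violation of the triangle inequality. -/
def totalViolation (Z : Fin n → Fin n → ℕ) : ℕ :=
  ∑ u, ∑ v, ∑ w, (Z u w - (Z u v + Z v w))

/-- Adding the total violation to all off-diagonal entries restores the triangle inequality. -/
def repair (K : ℕ) (Z : Fin n → Fin n → ℕ) (u v : Fin n) : ℕ :=
  if u = v then 0 else min K (Z u v + totalViolation Z)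

/-- The linear part of the objective function. -/
def linearPart (X : Fin n → Fin n → ℝ) : ℝ :=
  ∑ u, ∑ v, if u = v then 0 else if G.Adj u v then X u v else -X u v

/-- The sum of the violations of the triangle inequality. -/
def violationPart (X : Fin n → Fin n → ℝ) : ℝ :=
  ∑ u, ∑ v, ∑ w, max 0 (X u w - X u v - X v w)

/-- The linear part of the objective function with an exact penalty for violations of the triangle
inequality. This function is convex and positively homogeneous. -/
def penalized (X : Fin n → Fin n → ℝ) : ℝ := linearPart G X + n ^ 2 * violationPart X

/-- A subgradient of `penalized` at `X`: a violated triangle inequality contributes its coefficients. -/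
def grad (X : Fin n → Fin n → ℕ) (u v : Fin n) : ℝ := (gradPos G X u v : ℝ) - gradNeg G X u v

theorem sum_indicator_le (p : Fin n → Prop) [DecidablePred p] :
    (∑ w, if p w then 1 else 0) ≤ n := by
  have := Finset.sum_le_card_nsmul (Finset.univ : Finset (Fin n)) (fun w => if p w then 1 else 0) 1
    (fun w _ => by split_ifs <;> omega)
  simpa using this

theorem abs_grad_le (X : Fin n → Fin n → ℕ) (u v : Fin n) : |grad G X u v| ≤ 1 + 2 * n ^ 3 := by
  have h1 : gradPos G X u v ≤ 1 + 2 * n ^ 3 := by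
    have := Nat.mul_le_mul_left (n ^ 2) (sum_indicator_le fun w => X u w + X w v < X u v)
    have e : n ^ 2 * n = n ^ 3 := by ring
    rw [e] at this
    unfold gradPos
    split_ifs <;> omega
  have h2 : gradNeg G X u v ≤ 1 + 2 * n ^ 3 := by
    have h3 := Nat.mul_le_mul_left (n ^ 2) (sum_indicator_le fun w => X u v + X v w < X u w)
    have h4 := Nat.mul_le_mul_left (n ^ 2) (sum_indicator_le fun w => X w u + X u v < X w v)
    have e : n ^ 2 * n = n ^ 3 := by ring
    rw [e] at h3 h4
    unfold gradNeg
    rw [Finset.sum_add_distrib, mul_add]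
    split_ifs <;> omega
  unfold grad
  have h1' : (gradPos G X u v : ℝ) ≤ 1 + 2 * n ^ 3 := by exact_mod_cast h1
  have h2' : (gradNeg G X u v : ℝ) ≤ 1 + 2 * n ^ 3 := by exact_mod_cast h2
  have h3 : (0 : ℝ) ≤ gradPos G X u v := Nat.cast_nonneg _
  have h4 : (0 : ℝ) ≤ gradNeg G X u v := Nat.cast_nonneg _
  rw [abs_le]
  constructor <;> linarith

/-- The sum over the violated triangle inequalities, in place of the sum over the entries. -/
theorem sum_grad_mul (X : Fin n → Fin n → ℕ) {D : Fin n → Fin n → ℝ} (hD : ∀ u, D u u = 0) :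
    ∑ u, ∑ v, grad G X u v * D u v = linearPart G D + n ^ 2 * ∑ u, ∑ v, ∑ w,
      (if X u v + X v w < X u w then D u w - D u v - D v w else 0) := by
  have e : ∀ u v, grad G X u v * D u v =
      (if u = v then 0 else if G.Adj u v then D u v else -D u v)
      + n ^ 2 * ((∑ w, if X u w + X w v < X u v then D u v else 0)
        - (∑ w, if X u v + X v w < X u w then D u v else 0)
        - ∑ w, if X w u + X u v < X w v then D u v else 0) := by
    intro u v
    have h0 : (((if G.Adj u v then 1 else 0 : ℕ) : ℝ) - ((if G.Adj u v then 0 else 1 : ℕ) : ℝ))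
        * D u v = if u = v then 0 else if G.Adj u v then D u v else -D u v := by
      by_cases huv : u = v
      · subst huv; simp [hD]
      · split_ifs <;> simp
    have h1 : ∀ p : Fin n → Prop, ∀ [DecidablePred p],
        (∑ w, if p w then D u v else 0) = (∑ w, if p w then (1 : ℝ) else 0) * D u v := by
      intro p _
      rw [Finset.sum_mul]
      exact Finset.sum_congr rfl fun w _ => by split_ifs <;> simp
    rw [← h0, h1, h1, h1]
    unfold grad gradPos gradNeg
    push_cast
    rw [Finset.sum_add_distrib]
    ring
  simp only [e, Finset.sum_add_distrib, ← Finset.mul_sum, Finset.sum_sub_distrib]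
  unfold linearPart
  congr 2
  have e1 : ∑ u, ∑ v, ∑ w, (if X u w + X w v < X u v then D u v else 0) =
      ∑ u, ∑ v, ∑ w, (if X u v + X v w < X u w then D u w else 0) :=
    Finset.sum_congr rfl fun u _ => Finset.sum_comm
  have e2 : ∑ u, ∑ v, ∑ w, (if X w u + X u v < X w v then D u v else 0) =
      ∑ u, ∑ v, ∑ w, (if X u v + X v w < X u w then D v w else 0) := by
    rw [Finset.sum_comm]
    have : ∀ v, ∑ u, ∑ w, (if X w u + X u v < X w v then D u v else 0) =
        ∑ u, ∑ w, (if X u w + X w v < X u v then D w v else 0) := fun v => Finset.sum_comm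
    simp only [this]
    rw [Finset.sum_comm]
    exact Finset.sum_congr rfl fun u _ => Finset.sum_comm
  rw [e1, e2]
  simp only [← Finset.sum_sub_distrib]
  refine Finset.sum_congr rfl fun u _ => Finset.sum_congr rfl fun v _ =>
    Finset.sum_congr rfl fun w _ => ?_
  split_ifs <;> simp

theorem linearPart_sub (X Y : Fin n → Fin n → ℝ) :
    linearPart G (fun u v => X u v - Y u v) = linearPart G X - linearPart G Y := by
  simp only [linearPart, ← Finset.sum_sub_distrib]
  refine Finset.sum_congr rfl fun u _ => Finset.sum_congr rfl fun v _ => ?_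
  split_ifs <;> ring

/-- The subgradient inequality. -/
theorem penalized_sub_le (X : Fin n → Fin n → ℕ) (Y : Fin n → Fin n → ℝ) (hX : ∀ u, X u u = 0)
    (hY : ∀ u, Y u u = 0) :
    penalized G (fun u v => X u v) - penalized G Y ≤
      ∑ u, ∑ v, grad G X u v * ((X u v : ℝ) - Y u v) := by
  rw [sum_grad_mul G X (D := fun u v => (X u v : ℝ) - Y u v) (fun u => by simp [hX, hY]),
    linearPart_sub G (fun u v => (X u v : ℝ)) Y]
  unfold penalized violationPart
  have h : ∑ u, ∑ v, ∑ w, max 0 ((X u w : ℝ) - X u v - X v w)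
      - ∑ u, ∑ v, ∑ w, max 0 (Y u w - Y u v - Y v w) ≤
      ∑ u, ∑ v, ∑ w, (if X u v + X v w < X u w then
        ((X u w : ℝ) - Y u w) - ((X u v : ℝ) - Y u v) - ((X v w : ℝ) - Y v w) else 0) := by
    simp only [← Finset.sum_sub_distrib]
    refine Finset.sum_le_sum fun u _ => Finset.sum_le_sum fun v _ => Finset.sum_le_sum fun w _ => ?_
    split_ifs with hc
    · have hc' : (X u v : ℝ) + X v w < X u w := by exact_mod_cast hc
      rw [max_eq_right (by linarith)]
      have := le_max_right 0 (Y u w - Y u v - Y v w)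
      linarith
    · have hc' : (X u w : ℝ) ≤ X u v + X v w := by exact_mod_cast not_lt.1 hc
      rw [max_eq_left (by linarith)]
      have := le_max_left 0 (Y u w - Y u v - Y v w)
      linarith
  have := mul_le_mul_of_nonneg_left h (show (0 : ℝ) ≤ n ^ 2 by positivity)
  linarith

/-- Truncation to `[0, M]` does not increase the distance to a point of the box. -/
theorem lpStep_dist (M : ℕ) (X : Fin n → Fin n → ℕ) (hX : ∀ u, X u u = 0) (Y : Fin n → Fin n → ℝ)
    (hY : ∀ u, Y u u = 0) (hY0 : ∀ u v, 0 ≤ Y u v) (hYM : ∀ u v, Y u v ≤ M) (u v : Fin n) :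
    ((lpStep G M X u v : ℝ) - Y u v) ^ 2 ≤ ((X u v : ℝ) - Y u v) ^ 2
      - 2 * (grad G X u v * ((X u v : ℝ) - Y u v)) + (1 + 2 * n ^ 3) ^ 2 := by
  have hg : grad G X u v ^ 2 ≤ (1 + 2 * n ^ 3) ^ 2 := by
    rw [← sq_abs]
    exact pow_le_pow_left₀ (abs_nonneg _) (abs_grad_le G X u v) 2
  by_cases huv : u = v
  · subst huv
    simp only [lpStep, if_true, hX, hY]
    norm_num
    positivity
  suffices h : ((lpStep G M X u v : ℝ) - Y u v) ^ 2 ≤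
      ((X u v : ℝ) - grad G X u v - Y u v) ^ 2 by nlinarith
  have hy0 := hY0 u v
  have hyM := hYM u v
  simp only [lpStep, if_neg huv]
  unfold grad
  set g := gradPos G X u v
  set h := gradNeg G X u v
  rcases le_total (X u v + h) g with hc | hc
  · rw [Nat.sub_eq_zero_of_le hc]
    have hc' : (X u v : ℝ) + h ≤ g := by exact_mod_cast hc
    rw [Nat.min_zero, Nat.cast_zero]
    nlinarith
  · have e : ((X u v + h - g : ℕ) : ℝ) = (X u v : ℝ) + h - g := by
      rw [Nat.cast_sub hc]; push_cast; ring
    rw [Nat.cast_min, e]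
    rcases le_total (M : ℝ) ((X u v : ℝ) + h - g) with hc' | hc'
    · rw [min_eq_left hc']
      nlinarith
    · rw [min_eq_right hc']
      exact le_of_eq (by ring)

theorem lpIter_self (M t : ℕ) (u : Fin n) : lpIter G M t u u = 0 := by
  cases t with
  | zero => rfl
  | succ t => exact if_pos rfl

theorem lpIter_le (M t : ℕ) (u v : Fin n) : lpIter G M t u v ≤ M := by
  cases t with
  | zero => exact Nat.zero_le _
  | succ t =>
    change lpStep G M (lpIter G M t) u v ≤ M
    unfold lpStep
    split_ifs
    · exact Nat.zero_le _
    · exact min_le_left _ _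

theorem lpStep_comm (M : ℕ) {X : Fin n → Fin n → ℕ} (hX : ∀ u v, X u v = X v u) (u v : Fin n) :
    lpStep G M X u v = lpStep G M X v u := by
  have h1 : gradPos G X u v = gradPos G X v u := by
    unfold gradPos
    simp only [G.adj_comm u v]
    congr 2
    refine Finset.sum_congr rfl fun w _ => ?_
    rw [hX u w, hX w v, hX u v, add_comm]
  have h2 : gradNeg G X u v = gradNeg G X v u := by
    unfold gradNeg
    simp only [G.adj_comm u v]
    congr 2
    refine Finset.sum_congr rfl fun w _ => ?_
    rw [hX w u, hX w v, hX u v, add_comm (X u w), add_comm (X v u), add_comm (ite _ _ _)]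
  unfold lpStep
  rw [h1, h2, hX u v]
  simp only [eq_comm (a := u)]

theorem lpIter_comm (M t : ℕ) : ∀ u v : Fin n, lpIter G M t u v = lpIter G M t v u := by
  induction t with
  | zero => exact fun _ _ => rfl
  | succ t ih => exact lpStep_comm G M ih

theorem lpSum_le (M T : ℕ) (u v : Fin n) : lpSum G M T u v ≤ T * M := by
  have := Finset.sum_le_card_nsmul (Finset.range T) (fun t => lpIter G M t u v) M
    fun t _ => lpIter_le G M t u v
  simpa [lpSum] using this

theorem lpSum_comm (M T : ℕ) (u v : Fin n) : lpSum G M T u v = lpSum G M T v u :=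
  Finset.sum_congr rfl fun t _ => lpIter_comm G M t u v

/-- Convexity and homogeneity. -/
theorem penalized_lpSum_le (M T : ℕ) :
    penalized G (fun u v => (lpSum G M T u v : ℝ)) ≤
      ∑ t ∈ Finset.range T, penalized G fun u v => (lpIter G M t u v : ℝ) := by
  induction T with
  | zero => simp [penalized, linearPart, violationPart, lpSum]
  | succ T ih =>
    rw [Finset.sum_range_succ]
    refine le_trans ?_ (add_le_add_left ih _)
    have e : ∀ u v, (lpSum G M (T + 1) u v : ℝ) = lpSum G M T u v + lpIter G M T u v := by
      intro u v
      unfold lpSum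
      rw [Finset.sum_range_succ]; push_cast; rfl
    have h1 : linearPart G (fun u v => (lpSum G M (T + 1) u v : ℝ)) =
        linearPart G (fun u v => (lpSum G M T u v : ℝ))
        + linearPart G (fun u v => (lpIter G M T u v : ℝ)) := by
      simp only [linearPart, ← Finset.sum_add_distrib, e]
      refine Finset.sum_congr rfl fun u _ => Finset.sum_congr rfl fun v _ => ?_
      split_ifs <;> ring
    have h2 : violationPart (fun u v => (lpSum G M (T + 1) u v : ℝ)) ≤
        violationPart (fun u v => (lpSum G M T u v : ℝ))
        + violationPart (fun u v => (lpIter G M T u v : ℝ)) := by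
      simp only [violationPart, ← Finset.sum_add_distrib, e]
      refine Finset.sum_le_sum fun u _ => Finset.sum_le_sum fun v _ =>
        Finset.sum_le_sum fun w _ => ?_
      refine max_le (add_nonneg (le_max_left _ _) (le_max_left _ _)) ?_
      refine le_trans (le_of_eq ?_) (add_le_add (le_max_right _ _) (le_max_right _ _))
      ring
    have := mul_le_mul_of_nonneg_left h2 (show (0 : ℝ) ≤ n ^ 2 by positivity)
    unfold penalized
    linarith

/-- The convergence of the subgradient method: the squared distances to `Y` telescope. -/
theorem two_mul_penalized_lpSum_le (M T : ℕ) (Y : Fin n → Fin n → ℝ)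
    (hY : ∀ u, Y u u = 0) (hY0 : ∀ u v, 0 ≤ Y u v) (hYM : ∀ u v, Y u v ≤ M) :
    2 * (penalized G (fun u v => (lpSum G M T u v : ℝ)) - T * penalized G Y) ≤
      n ^ 2 * (M : ℝ) ^ 2 + T * (n ^ 2 * (1 + 2 * n ^ 3) ^ 2) := by
  have step : ∀ t, 2 * (penalized G (fun u v => (lpIter G M t u v : ℝ)) - penalized G Y) ≤
      (∑ u, ∑ v, ((lpIter G M t u v : ℝ) - Y u v) ^ 2)
      - (∑ u, ∑ v, ((lpIter G M (t + 1) u v : ℝ) - Y u v) ^ 2)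
      + n ^ 2 * (1 + 2 * n ^ 3) ^ 2 := by
    intro t
    have h1 := penalized_sub_le G (lpIter G M t) Y (lpIter_self G M t) hY
    have h2 : ∑ u, ∑ v, ((lpIter G M (t + 1) u v : ℝ) - Y u v) ^ 2 ≤
        ∑ u : Fin n, ∑ v : Fin n, (((lpIter G M t u v : ℝ) - Y u v) ^ 2
        - 2 * (grad G (lpIter G M t) u v * ((lpIter G M t u v : ℝ) - Y u v))
        + (1 + 2 * n ^ 3) ^ 2) :=
      Finset.sum_le_sum fun u _ => Finset.sum_le_sum fun v _ =>
        lpStep_dist G M _ (lpIter_self G M t) Y hY hY0 hYM u v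
    simp only [Finset.sum_add_distrib, Finset.sum_sub_distrib, ← Finset.mul_sum, Finset.sum_const,
      Finset.card_univ, Fintype.card_fin, nsmul_eq_mul] at h2
    linarith
  have total : ∀ T : ℕ, 2 * (∑ t ∈ Finset.range T,
      penalized G (fun u v => (lpIter G M t u v : ℝ)) - T * penalized G Y) ≤
      (∑ u, ∑ v, ((lpIter G M 0 u v : ℝ) - Y u v) ^ 2)
      - (∑ u, ∑ v, ((lpIter G M T u v : ℝ) - Y u v) ^ 2)
      + T * (n ^ 2 * (1 + 2 * n ^ 3) ^ 2) := by
    intro T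
    induction T with
    | zero => simp
    | succ T ih =>
      rw [Finset.sum_range_succ]
      push_cast
      linarith [step T]
  have h0 : ∑ u, ∑ v, ((lpIter G M 0 u v : ℝ) - Y u v) ^ 2 ≤ n ^ 2 * (M : ℝ) ^ 2 := by
    have : ∑ u, ∑ v, ((lpIter G M 0 u v : ℝ) - Y u v) ^ 2 ≤
        ∑ _u : Fin n, ∑ _v : Fin n, (M : ℝ) ^ 2 := by
      refine Finset.sum_le_sum fun u _ => Finset.sum_le_sum fun v _ => ?_
      have e : (lpIter G M 0 u v : ℝ) = 0 := by simp [lpIter]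
      rw [e, zero_sub, neg_sq]
      exact pow_le_pow_left₀ (hY0 u v) (hYM u v) 2
    refine this.trans (le_of_eq ?_)
    simp only [Finset.sum_const, Finset.card_univ, Fintype.card_fin, nsmul_eq_mul]
    ring
  have hT : 0 ≤ ∑ u, ∑ v, ((lpIter G M T u v : ℝ) - Y u v) ^ 2 :=
    Finset.sum_nonneg fun u _ => Finset.sum_nonneg fun v _ => sq_nonneg _
  have := total T
  have := penalized_lpSum_le G M T
  linarith

theorem violation_le_total (Z : Fin n → Fin n → ℕ) (u v w : Fin n) :
    Z u w ≤ Z u v + Z v w + totalViolation Z := by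
  have h1 : Z u w - (Z u v + Z v w) ≤ ∑ w, (Z u w - (Z u v + Z v w)) :=
    Finset.single_le_sum (f := fun w => Z u w - (Z u v + Z v w)) (fun _ _ => Nat.zero_le _)
      (Finset.mem_univ w)
  have h2 : ∑ w, (Z u w - (Z u v + Z v w)) ≤ ∑ v, ∑ w, (Z u w - (Z u v + Z v w)) :=
    Finset.single_le_sum (f := fun v => ∑ w, (Z u w - (Z u v + Z v w))) (fun _ _ => Nat.zero_le _)
      (Finset.mem_univ v)
  have h3 : ∑ v, ∑ w, (Z u w - (Z u v + Z v w)) ≤ totalViolation Z :=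
    Finset.single_le_sum (f := fun u => ∑ v, ∑ w, (Z u w - (Z u v + Z v w)))
      (fun _ _ => Nat.zero_le _) (Finset.mem_univ u)
  omega

theorem repair_comm (K : ℕ) {Z : Fin n → Fin n → ℕ} (hZ : ∀ u v, Z u v = Z v u) (u v : Fin n) :
    repair K Z u v = repair K Z v u := by
  unfold repair
  rw [hZ u v]
  simp only [eq_comm (a := u)]

theorem repair_le (K : ℕ) (Z : Fin n → Fin n → ℕ) (u v : Fin n) : repair K Z u v ≤ K := by
  unfold repair
  split_ifs
  · exact Nat.zero_le _
  · exact min_le_left _ _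

theorem repair_triangle (K : ℕ) (Z : Fin n → Fin n → ℕ) (u v w : Fin n) :
    repair K Z u w ≤ repair K Z u v + repair K Z v w := by
  have h := violation_le_total Z u v w
  unfold repair
  by_cases h1 : u = v
  · subst h1; simp
  · by_cases h2 : v = w
    · subst h2; simp
    · rw [if_neg h1, if_neg h2]
      split_ifs <;> omega

/-- The solution of the linear program given by a symmetric matrix with entries in `[0, K]`. -/
def solutionOf (K : ℕ) (W : Fin n → Fin n → ℕ) (hW : ∀ u v, W u v = W v u)
    (hK : ∀ u v, W u v ≤ K) (e : Sym2 (Fin n)) : I :=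
  ⟨Sym2.lift ⟨fun u v => (W u v : ℝ) / K, fun u v => by
    change (W u v : ℝ) / K = (W v u : ℝ) / K
    rw [hW u v]⟩ e, by
    induction e with
    | _ u v =>
      rw [Sym2.lift_mk]
      exact ⟨by positivity, div_le_one_of_le₀ (by exact_mod_cast hK u v) (by positivity)⟩⟩

theorem solutionOf_mk (K : ℕ) (W : Fin n → Fin n → ℕ) (hW : ∀ u v, W u v = W v u)
    (hK : ∀ u v, W u v ≤ K) (u v : Fin n) :
    (solutionOf K W hW hK s(u, v) : ℝ) = (W u v : ℝ) / K := rfl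

theorem solutionOf_isFeasible (K : ℕ) (W : Fin n → Fin n → ℕ) (hW : ∀ u v, W u v = W v u)
    (hK : ∀ u v, W u v ≤ K) (h0 : ∀ u, W u u = 0) (htri : ∀ u v w, W u w ≤ W u v + W v w) :
    IsFeasible (solutionOf K W hW hK) where
  diag u := by
    apply Subtype.ext
    rw [solutionOf_mk, h0]
    simp
  triangle u v w := by
    simp only [solutionOf_mk]
    rw [← add_div]
    exact div_le_div_of_nonneg_right (by exact_mod_cast htri u v w) (by positivity)

theorem two_mul_lpCost_eq (x : Sym2 (Fin n) → I) :
    2 * lpCost G x = linearPart G (fun u v => (x s(u, v) : ℝ))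
      + ∑ u, ∑ v, (if u = v then 0 else if G.Adj u v then 0 else 1) := by
  rw [two_mul_lpCost, pairSum, linearPart]
  simp only [← Finset.sum_add_distrib]
  refine Finset.sum_congr rfl fun u _ => Finset.sum_congr rfl fun v _ => ?_
  unfold pairLP
  split_ifs <;> ring

theorem linearPart_mul (c : ℝ) (X : Fin n → Fin n → ℝ) :
    linearPart G (fun u v => c * X u v) = c * linearPart G X := by
  simp only [linearPart, Finset.mul_sum]
  refine Finset.sum_congr rfl fun u _ => Finset.sum_congr rfl fun v _ => ?_
  split_ifs <;> ring

/-- The repair increases each of the `n ^ 2` entries by at most the total violation, which the penalty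
term pays for. -/
theorem linearPart_repair_le {K : ℕ} {Z : Fin n → Fin n → ℕ} (hZ : ∀ u v, Z u v ≤ K) :
    linearPart G (fun u v => (repair K Z u v : ℝ)) ≤ penalized G fun u v => (Z u v : ℝ) := by
  have h1 : violationPart (fun u v => (Z u v : ℝ)) = totalViolation Z := by
    unfold violationPart totalViolation
    push_cast
    refine Finset.sum_congr rfl fun u _ => Finset.sum_congr rfl fun v _ =>
      Finset.sum_congr rfl fun w _ => ?_
    rcases le_total (Z u w) (Z u v + Z v w) with h | h
    · rw [Nat.sub_eq_zero_of_le h, Nat.cast_zero]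
      have : (Z u w : ℝ) ≤ Z u v + Z v w := by exact_mod_cast h
      exact max_eq_left (by linarith)
    · rw [Nat.cast_sub h]
      have : (Z u v : ℝ) + Z v w ≤ Z u w := by exact_mod_cast h
      push_cast
      rw [max_eq_right (by linarith)]
      ring
  have h2 : linearPart G (fun u v => (repair K Z u v : ℝ)) ≤
      ∑ u : Fin n, ∑ v : Fin n, ((if u = v then 0 else if G.Adj u v then (Z u v : ℝ) else -Z u v)
        + totalViolation Z) := by
    refine Finset.sum_le_sum fun u _ => Finset.sum_le_sum fun v _ => ?_
    have h0 : (0 : ℝ) ≤ totalViolation Z := Nat.cast_nonneg _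
    change (if u = v then 0 else if G.Adj u v then (repair K Z u v : ℝ) else -(repair K Z u v : ℝ)) ≤ _
    unfold repair
    split_ifs with h3 h4
    · linarith
    · have : min K (Z u v + totalViolation Z) ≤ Z u v + totalViolation Z := min_le_right _ _
      exact_mod_cast this
    · have : Z u v ≤ min K (Z u v + totalViolation Z) := le_min (hZ u v) (by omega)
      have h5 : (Z u v : ℝ) ≤ (min K (Z u v + totalViolation Z) : ℕ) := by exact_mod_cast this
      linarith
  refine h2.trans (le_of_eq ?_)
  unfold penalized
  rw [h1]
  simp only [Finset.sum_add_distrib, Finset.sum_const, Finset.card_univ, Fintype.card_fin,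
    nsmul_eq_mul, linearPart]
  ring

variable (n) in
/-- The scale of the iterates. This choice and that of `lpRounds` make both error terms in
`two_mul_penalized_lpSum_le` equal to `lpDenom n / 25000`. -/
def lpScale : ℕ := 25000 * n ^ 2 * (1 + 2 * n ^ 3) ^ 2

variable (n) in
/-- The number of iterations. -/
def lpRounds : ℕ := 25000 * n ^ 2 * lpScale n

variable (n) in
/-- The scale of the approximate solution. -/
def lpDenom : ℕ := lpRounds n * lpScale n

/-- The approximate solution, multiplied by `lpDenom n`. -/
def lpMatrix : Fin n → Fin n → ℕ := repair (lpDenom n) (lpSum G (lpScale n) (lpRounds n))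

theorem lpMatrix_comm (u v : Fin n) : lpMatrix G u v = lpMatrix G v u :=
  repair_comm _ (lpSum_comm G _ _) u v

theorem lpMatrix_le (u v : Fin n) : lpMatrix G u v ≤ lpDenom n := repair_le _ _ u v

theorem lpMatrix_self (u : Fin n) : lpMatrix G u u = 0 := if_pos rfl

/-- The approximate solution of the linear program. -/
def lpSolution : Sym2 (Fin n) → I :=
  solutionOf (lpDenom n) (lpMatrix G) (lpMatrix_comm G) (lpMatrix_le G)

theorem lpSolution_isFeasible : IsFeasible (lpSolution G) :=
  solutionOf_isFeasible _ _ _ _ (lpMatrix_self G) (repair_triangle _ _)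

theorem lpDenom_pos (hn : 0 < n) : 0 < lpDenom n := by
  unfold lpDenom lpRounds lpScale
  positivity

/-- The approximate solution is optimal up to an additive error. -/
theorem lpCost_lpSolution_le (hn : 0 < n) {y : Sym2 (Fin n) → I} (hy : IsFeasible y) :
    lpCost G (lpSolution G) ≤ lpCost G y + 1 / 50000 := by
  have hM : (0 : ℝ) < lpScale n := by
    have : 0 < lpScale n := by unfold lpScale; positivity
    exact_mod_cast this
  have hT : (0 : ℝ) < lpRounds n := by
    have : 0 < lpRounds n := by unfold lpRounds lpScale; positivity
    exact_mod_cast this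
  have hK : (lpDenom n : ℝ) = lpRounds n * lpScale n := by unfold lpDenom; push_cast; ring
  have h1 := two_mul_penalized_lpSum_le G (lpScale n) (lpRounds n)
    (fun u v => lpScale n * (y s(u, v) : ℝ)) (fun u => by simp [hy.diag])
    (fun u v => mul_nonneg hM.le (y _).2.1)
    (fun u v => mul_le_of_le_one_right hM.le (y _).2.2)
  have h2 : penalized G (fun u v => lpScale n * (y s(u, v) : ℝ)) =
      lpScale n * linearPart G fun u v => (y s(u, v) : ℝ) := by
    unfold penalized violationPart
    rw [linearPart_mul]
    have : ∀ u v w, max 0 ((lpScale n : ℝ) * (y s(u, w) : ℝ) - lpScale n * (y s(u, v) : ℝ)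
        - lpScale n * (y s(v, w) : ℝ)) = 0 := by
      intro u v w
      refine max_eq_left ?_
      have := mul_le_mul_of_nonneg_left (hy.triangle u v w) hM.le
      linarith
    simp [this]
  have h3 : linearPart G (fun u v => (lpMatrix G u v : ℝ)) ≤ _ :=
    linearPart_repair_le G fun u v => lpSum_le G (lpScale n) (lpRounds n) u v
  have h4 : linearPart G (fun u v => (lpSolution G s(u, v) : ℝ)) =
      (1 / lpDenom n) * linearPart G fun u v => (lpMatrix G u v : ℝ) := by
    rw [← linearPart_mul]
    congr 1
    funext u v
    rw [lpSolution, solutionOf_mk]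
    ring
  have e1 := two_mul_lpCost_eq G (lpSolution G)
  have e2 := two_mul_lpCost_eq G y
  -- the error term of the subgradient method, in the scale of the approximate solution
  have h5 : (n : ℝ) ^ 2 * (lpScale n : ℝ) ^ 2 + lpRounds n * (n ^ 2 * (1 + 2 * n ^ 3) ^ 2) =
      2 * (lpDenom n * (1 / 25000)) := by
    have a1 : (lpScale n : ℝ) = 25000 * n ^ 2 * (1 + 2 * n ^ 3) ^ 2 := by
      unfold lpScale; push_cast; ring
    have a2 : (lpRounds n : ℝ) = 25000 * n ^ 2 * lpScale n := by unfold lpRounds; push_cast; ring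
    have a3 : (n : ℝ) ^ 2 * (1 + 2 * n ^ 3) ^ 2 = lpScale n / 25000 := by rw [a1]; ring
    rw [a3, hK]
    have a4 : (n : ℝ) ^ 2 * (lpScale n : ℝ) = lpRounds n / 25000 := by rw [a2]; ring
    rw [sq (lpScale n : ℝ), ← mul_assoc, a4]
    ring
  rw [h5, h2] at h1
  have h6 : linearPart G (fun u v => (lpMatrix G u v : ℝ)) ≤
      lpDenom n * (linearPart G (fun u v => (y s(u, v) : ℝ)) + 1 / 25000) := by
    have e : (lpRounds n : ℝ) * (lpScale n * linearPart G fun u v => (y s(u, v) : ℝ)) =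
        lpDenom n * linearPart G fun u v => (y s(u, v) : ℝ) := by rw [hK]; ring
    rw [e] at h1
    linarith
  have hK0 : (0 : ℝ) < lpDenom n := by exact_mod_cast lpDenom_pos hn
  have h7 : linearPart G (fun u v => (lpSolution G s(u, v) : ℝ)) ≤
      linearPart G (fun u v => (y s(u, v) : ℝ)) + 1 / 25000 := by
    rw [h4, one_div, inv_mul_le_iff₀ hK0]
    exact h6
  linarith

end Subgradient

/-! ### Derandomization by coordinatewise rounding -/

section Greedy

variable {V : Type u} [DecidableEq V] (G : SimpleGraph V) [DecidableRel G.Adj]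

/-- The pairs that contain `u` are separated from the others. -/
theorem pairSum_erase {A : Finset V} {u : V} (hu : u ∈ A) (f : V → V → ℝ) :
    pairSum A f = pairSum (A.erase u) f + ∑ v ∈ A.erase u, (f u v + f v u) := by
  have hne : ∀ v ∈ A.erase u, u ≠ v := fun v hv => (Finset.ne_of_mem_erase hv).symm
  unfold pairSum
  rw [← Finset.add_sum_erase _ _ hu, ← Finset.add_sum_erase _ _ hu]
  have h1 : ∑ v ∈ A.erase u, ∑ w ∈ A, (if v = w then 0 else f v w) =
      ∑ v ∈ A.erase u, (f v u + ∑ w ∈ A.erase u, if v = w then 0 else f v w) := by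
    refine Finset.sum_congr rfl fun v hv => ?_
    rw [← Finset.add_sum_erase _ _ hu, if_neg (hne v hv).symm]
  have h2 : ∑ v ∈ A.erase u, (if u = v then 0 else f u v) = ∑ v ∈ A.erase u, f u v :=
    Finset.sum_congr rfl fun v hv => if_neg (hne v hv)
  rw [h1, h2, if_pos rfl, Finset.sum_add_distrib, Finset.sum_add_distrib]
  ring

/-- Half of the derivative of `stepSlack` with respect to the probability of `u`. -/
def slackDeriv (x : Sym2 V → I) (A : Finset V) (q : V → ℝ) (u : V) : ℝ :=
  ∑ v ∈ A.erase u, ((if G.Adj u v then 1 - 2 * q v else -(1 - q v))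
    + 2.0599 * (pairLP G x u v * q v))

/-- `stepSlack` is affine in each of the probabilities. -/
theorem stepSlack_update (x : Sym2 V → I) {A : Finset V} {u : V} (hu : u ∈ A) (q : V → ℝ) (a : ℝ) :
    stepSlack G x A (Function.update q u a) =
      stepSlack G x A q + 2 * ((a - q u) * slackDeriv G x A q u) := by
  unfold stepSlack slackDeriv
  rw [pairSum_erase hu, pairSum_erase hu, Finset.mul_sum, Finset.mul_sum, add_assoc,
    ← Finset.sum_add_distrib]
  congr 1
  · refine pairSum_congr fun v hv w hw _ => ?_
    rw [Function.update_of_ne (Finset.ne_of_mem_erase hv),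
      Function.update_of_ne (Finset.ne_of_mem_erase hw)]
  · refine Finset.sum_congr rfl fun v hv => ?_
    rw [Function.update_of_ne (Finset.ne_of_mem_erase hv), Function.update_self,
      pairLP_comm G x v u]
    unfold pairCost
    simp only [G.adj_comm v u]
    split_ifs <;> ring

/-- `stepSlack` depends only on the probabilities of the active vertices. -/
theorem stepSlack_congr (x : Sym2 V → I) {A : Finset V} {q q' : V → ℝ}
    (h : ∀ u ∈ A, q u = q' u) : stepSlack G x A q = stepSlack G x A q' :=
  pairSum_congr fun u hu v hv _ => by rw [h u hu, h v hv]

end Greedy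

section Rounds

variable {n : ℕ} (G : SimpleGraph (Fin n)) [DecidableRel G.Adj]

variable (n) in
/-- The scale of the cut probabilities. -/
def probDenom : ℕ := (3195 * lpDenom n) * (3195 * lpDenom n)

/-- The cut probabilities of the approximate solution, multiplied by `probDenom n`. -/
def probMatrix (w u : Fin n) : ℕ :=
  if u = w then 0
  else if G.Adj u w then
    min (probDenom n) ((10000 * lpMatrix G u w - 1900 * lpDenom n)
      * (10000 * lpMatrix G u w - 1900 * lpDenom n))
  else 3195 * (3195 * (lpDenom n * lpMatrix G u w))

/-- The terms of the objective function, multiplied by `lpDenom n`. -/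
def lpTerm (u v : Fin n) : ℕ := if G.Adj u v then lpMatrix G u v else lpDenom n - lpMatrix G u v

theorem pairLP_lpSolution (hn : 0 < n) (u v : Fin n) :
    pairLP G (lpSolution G) u v = (lpTerm G u v : ℝ) / lpDenom n := by
  have hK : (lpDenom n : ℝ) ≠ 0 := by exact_mod_cast (lpDenom_pos hn).ne'
  unfold pairLP lpTerm
  rw [lpSolution, solutionOf_mk]
  split_ifs
  · rfl
  · rw [Nat.cast_sub (lpMatrix_le G u v), sub_div, div_self hK]

theorem probDenom_pos (hn : 0 < n) : 0 < probDenom n := by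
  have := lpDenom_pos hn
  unfold probDenom
  positivity

theorem probMatrix_le (w u : Fin n) : probMatrix G w u ≤ probDenom n := by
  unfold probMatrix
  split_ifs
  · exact Nat.zero_le _
  · exact min_le_left _ _
  · have := Nat.mul_le_mul_left (lpDenom n) (lpMatrix_le G u w)
    unfold probDenom
    nlinarith

theorem probMatrix_div (hn : 0 < n) (w u : Fin n) :
    (probMatrix G w u : ℝ) / probDenom n = cutProb G fPlus fMinus (lpSolution G) u w := by
  have hK0 : (0 : ℝ) < lpDenom n := by exact_mod_cast lpDenom_pos hn
  have hD : (probDenom n : ℝ) = (3195 * lpDenom n) * (3195 * lpDenom n) := by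
    unfold probDenom; push_cast; ring
  by_cases huw : u = w
  · subst huw
    rw [cutProb_self G (lpSolution_isFeasible G)]
    simp [probMatrix]
  by_cases hadj : G.Adj u w
  · rw [cutProb_of_adj G _ hadj, lpSolution, solutionOf_mk, probMatrix, if_neg huw, if_pos hadj]
    set K := lpDenom n
    set y := lpMatrix G u w
    unfold piecewiseQuadratic
    split_ifs with h1 h2
    · have h3 : 10000 * y ≤ 1900 * K := by
        rw [div_lt_iff₀ hK0] at h1
        have : (10000 * y : ℝ) ≤ 1900 * K := by linarith
        exact_mod_cast this
      rw [Nat.sub_eq_zero_of_le h3]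
      simp
    · have h3 : 1900 * K ≤ 10000 * y := by
        rw [not_lt, le_div_iff₀ hK0] at h1
        have : (1900 * K : ℝ) ≤ 10000 * y := by linarith
        exact_mod_cast this
      have h4 : 10000 * y ≤ 5095 * K := by
        rw [div_le_iff₀ hK0] at h2
        have : (10000 * y : ℝ) ≤ 5095 * K := by linarith
        exact_mod_cast this
      have h5 : 10000 * y - 1900 * K ≤ 3195 * K := by omega
      rw [min_eq_right (show _ ≤ probDenom n from Nat.mul_le_mul h5 h5), hD]
      push_cast [Nat.cast_sub h3]
      field_simp
      ring
    · have h4 : 5095 * K ≤ 10000 * y := by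
        rw [not_le, lt_div_iff₀ hK0] at h2
        have : (5095 * K : ℝ) ≤ 10000 * y := by linarith
        exact_mod_cast this
      have h5 : 3195 * K ≤ 10000 * y - 1900 * K := by omega
      rw [min_eq_left (show probDenom n ≤ _ from Nat.mul_le_mul h5 h5)]
      have : (probDenom n : ℝ) ≠ 0 := by rw [hD]; positivity
      rw [div_self this]
  · rw [cutProb_of_not_adj G _ hadj huw, lpSolution, solutionOf_mk, probMatrix, if_neg huw,
      if_neg hadj, hD]
    push_cast
    field_simp

/-- The positive part of `slackDeriv`, multiplied by `10000 * lpDenom n * probDenom n`, for scaled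
probabilities `q`, when the active vertices are those with label `0`. -/
def derivPos (lab q : Fin n → ℕ) (u : Fin n) : ℕ :=
  ∑ v, if lab v = 0 ∧ v ≠ u then
    (if G.Adj u v then 10000 * lpDenom n * probDenom n else 10000 * lpDenom n * q v)
      + 20599 * lpTerm G u v * q v else 0

/-- The negative part of `slackDeriv`, on the same scale as `derivPos`. -/
def derivNeg (lab q : Fin n → ℕ) (u : Fin n) : ℕ :=
  ∑ v, if lab v = 0 ∧ v ≠ u then
    (if G.Adj u v then 20000 * lpDenom n * q v else 10000 * lpDenom n * probDenom n) else 0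

/-- The rounded value of the coordinate `u` for the pivot `w`. The pivot joins its cluster. -/
def roundCoord (lab q : Fin n → ℕ) (w u : Fin n) : ℕ :=
  if u = w then 0 else if derivPos G lab q u ≤ derivNeg G lab q u then probDenom n else 0

/-- The scaled probabilities for the pivot `w` after the coordinates less than `j` have been
rounded, one after the other. -/
def greedy (lab : Fin n → ℕ) (w : Fin n) : ℕ → Fin n → ℕ
  | 0 => probMatrix G w
  | j + 1 => if h : j < n then
      Function.update (greedy lab w j) ⟨j, h⟩ (roundCoord G lab (greedy lab w j) w ⟨j, h⟩)
    else greedy lab w j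

/-- The result of rounding all coordinates. -/
def rounded (lab : Fin n → ℕ) (w u : Fin n) : ℕ := greedy G lab w n u

/-- Coordinates that have not been reached. -/
theorem greedy_of_le (lab : Fin n → ℕ) (w : Fin n) {j : ℕ} {v : Fin n} (h : j ≤ v) :
    greedy G lab w j v = probMatrix G w v := by
  induction j with
  | zero => rfl
  | succ j ih =>
    rw [greedy, dif_pos (by omega), Function.update_of_ne, ih (by omega)]
    intro h'
    rw [h'] at h
    simp at h

/-- Coordinates do not change after they have been rounded. -/
theorem greedy_of_lt (lab : Fin n → ℕ) (w : Fin n) {j k : ℕ} {v : Fin n} (h : v < j) (hjk : j ≤ k) :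
    greedy G lab w k v = greedy G lab w j v := by
  induction k, hjk using Nat.le_induction with
  | base => rfl
  | succ k hk ih =>
    rw [greedy]
    split_ifs with hkn
    · rw [Function.update_of_ne, ih]
      intro h'
      rw [h'] at h
      simp at h
      omega
    · exact ih

/-- The rounded values satisfy a recursion that allows for computing them in place. -/
theorem rounded_eq (lab : Fin n → ℕ) (w u : Fin n) :
    rounded G lab w u = roundCoord G lab
      (fun v => if v < u then rounded G lab w v else probMatrix G w v) w u := by
  unfold rounded
  rw [greedy_of_lt G lab w (j := u + 1) (by omega) (by omega), greedy, dif_pos u.2,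
    Function.update_self]
  congr 1
  funext v
  split_ifs with h
  · rw [greedy_of_lt G lab w (j := u) (k := n) h (by omega)]
  · exact greedy_of_le G lab w (not_lt.1 h)

theorem rounded_eq_zero_or (lab : Fin n → ℕ) (w u : Fin n) :
    rounded G lab w u = 0 ∨ rounded G lab w u = probDenom n := by
  rw [rounded_eq]
  unfold roundCoord
  split_ifs <;> simp

theorem rounded_self (lab : Fin n → ℕ) (w : Fin n) : rounded G lab w w = 0 := by
  rw [rounded_eq]
  exact if_pos rfl

theorem rounded_le (lab : Fin n → ℕ) (w u : Fin n) : rounded G lab w u ≤ probDenom n := by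
  rcases rounded_eq_zero_or G lab w u with h | h <;> rw [h]
  exact Nat.zero_le _

/-- The vertices that have not been put into a cluster. -/
def active (lab : Fin n → ℕ) : Finset (Fin n) := Finset.univ.filter fun v => lab v = 0

theorem mem_active {lab : Fin n → ℕ} {v : Fin n} : v ∈ active lab ↔ lab v = 0 := by
  simp [active]

/-- The integer comparison in `roundCoord` decides the sign of `slackDeriv`. -/
theorem slackDeriv_eq (hn : 0 < n) (lab q : Fin n → ℕ) (u : Fin n) :
    (derivPos G lab q u : ℝ) - derivNeg G lab q u = 10000 * lpDenom n * probDenom n *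
      slackDeriv G (lpSolution G) (active lab) (fun v => (q v : ℝ) / probDenom n) u := by
  have hK : (lpDenom n : ℝ) ≠ 0 := by exact_mod_cast (lpDenom_pos hn).ne'
  have hD : (probDenom n : ℝ) ≠ 0 := by exact_mod_cast (probDenom_pos hn).ne'
  have e : (active lab).erase u = Finset.univ.filter fun v => lab v = 0 ∧ v ≠ u := by
    ext v
    simp [active, and_comm]
  unfold slackDeriv derivPos derivNeg
  rw [e, Finset.sum_filter, Nat.cast_sum, Nat.cast_sum, ← Finset.sum_sub_distrib, Finset.mul_sum]
  refine Finset.sum_congr rfl fun v _ => ?_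
  rw [pairLP_lpSolution G hn]
  split_ifs
  · push_cast
    field_simp
    ring
  · push_cast
    field_simp
    ring
  · simp

theorem greedy_le (lab : Fin n → ℕ) (w : Fin n) (j : ℕ) (v : Fin n) :
    greedy G lab w j v ≤ probDenom n := by
  rcases lt_or_ge (v : ℕ) j with h | h
  · have h1 := rounded_le G lab w v
    have h2 := greedy_of_lt G lab w (j := v + 1) (k := j) (v := v) (by omega) (by omega)
    have h3 := greedy_of_lt G lab w (j := v + 1) (k := n) (v := v) (by omega) (by omega)
    unfold rounded at h1
    rw [h2, ← h3]
    exact h1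
  · rw [greedy_of_le G lab w h]
    exact probMatrix_le G w v

/-- Rounding a coordinate does not increase the slack. -/
theorem stepSlack_greedy_succ_le (hn : 0 < n) (lab : Fin n → ℕ) (w : Fin n) (j : ℕ) :
    stepSlack G (lpSolution G) (active lab) (fun v => (greedy G lab w (j + 1) v : ℝ) / probDenom n) ≤
      stepSlack G (lpSolution G) (active lab) fun v => (greedy G lab w j v : ℝ) / probDenom n := by
  have hD : (0 : ℝ) < probDenom n := by exact_mod_cast probDenom_pos hn
  have hK : (0 : ℝ) < lpDenom n := by exact_mod_cast lpDenom_pos hn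
  by_cases hj : j < n
  swap
  · rw [greedy, dif_neg hj]
  set q := greedy G lab w j with hq
  set u : Fin n := ⟨j, hj⟩ with hu
  set a := roundCoord G lab q w u with ha
  have e : (fun v => (greedy G lab w (j + 1) v : ℝ) / probDenom n) =
      Function.update (fun v => (q v : ℝ) / probDenom n) u ((a : ℝ) / probDenom n) := by
    funext v
    rw [greedy, dif_pos hj]
    by_cases hv : v = u
    · rw [hv, hu, Function.update_self, Function.update_self]
    · rw [Function.update_of_ne hv, Function.update_of_ne hv]
  rw [e]
  by_cases hmem : u ∈ active lab
  swap
  · refine le_of_eq (stepSlack_congr G _ fun v hv => ?_)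
    rw [Function.update_of_ne]
    rintro rfl
    exact hmem hv
  rw [stepSlack_update G _ hmem]
  have hder := slackDeriv_eq G hn lab q u
  set S := slackDeriv G (lpSolution G) (active lab) (fun v => (q v : ℝ) / probDenom n) u
  have hpos : (0 : ℝ) < 10000 * lpDenom n * probDenom n := by positivity
  suffices h : ((a : ℝ) / probDenom n - (q u : ℝ) / probDenom n) * S ≤ 0 by
    linarith
  have hqle : (q u : ℝ) ≤ probDenom n := by exact_mod_cast greedy_le G lab w j u
  have hq0 : (0 : ℝ) ≤ (q u : ℝ) / probDenom n := by positivity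
  rw [ha]
  unfold roundCoord
  split_ifs with h1 h2
  · have : q u = 0 := by
      rw [hq, greedy_of_le G lab w (v := u) (show j ≤ (u : ℕ) from le_rfl), probMatrix, if_pos h1]
    simp [this]
  · have h3 : (derivPos G lab q u : ℝ) ≤ derivNeg G lab q u := by exact_mod_cast h2
    have hS : S ≤ 0 := by
      by_contra hS
      have := mul_pos hpos (not_le.1 hS)
      linarith
    rw [← sub_div]
    exact mul_nonpos_of_nonneg_of_nonpos (div_nonneg (by linarith) hD.le) hS
  · have h3 : (derivNeg G lab q u : ℝ) ≤ derivPos G lab q u := by exact_mod_cast (not_le.1 h2).le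
    have hS : 0 ≤ S := by
      by_contra hS
      have := mul_neg_of_pos_of_neg hpos (not_le.1 hS)
      linarith
    rw [Nat.cast_zero, zero_div, zero_sub, neg_mul]
    exact neg_nonpos.2 (mul_nonneg hq0 hS)

/-- The cluster of the pivot `w`. -/
def cluster (lab : Fin n → ℕ) (w : Fin n) : Finset (Fin n) :=
  Finset.univ.filter fun u => rounded G lab w u = 0

/-- Rounding all coordinates turns the random cluster of the pivot `w` into a definite one, without
increasing the slack. -/
theorem stepSlack_cluster_le (hn : 0 < n) (lab : Fin n → ℕ) (w : Fin n) :
    stepSlack G (lpSolution G) (active lab) (outside (cluster G lab w)) ≤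
      stepSlack G (lpSolution G) (active lab)
        fun u => (cutProb G fPlus fMinus (lpSolution G) u w : ℝ) := by
  have hD : (probDenom n : ℝ) ≠ 0 := by exact_mod_cast (probDenom_pos hn).ne'
  have h1 : outside (cluster G lab w) = fun v => (greedy G lab w n v : ℝ) / probDenom n := by
    funext v
    change _ = (rounded G lab w v : ℝ) / probDenom n
    unfold outside cluster
    rcases rounded_eq_zero_or G lab w v with h | h
    · simp [h]
    · have h0 : probDenom n ≠ 0 := (probDenom_pos hn).ne'
      simp [h, h0]
  have h2 : (fun u => (cutProb G fPlus fMinus (lpSolution G) u w : ℝ)) =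
      fun v => (greedy G lab w 0 v : ℝ) / probDenom n := by
    funext v
    rw [← probMatrix_div G hn]
    rfl
  rw [h1, h2]
  have : ∀ j, stepSlack G (lpSolution G) (active lab)
      (fun v => (greedy G lab w j v : ℝ) / probDenom n) ≤
      stepSlack G (lpSolution G) (active lab) fun v => (greedy G lab w 0 v : ℝ) / probDenom n := by
    intro j
    induction j with
    | zero => exact le_rfl
    | succ j ih => exact (stepSlack_greedy_succ_le G hn lab w j).trans ih
  exact this n

/-- Since the slacks of all pivots add up to at most `0`, one of them is at most `0`. -/
theorem exists_pivot (hn : 0 < n) {lab : Fin n → ℕ} (h : (active lab).Nonempty) :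
    ∃ w ∈ active lab,
      stepSlack G (lpSolution G) (active lab) (outside (cluster G lab w)) ≤ 0 := by
  by_contra! hc
  have h1 := Finset.sum_lt_sum_of_nonempty h hc
  have h2 := Finset.sum_le_sum fun w (_ : w ∈ active lab) => stepSlack_cluster_le G hn lab w
  have h3 := sum_stepSlack_nonpos G (lpSolution_isFeasible G) (active lab)
  rw [Finset.sum_const_zero] at h1
  linarith

/-- The number of ordered pairs that the step with pivot `w` decides wrongly. -/
def stepCost (lab : Fin n → ℕ) (w : Fin n) : ℕ :=
  ∑ u, ∑ v, if lab u = 0 ∧ lab v = 0 ∧ u ≠ v then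
    (if G.Adj u v then
      if rounded G lab w u = 0 ∧ rounded G lab w v = 0 ∨
        rounded G lab w u ≠ 0 ∧ rounded G lab w v ≠ 0 then 0 else 1
    else if rounded G lab w u = 0 ∧ rounded G lab w v = 0 then 1 else 0) else 0

/-- The contribution to the objective function of the ordered pairs that the step with pivot `w`
removes, multiplied by `lpDenom n`. -/
def stepGain (lab : Fin n → ℕ) (w : Fin n) : ℕ :=
  ∑ u, ∑ v, if lab u = 0 ∧ lab v = 0 ∧ u ≠ v then
    (if rounded G lab w u = 0 ∨ rounded G lab w v = 0 then lpTerm G u v else 0) else 0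

/-- The pivots that pay for themselves. -/
def IsGood (lab : Fin n → ℕ) (w : Fin n) : Prop :=
  lab w = 0 ∧ 10000 * lpDenom n * stepCost G lab w ≤ 20599 * stepGain G lab w

theorem stepSlack_cluster_eq (hn : 0 < n) (lab : Fin n → ℕ) (w : Fin n) :
    10000 * lpDenom n * stepSlack G (lpSolution G) (active lab) (outside (cluster G lab w)) =
      ((10000 * lpDenom n * stepCost G lab w : ℕ) : ℝ) - ((20599 * stepGain G lab w : ℕ) : ℝ) := by
  have hK : (lpDenom n : ℝ) ≠ 0 := by exact_mod_cast (lpDenom_pos hn).ne'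
  unfold stepSlack
  rw [pairSum_subset (Finset.subset_univ (active lab))]
  unfold pairSum stepCost stepGain
  push_cast
  simp only [Finset.mul_sum, ← Finset.sum_sub_distrib]
  refine Finset.sum_congr rfl fun u _ => Finset.sum_congr rfl fun v _ => ?_
  simp only [mem_active]
  by_cases huv : u = v
  · simp [huv]
  by_cases h1 : lab u = 0 ∧ lab v = 0
  swap
  · have h2 : ¬ (lab u = 0 ∧ lab v = 0 ∧ u ≠ v) := fun h => h1 ⟨h.1, h.2.1⟩
    simp only [if_neg h1, if_neg h2, if_neg huv]
    simp
  have h2 : lab u = 0 ∧ lab v = 0 ∧ u ≠ v := ⟨h1.1, h1.2, huv⟩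
  simp only [if_neg huv, if_pos h1, if_pos h2]
  rw [pairLP_lpSolution G hn]
  unfold pairCost outside cluster
  simp only [Finset.mem_filter, Finset.mem_univ, true_and]
  by_cases h3 : rounded G lab w u = 0 <;> by_cases h4 : rounded G lab w v = 0 <;>
    by_cases h5 : G.Adj u v <;> simp [h3, h4, h5] <;> field_simp <;> first | ring1 | norm_num

theorem exists_isGood (hn : 0 < n) {lab : Fin n → ℕ} (h : (active lab).Nonempty) :
    ∃ w, IsGood G lab w := by
  obtain ⟨w, hw, hle⟩ := exists_pivot G hn h
  refine ⟨w, mem_active.1 hw, ?_⟩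
  have hK : (0 : ℝ) < lpDenom n := by exact_mod_cast lpDenom_pos hn
  have h1 := stepSlack_cluster_eq G hn lab w
  have h2 : (10000 * lpDenom n : ℝ) * stepSlack G (lpSolution G) (active lab)
      (outside (cluster G lab w)) ≤ 0 :=
    mul_nonpos_of_nonneg_of_nonpos (by positivity) hle
  have h3 : ((10000 * lpDenom n * stepCost G lab w : ℕ) : ℝ) ≤
    ((20599 * stepGain G lab w : ℕ) : ℝ) := by linarith
  exact_mod_cast h3

/-- The invariant of the rounding phase after `t` steps: labels are not used again, the pairs that
have been decided are paid for, and at most `n - t` vertices are active. Label `0` marks the active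
vertices, and label `w + 1` the cluster of the pivot `w`. -/
structure RoundInv (t : ℕ) (lab : Fin n → ℕ) : Prop where
  le : ∀ v, lab v ≤ n
  fresh : ∀ u w : Fin n, lab u = w + 1 → lab w ≠ 0
  card : (active lab).card ≤ n - t
  paid : pairSum Finset.univ (fun u v => if u ∈ active lab ∧ v ∈ active lab then 0 else
    pairViolated G (TogetherInLabels lab) u v - 2.0599 * pairLP G (lpSolution G) u v) ≤ 0

theorem RoundInv.zero : RoundInv G 0 (fun _ => 0) where
  le _ := Nat.zero_le _
  fresh u w h := by omega
  card := by
    rw [Nat.sub_zero]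
    exact (Finset.card_le_univ _).trans (by simp)
  paid := by
    have : ∀ u : Fin n, u ∈ active (fun _ : Fin n => 0) := fun u => mem_active.2 rfl
    simp [this, pairSum]

/-- A step with a good pivot `w`, whose cluster gets the label `w + 1`. -/
theorem RoundInv.step (hn : 0 < n) {t : ℕ} {lab lab' : Fin n → ℕ} (h : RoundInv G t lab)
    {w : Fin n} (hw : IsGood G lab w)
    (hlab : ∀ v, lab' v = if lab v = 0 ∧ rounded G lab w v = 0 then (w : ℕ) + 1 else lab v) :
    RoundInv G (t + 1) lab' := by
  have hww : lab' w = w + 1 := by rw [hlab, if_pos ⟨hw.1, rounded_self G lab w⟩]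
  have hact : ∀ v, v ∈ active lab' ↔ v ∈ active lab ∧ v ∉ cluster G lab w := by
    intro v
    rw [mem_active, mem_active, hlab, cluster, Finset.mem_filter]
    by_cases h1 : lab v = 0 <;> by_cases h2 : rounded G lab w v = 0 <;> simp [h1, h2]
  have hne : ∀ u, lab u ≠ w + 1 := fun u hu => h.fresh u w hu hw.1
  refine ⟨fun v => ?_, fun u w' hu => ?_, ?_, ?_⟩
  · rw [hlab]
    split_ifs
    · omega
    · exact h.le v
  · rw [hlab] at hu
    split_ifs at hu with h1
    · have : w' = w := Fin.ext (by omega)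
      rw [this, hww]; omega
    · rw [hlab]
      split_ifs
      · omega
      · exact h.fresh u w' hu
  · have : (active lab').card < (active lab).card := by
      refine Finset.card_lt_card ⟨fun v hv => ((hact v).1 hv).1, fun hsub => ?_⟩
      have := mem_active.1 (hsub (mem_active.2 hw.1))
      omega
    have := h.card
    omega
  · have hK : (0 : ℝ) < lpDenom n := by exact_mod_cast lpDenom_pos hn
    have h1 : stepSlack G (lpSolution G) (active lab) (outside (cluster G lab w)) ≤ 0 := by
      have h1 := stepSlack_cluster_eq G hn lab w
      have h2 : ((10000 * lpDenom n * stepCost G lab w : ℕ) : ℝ) ≤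
        ((20599 * stepGain G lab w : ℕ) : ℝ) := by exact_mod_cast hw.2
      by_contra hc
      have := mul_pos (show (0 : ℝ) < 10000 * lpDenom n by positivity) (not_le.1 hc)
      linarith
    unfold stepSlack at h1
    rw [pairSum_subset (Finset.subset_univ (active lab))] at h1
    refine le_trans (le_of_eq ?_) (add_nonpos h.paid h1)
    rw [← pairSum_add]
    refine pairSum_congr fun u _ v _ _ => ?_
    have hu := hlab u
    have hv := hlab v
    have hnu := hne u
    have hnv := hne v
    unfold pairViolated pairCost outside
    simp only [togetherInLabels_mk, hact]
    simp only [mem_active, cluster, Finset.mem_filter, Finset.mem_univ, true_and]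
    by_cases a1 : lab u = 0 <;> by_cases a2 : lab v = 0 <;>
      by_cases a3 : rounded G lab w u = 0 <;> by_cases a4 : rounded G lab w v = 0 <;>
      by_cases a5 : G.Adj u v <;>
      simp [a1, a2, a3, a4, a5, hu, hv, hnu, Ne.symm hnv, eq_comm (a := (0 : ℕ))]
    norm_num

/-- After `n` steps all vertices have a label. -/
theorem RoundInv.cost_le {lab : Fin n → ℕ} (h : RoundInv G n lab) :
    (numViolated G (TogetherInLabels lab) : ℝ) ≤ 2.0599 * lpCost G (lpSolution G) := by
  have hempty : active lab = ∅ := by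
    have := h.card
    rw [Nat.sub_self] at this
    exact Finset.card_eq_zero.1 (Nat.le_zero.1 this)
  have h1 := h.paid
  simp only [hempty, Finset.notMem_empty, false_and, if_false] at h1
  rw [pairSum_sub, pairSum_mul_left, ← two_mul_numViolated, ← two_mul_lpCost] at h1
  linarith

/-- If the linear program has a solution of cost less than `1`, then adjacency is transitive. -/
theorem exists_feasible_zero {x : Sym2 (Fin n) → I} (hx : IsFeasible x) (h : lpCost G x < 1) :
    ∃ y : Sym2 (Fin n) → I, IsFeasible y ∧ lpCost G y = 0 := by
  classical
  have htrans : ∀ u v w, G.Adj u v → G.Adj v w → u ≠ w → G.Adj u w := by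
    intro u v w huv hvw huw
    by_contra hnadj
    have h1 : (x s(u, v) : ℝ) + x s(v, w) ≤ ∑ e ∈ G.edgeFinset, (x e : ℝ) := by
      have hne : s(u, v) ≠ s(v, w) := by
        intro he
        rcases Sym2.eq_iff.1 he with ⟨h1, _⟩ | ⟨h1, _⟩
        · exact huv.ne h1
        · exact huw h1
      rw [← Finset.sum_pair (f := fun e => (x e : ℝ)) hne]
      refine Finset.sum_le_sum_of_subset_of_nonneg ?_ fun e _ _ => (x e).2.1
      intro e he
      rcases Finset.mem_insert.1 he with rfl | he
      · simpa using huv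
      · rw [Finset.mem_singleton.1 he]
        simpa using hvw
    have h2 : 1 - (x s(u, w) : ℝ) ≤ ∑ e ∈ Gᶜ.edgeFinset, (1 - (x e : ℝ)) := by
      refine Finset.single_le_sum (f := fun e => 1 - (x e : ℝ))
        (fun e _ => sub_nonneg.2 (x e).2.2) ?_
      simp [huw, hnadj]
    have h3 := hx.triangle u v w
    unfold lpCost at h
    linarith
  let y : Sym2 (Fin n) → I := fun e => if e.IsDiag ∨ e ∈ G.edgeSet then 0 else 1
  have hy : ∀ u v, y s(u, v) = if u = v ∨ G.Adj u v then 0 else 1 := by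
    intro u v
    simp [y]
  refine ⟨y, ⟨fun u => by simp [hy], fun u v w => ?_⟩, ?_⟩
  · simp only [hy]
    by_cases h1 : u = v
    · subst h1; simp
    by_cases h2 : v = w
    · subst h2; simp
    by_cases h3 : G.Adj u v
    · by_cases h4 : G.Adj v w
      · by_cases h5 : u = w
        · rw [if_pos (Or.inl h5)]
          exact add_nonneg (unitInterval.nonneg _) (unitInterval.nonneg _)
        · simp [h1, h2, h3, h4, htrans u v w h3 h4 h5]
      · simp only [h1, h2, h3, h4, or_self, if_false]
        split_ifs <;> simp
    · simp only [h1, h3, or_self, if_false]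
      split_ifs <;> simp
  · have h2 := two_mul_lpCost G y
    have h3 : pairSum Finset.univ (pairLP G y) = 0 := by
      rw [← show pairSum Finset.univ (fun _ _ : Fin n => 0) = 0 by simp [pairSum]]
      refine pairSum_congr fun u _ v _ huv => ?_
      unfold pairLP
      rw [hy]
      by_cases h4 : G.Adj u v <;> simp [h4, huv]
    linarith

/-- The guarantee of the deterministic algorithm. The additive error of the linear program is
absorbed because costs are integers. -/
theorem RoundInv.ratio (hn : 0 < n) {lab : Fin n → ℕ} (h : RoundInv G n lab)
    {x : Sym2 (Fin n) → I} (hx : IsFeasible x) :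
    (numViolated G (TogetherInLabels lab) : ℝ) ≤ 2.05995 * lpCost G x := by
  have h1 := h.cost_le
  rcases lt_or_ge (lpCost G x) 1 with hc | hc
  · obtain ⟨y, hy, hy0⟩ := exists_feasible_zero G hx hc
    have h2 := lpCost_lpSolution_le G hn hy
    have h3 : (numViolated G (TogetherInLabels lab) : ℝ) < 1 := by linarith
    have h4 : numViolated G (TogetherInLabels lab) = 0 := by
      have : numViolated G (TogetherInLabels lab) < 1 := by exact_mod_cast h3
      omega
    rw [h4, Nat.cast_zero]
    have h5 := lpCost_nonneg G x
    positivity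
  · have h2 := lpCost_lpSolution_le G hn hx
    linarith

end Rounds

/-! ### Derived expressions -/

namespace Expr

/-- The indicator of `a = 0`. -/
def isZero (a : Expr) : Expr := .sub (.const 1) a

/-- The indicator of `a < b`. -/
def less (a b : Expr) : Expr := isZero (isZero (.sub b a))

/-- The indicator of `a = b`. -/
def same (a b : Expr) : Expr := isZero (.add (.sub a b) (.sub b a))

/-- The minimum of `a` and `b`. -/
def least (a b : Expr) : Expr := .sub a (.sub a b)

/-- The value of `a` if `c` is nonzero, and the value of `b` otherwise. -/
def select (c a b : Expr) : Expr := .add (.mul (.sub (.const 1) (isZero c)) a) (.mul (isZero c) b)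

/-- The entry in row `a` and column `b` of the matrix stored in the array `k`. -/
def entry (k : ℕ) (a b : Expr) : Expr := .read k (.add (.mul a (.var 0)) b)

theorem eval_isZero (a : Expr) (s : Store) :
    (isZero a).eval s = if a.eval s = 0 then 1 else 0 := by
  simp only [isZero, eval]
  split_ifs <;> omega

theorem eval_less (a b : Expr) (s : Store) :
    (less a b).eval s = if a.eval s < b.eval s then 1 else 0 := by
  simp only [less, eval_isZero, eval]
  rcases lt_or_ge (a.eval s) (b.eval s) with h | h
  · simp [h, (Nat.sub_pos_of_lt h).ne']
  · simp [h.not_gt, Nat.sub_eq_zero_of_le h]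

theorem eval_same (a b : Expr) (s : Store) :
    (same a b).eval s = if a.eval s = b.eval s then 1 else 0 := by
  simp only [same, eval_isZero, eval]
  congr 1
  simp only [eq_iff_iff]
  omega

theorem eval_least (a b : Expr) (s : Store) :
    (least a b).eval s = min (a.eval s) (b.eval s) := by
  simp only [least, eval]
  omega

theorem eval_select (c a b : Expr) (s : Store) :
    (select c a b).eval s = if c.eval s = 0 then b.eval s else a.eval s := by
  simp only [select, eval, eval_isZero]
  split_ifs <;> simp

theorem eval_entry (k : ℕ) (a b : Expr) (s : Store) :
    (entry k a b).eval s = s.arr k (a.eval s * s.reg 0 + b.eval s) := rfl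

end Expr

section Program

variable {n : ℕ} (G : SimpleGraph (Fin n)) [DecidableRel G.Adj]

/-- The array `k` contains the matrix `f` row by row. -/
def HoldsMatrix (s : Store) (k : ℕ) (f : Fin n → Fin n → ℕ) : Prop :=
  ∀ u v : Fin n, s.arr k (u * n + v) = f u v

/-- The array `k` contains the vector `f`. -/
def HoldsVector (s : Store) (k : ℕ) (f : Fin n → ℕ) : Prop := ∀ v : Fin n, s.arr k v = f v

theorem index_lt (u v : Fin n) : (u : ℕ) * n + v < n * n := by
  have : (u : ℕ) * n + n ≤ n * n := by
    rw [← Nat.succ_mul]; exact Nat.mul_le_mul_right n u.2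
  omega

theorem index_lt_iff (u v u' v' : Fin n) :
    (u' : ℕ) * n + v' < u * n + v ↔ u' < u ∨ u' = u ∧ v' < v := by
  rcases lt_trichotomy (u' : ℕ) u with h | h | h
  · have : (u' : ℕ) * n + n ≤ u * n := by
      rw [← Nat.succ_mul]; exact Nat.mul_le_mul_right n h
    have h1 : u' < u := h
    simp only [h1, true_or, iff_true]
    omega
  · have h1 : u' = u := Fin.ext h
    subst h1
    simp
  · have : (u : ℕ) * n + n ≤ u' * n := by
      rw [← Nat.succ_mul]; exact Nat.mul_le_mul_right n h
    have h1 : u < u' := h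
    simp only [h1.not_gt, h1.ne', false_and, or_false, iff_false]
    omega

theorem index_inj {u v u' v' : Fin n} (h : (u' : ℕ) * n + v' = u * n + v) : u' = u ∧ v' = v := by
  have h1 := (index_lt_iff u v u' v').not.1 (by omega)
  have h2 := (index_lt_iff u' v' u v).not.1 (by omega)
  push Not at h1 h2
  have h3 : u' = u := le_antisymm h2.1 h1.1
  exact ⟨h3, le_antisymm (h2.2 h3.symm) (h1.2 h3)⟩

/-- The matrix `f` as a function of the index in the array. -/
def flat (f : Fin n → Fin n → ℕ) (j : ℕ) : ℕ :=
  if h : j / n < n ∧ j % n < n then f ⟨j / n, h.1⟩ ⟨j % n, h.2⟩ else 0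

theorem flat_index (f : Fin n → Fin n → ℕ) (u v : Fin n) : flat f (u * n + v) = f u v := by
  have hn : 0 < n := u.pos
  have h1 : ((u : ℕ) * n + v) / n = u := by
    rw [mul_comm, Nat.mul_add_div hn, Nat.div_eq_of_lt v.2, add_zero]
  have h2 : ((u : ℕ) * n + v) % n = v := by
    rw [mul_comm, Nat.mul_add_mod, Nat.mod_eq_of_lt v.2]
  unfold flat
  rw [dif_pos ⟨by rw [h1]; exact u.2, by rw [h2]; exact v.2⟩]
  congr 1 <;> ext <;> simp [h1, h2]

namespace HT

/-- The rule for `fillMatrix` in terms of matrices over `Fin n`. -/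
theorem fillMatrix_fin {k : ℕ} {e : Expr} (he : e.Below 40) {B : ℕ} {s : Store}
    (hs : Bounded 40 B s) (hn : s.reg 0 = n) (f : Fin n → Fin n → ℕ) (hf : ∀ u v, f u v ≤ B)
    (heval : ∀ u v : Fin n, ∀ s', AgreeOff [12, 13, 14, 15] s s' → s'.reg 12 = u → s'.reg 14 = v →
      (∀ k' ≠ k, s'.arr k' = s.arr k') →
      HoldsMatrix s' k (fun u' v' =>
        if u' < u ∨ u' = u ∧ v' < v then f u' v' else s.arr k (u' * n + v')) →
      e.eval s' = f u v)
    {Q : Store → Prop}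
    (h : ∀ s', Bounded 40 B s' → AgreeOff [12, 13, 14, 15] s s' →
      (∀ k' ≠ k, s'.arr k' = s.arr k') → HoldsMatrix s' k f → Q s') :
    HT (CorrClust.fillMatrix k e) ((fillMatrixBound e).eval B) s Q := by
  refine HT.fillMatrix he hs hn (flat f) (fun i _ => ?_) (fun u hu v hv s' h1 h2 h3 h4 => ?_)
    fun s' h1 h2 h3 => h s' h1 h2 (fun k' hk' => ?_) fun u v => ?_
  · unfold flat
    split_ifs
    · exact hf _ _
    · exact Nat.zero_le _
  · rw [show u * n + v = ((⟨u, hu⟩ : Fin n) : ℕ) * n + (⟨v, hv⟩ : Fin n) from rfl, flat_index]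
    refine heval ⟨u, hu⟩ ⟨v, hv⟩ s' h1 h2 h3 (fun k' hk' => ?_) fun u' v' => ?_
    · rw [h4, Function.update_of_ne hk']
    · rw [h4, Function.update_self, flat_index]
      simp only [← index_lt_iff]
  · rw [h3, Function.update_of_ne hk']
  · rw [h3, Function.update_self, flat_index, if_pos (index_lt u v)]

/-- The rule for `fillVector` in terms of vectors over `Fin n`. -/
theorem fillVector_fin {k : ℕ} {e : Expr} (he : e.Below 40) {B : ℕ} {s : Store}
    (hs : Bounded 40 B s) (hn : s.reg 0 = n) (f : Fin n → ℕ) (hf : ∀ v, f v ≤ B)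
    (heval : ∀ v : Fin n, ∀ s', AgreeOff [14, 15] s s' → s'.reg 14 = v →
      (∀ k' ≠ k, s'.arr k' = s.arr k') → (s'.arr k v = s.arr k v) → e.eval s' = f v)
    {Q : Store → Prop}
    (h : ∀ s', Bounded 40 B s' → AgreeOff [14, 15] s s' →
      (∀ k' ≠ k, s'.arr k' = s.arr k') → HoldsVector s' k f → Q s') :
    HT (CorrClust.fillVector k e) ((fillVectorBound e).eval B) s Q := by
  refine HT.fillVector he hs hn (fun j => if h : j < n then f ⟨j, h⟩ else 0) (fun i _ => ?_)
    (fun v hv s' h1 h2 h4 => ?_)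
    fun s' h1 h2 h3 => h s' h1 h2 (fun k' hk' => ?_) fun v => ?_
  · by_cases hi : i < n
    · simpa [hi] using hf _
    · simp [hi]
  · rw [dif_pos hv]
    refine heval ⟨v, hv⟩ s' h1 h2 (fun k' hk' => ?_) ?_
    · rw [h4, Function.update_of_ne hk']
    · rw [h4, Function.update_self]
      simp
  · rw [h3, Function.update_of_ne hk']
  · rw [h3, Function.update_self, if_pos v.2, dif_pos v.2]

end HT

/-! ### The expressions of the algorithm -/

open CorrClust.Expr

/-- The value of `gradPos` for the matrix in the array `2`, in the row and the column given by the
registers `12` and `14`. -/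
def gradPosExpr : Expr :=
  .add (entry 0 (.var 12) (.var 14)) (.mul (.mul (.var 0) (.var 0)) (.sum 16 (.var 0)
    (less (.add (entry 2 (.var 12) (.var 16)) (entry 2 (.var 16) (.var 14)))
      (entry 2 (.var 12) (.var 14)))))

/-- The value of `gradNeg` in the row and the column given by the
registers `12` and `14`. -/
def gradNegExpr : Expr :=
  .add (isZero (entry 0 (.var 12) (.var 14))) (.mul (.mul (.var 0) (.var 0)) (.sum 16 (.var 0)
    (.add (less (.add (entry 2 (.var 12) (.var 14)) (entry 2 (.var 14) (.var 16)))
        (entry 2 (.var 12) (.var 16)))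
      (less (.add (entry 2 (.var 16) (.var 12)) (entry 2 (.var 12) (.var 14)))
        (entry 2 (.var 16) (.var 14))))))

/-- The value of `lpStep` in the row and the column given by the
registers `12` and `14`. -/
def lpStepExpr : Expr :=
  select (same (.var 12) (.var 14)) (.const 0) (least (.var 1)
    (.sub (.add (entry 2 (.var 12) (.var 14)) gradNegExpr) gradPosExpr))

/-- The total violation of the matrix in the array `4`. -/
def totalViolationExpr : Expr :=
  .sum 16 (.var 0) (.sum 17 (.var 0) (.sum 18 (.var 0)
    (.sub (entry 4 (.var 16) (.var 18))
      (.add (entry 4 (.var 16) (.var 17)) (entry 4 (.var 17) (.var 18))))))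

/-- The value of `lpMatrix` in the row and the column given by the
registers `12` and `14`. -/
def lpMatrixExpr : Expr :=
  select (same (.var 12) (.var 14)) (.const 0)
    (least (.var 3) (.add (entry 4 (.var 12) (.var 14)) (.var 5)))

/-- The value of `probMatrix` in the row and the column given by the
registers `12` and `14`. -/
def probMatrixExpr : Expr :=
  select (same (.var 14) (.var 12)) (.const 0)
    (select (entry 0 (.var 14) (.var 12))
      (least (.var 4) (.mul
        (.sub (.mul (.const 10000) (entry 5 (.var 14) (.var 12))) (.mul (.const 1900) (.var 3)))
        (.sub (.mul (.const 10000) (entry 5 (.var 14) (.var 12))) (.mul (.const 1900) (.var 3)))))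
      (.mul (.const 3195) (.mul (.const 3195) (.mul (.var 3) (entry 5 (.var 14) (.var 12))))))

/-- The value of `lpTerm` for the pair `a, b`. -/
def lpTermExpr (a b : Expr) : Expr :=
  select (entry 0 a b) (entry 5 a b) (.sub (.var 3) (entry 5 a b))

/-- The value of `derivPos` for the vertex in register `14` and row `12` of the array `7`. -/
def derivPosExpr : Expr :=
  .sum 16 (.var 0) (select
    (.mul (isZero (.read 1 (.var 16))) (isZero (same (.var 16) (.var 14))))
    (.add (select (entry 0 (.var 14) (.var 16))
        (.mul (.mul (.const 10000) (.var 3)) (.var 4))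
        (.mul (.mul (.const 10000) (.var 3)) (entry 7 (.var 12) (.var 16))))
      (.mul (.mul (.const 20599) (lpTermExpr (.var 14) (.var 16))) (entry 7 (.var 12) (.var 16))))
    (.const 0))

/-- The value of `derivNeg` for the vertex in register `14` and row `12` of the array `7`. -/
def derivNegExpr : Expr :=
  .sum 16 (.var 0) (select
    (.mul (isZero (.read 1 (.var 16))) (isZero (same (.var 16) (.var 14))))
    (select (entry 0 (.var 14) (.var 16))
      (.mul (.mul (.const 20000) (.var 3)) (entry 7 (.var 12) (.var 16)))
      (.mul (.mul (.const 10000) (.var 3)) (.var 4)))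
    (.const 0))

/-- The value of `roundCoord` for the pivot in register `12` and the vertex in register `14`. -/
def roundCoordExpr : Expr :=
  select (same (.var 14) (.var 12)) (.const 0)
    (select (less derivNegExpr derivPosExpr) (.const 0) (.var 4))

/-- The indicator of the event that the vertices in the registers `17` and `18` are active and
distinct. -/
def activePairExpr : Expr :=
  .mul (isZero (.read 1 (.var 17)))
    (.mul (isZero (.read 1 (.var 18))) (isZero (same (.var 17) (.var 18))))

/-- The value of `stepCost` for the pivot in register `20`. -/
def stepCostExpr : Expr :=
  .sum 17 (.var 0) (.sum 18 (.var 0) (select activePairExpr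
    (select (entry 0 (.var 17) (.var 18))
      (isZero (same (isZero (entry 7 (.var 20) (.var 17))) (isZero (entry 7 (.var 20) (.var 18)))))
      (.mul (isZero (entry 7 (.var 20) (.var 17))) (isZero (entry 7 (.var 20) (.var 18)))))
    (.const 0)))

/-- The value of `stepGain` for the pivot in register `20`. -/
def stepGainExpr : Expr :=
  .sum 17 (.var 0) (.sum 18 (.var 0) (select activePairExpr
    (select (.add (isZero (entry 7 (.var 20) (.var 17))) (isZero (entry 7 (.var 20) (.var 18))))
      (lpTermExpr (.var 17) (.var 18)) (.const 0))
    (.const 0)))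

/-- The indicator of `IsGood` for the pivot in register `20`. -/
def isGoodExpr : Expr :=
  .mul (isZero (.read 1 (.var 20)))
    (isZero (less (.mul (.const 20599) (stepGainExpr))
      (.mul (.mul (.const 10000) (.var 3)) (stepCostExpr))))

/-- The first good pivot, or the number of vertices if there is none. It counts the vertices `w`
such that no vertex up to `w` is good. -/
def pivotExpr : Expr :=
  .sum 19 (.var 0) (isZero (.sum 20 (.add (.var 19) (.const 1)) (isGoodExpr)))

/-- The new label of the vertex in register `14` after the step with the pivot in register `6`. -/
def labelExpr : Expr :=
  select (.mul (isZero (.read 1 (.var 14))) (isZero (entry 7 (.var 6) (.var 14))))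
    (.add (.var 6) (.const 1)) (.read 1 (.var 14))

/-! ### Correctness of the expressions -/

/-- The input and the numbers that depend only on the number of vertices are in place. -/
structure Consts (s : Store) : Prop where
  size : s.reg 0 = n
  scale : s.reg 1 = lpScale n
  rounds : s.reg 2 = lpRounds n
  denom : s.reg 3 = lpDenom n
  prob : s.reg 4 = probDenom n
  adj : HoldsMatrix s 0 fun u v => if G.Adj u v then 1 else 0

variable {G}

theorem Consts.congr {s s' : Store} (h : Consts G s) (hr : ∀ q < 5, s'.reg q = s.reg q)
    (ha : s'.arr 0 = s.arr 0) : Consts G s' where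
  size := (hr 0 (by omega)).trans h.size
  scale := (hr 1 (by omega)).trans h.scale
  rounds := (hr 2 (by omega)).trans h.rounds
  denom := (hr 3 (by omega)).trans h.denom
  prob := (hr 4 (by omega)).trans h.prob
  adj u v := by rw [ha]; exact h.adj u v

theorem HoldsMatrix.congr {s s' : Store} {k : ℕ} {f : Fin n → Fin n → ℕ} (h : HoldsMatrix s k f)
    (ha : s'.arr k = s.arr k) : HoldsMatrix s' k f := fun u v => by rw [ha]; exact h u v

theorem HoldsVector.congr {s s' : Store} {k : ℕ} {f : Fin n → ℕ} (h : HoldsVector s k f)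
    (ha : s'.arr k = s.arr k) : HoldsVector s' k f := fun u => by rw [ha]; exact h u

section Eval

variable {s : Store}

theorem Consts.setReg (hc : Consts G s) {r : ℕ} (hr : 5 ≤ r) (v : ℕ) : Consts G (s.setReg r v) :=
  hc.congr (fun q hq => by rw [Store.reg_setReg, if_neg (by omega)]) rfl

theorem eval_lpStepExpr (hc : Consts G s) {X : Fin n → Fin n → ℕ} (hX : HoldsMatrix s 2 X)
    {u v : Fin n} (hu : s.reg 12 = u) (hv : s.reg 14 = v) :
    lpStepExpr.eval s = lpStep G (lpScale n) X u v := by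
  have ha := hc.adj
  unfold HoldsMatrix at hX ha
  simp only [lpStepExpr, gradNegExpr, gradPosExpr, eval_select, eval_same, eval_least,
    eval_entry, eval_less, eval_isZero, eval, hc.size, hc.scale, ha, hX, hu, hv,
    Store.reg_setReg, Store.arr_setReg, Finset.sum_range]
  simp only [lpStep, gradPos, gradNeg, pow_two, Fin.val_inj]
  by_cases huv : u = v <;> by_cases hadj : G.Adj u v <;> simp [huv, hadj, hX]

theorem eval_totalViolationExpr (hc : Consts G s) {Z : Fin n → Fin n → ℕ}
    (hZ : HoldsMatrix s 4 Z) : totalViolationExpr.eval s = totalViolation Z := by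
  unfold HoldsMatrix at hZ
  simp only [totalViolationExpr, eval_entry, eval, Store.reg_setReg, Store.arr_setReg]
  simp [hc.size, Finset.sum_range, hZ, totalViolation]

theorem eval_lpMatrixExpr (hc : Consts G s)
    (hZ : HoldsMatrix s 4 (lpSum G (lpScale n) (lpRounds n)))
    (h5 : s.reg 5 = totalViolation (lpSum G (lpScale n) (lpRounds n))) {u v : Fin n}
    (hu : s.reg 12 = u) (hv : s.reg 14 = v) : lpMatrixExpr.eval s = lpMatrix G u v := by
  unfold HoldsMatrix at hZ
  simp only [lpMatrixExpr, eval_select, eval_same, eval_least, eval_entry, eval, hc.size, hc.denom,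
    hZ, hu, hv, h5, lpMatrix, repair, Fin.val_inj]
  by_cases huv : u = v <;> simp [huv]

theorem eval_probMatrixExpr (hc : Consts G s) (hY : HoldsMatrix s 5 (lpMatrix G)) {w u : Fin n}
    (hw : s.reg 12 = w) (hu : s.reg 14 = u) : probMatrixExpr.eval s = probMatrix G w u := by
  have ha := hc.adj
  unfold HoldsMatrix at hY ha
  simp only [probMatrixExpr, eval_select, eval_same, eval_least, eval_entry, eval, hc.size,
    hc.denom, hc.prob, hY, ha, hu, hw, probMatrix, Fin.val_inj]
  by_cases huv : u = w <;> by_cases hadj : G.Adj u w <;> simp [huv, hadj]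

theorem eval_lpTermExpr (hc : Consts G s) (hY : HoldsMatrix s 5 (lpMatrix G)) {a b : Expr}
    {u v : Fin n} (hu : a.eval s = u) (hv : b.eval s = v) :
    (lpTermExpr a b).eval s = lpTerm G u v := by
  have ha := hc.adj
  unfold HoldsMatrix at hY ha
  simp only [lpTermExpr, eval_select, eval_entry, eval, hc.size, hc.denom, hY, ha, hu, hv, lpTerm]
  by_cases hadj : G.Adj u v <;> simp [hadj]

theorem eval_roundCoordExpr (hc : Consts G s) (hY : HoldsMatrix s 5 (lpMatrix G))
    {lab q : Fin n → ℕ} (hL : HoldsVector s 1 lab) {w u : Fin n}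
    (hQ : ∀ v : Fin n, s.arr 7 (w * n + v) = q v)
    (hw : s.reg 12 = w) (hu : s.reg 14 = u) :
    roundCoordExpr.eval s = roundCoord G lab q w u := by
  have ha := hc.adj
  unfold HoldsMatrix at ha
  unfold HoldsVector at hL
  have ht : ∀ v : Fin n, (lpTermExpr (.var 14) (.var 16)).eval (s.setReg 16 v) = lpTerm G u v :=
    fun v => eval_lpTermExpr (hc.setReg (by omega) v) hY hu (by simp [eval, Store.reg_setReg])
  have hpos : derivPosExpr.eval s = derivPos G lab q u := by
    simp only [derivPosExpr, eval, hc.size, Finset.sum_range]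
    refine Finset.sum_congr rfl fun v _ => ?_
    simp only [eval_select, eval_same, eval_isZero, eval_entry, eval, ht, Store.reg_setReg,
      Store.arr_setReg]
    by_cases h1 : lab v = 0 <;> by_cases h2 : v = u <;> by_cases h3 : G.Adj u v <;>
      simp [hc.size, hc.denom, hc.prob, hL, hQ, hu, hw, ha, Fin.val_inj, h1, h2, h3]
  have hneg : derivNegExpr.eval s = derivNeg G lab q u := by
    simp only [derivNegExpr, eval, hc.size, Finset.sum_range]
    refine Finset.sum_congr rfl fun v _ => ?_
    simp only [eval_select, eval_same, eval_isZero, eval_entry, eval, Store.reg_setReg,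
      Store.arr_setReg]
    by_cases h1 : lab v = 0 <;> by_cases h2 : v = u <;> by_cases h3 : G.Adj u v <;>
      simp [hc.size, hc.denom, hc.prob, hL, hQ, hu, hw, ha, Fin.val_inj, h1, h2, h3]
  simp only [roundCoordExpr, eval_select, eval_same, eval_less, hpos, hneg, eval, hc.prob, hu, hw,
    roundCoord, Fin.val_inj]
  by_cases h1 : u = w
  · simp [h1]
  · rcases le_or_gt (derivPos G lab q u) (derivNeg G lab q u) with h2 | h2
    · simp [h1, h2, h2.not_gt]
    · simp [h1, h2, h2.not_ge]

open scoped Classical in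
theorem eval_isGoodExpr (hc : Consts G s) (hY : HoldsMatrix s 5 (lpMatrix G))
    {lab : Fin n → ℕ} (hL : HoldsVector s 1 lab) (hQ : HoldsMatrix s 7 (rounded G lab))
    {w : Fin n} (hw : s.reg 20 = w) :
    isGoodExpr.eval s = if IsGood G lab w then 1 else 0 := by
  have ha := hc.adj
  unfold HoldsMatrix at ha hQ
  unfold HoldsVector at hL
  have ht : ∀ u v : Fin n, (lpTermExpr (.var 17) (.var 18)).eval
      ((s.setReg 17 u).setReg 18 v) = lpTerm G u v := fun u v =>
    eval_lpTermExpr ((hc.setReg (by omega) u).setReg (by omega) v) hY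
      (by simp [eval, Store.reg_setReg]) (by simp [eval, Store.reg_setReg])
  have hcost : stepCostExpr.eval s = stepCost G lab w := by
    simp only [stepCostExpr, eval, hc.size, Store.reg_setReg, if_neg (show (0 : ℕ) ≠ 17 by omega),
      Finset.sum_range]
    refine Finset.sum_congr rfl fun u _ => Finset.sum_congr rfl fun v _ => ?_
    simp only [activePairExpr, eval_select, eval_same, eval_isZero, eval_entry, eval,
      Store.reg_setReg, Store.arr_setReg]
    by_cases h1 : lab u = 0 <;> by_cases h2 : lab v = 0 <;> by_cases h3 : u = v <;>
      by_cases h4 : G.Adj u v <;> by_cases h5 : rounded G lab w u = 0 <;>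
      by_cases h6 : rounded G lab w v = 0 <;>
      simp [hc.size, hL, hQ, hw, ha, Fin.val_inj, h1, h2, h3, h4, h5, h6]
  have hgain : stepGainExpr.eval s = stepGain G lab w := by
    simp only [stepGainExpr, eval, hc.size, Store.reg_setReg, if_neg (show (0 : ℕ) ≠ 17 by omega),
      Finset.sum_range]
    refine Finset.sum_congr rfl fun u _ => Finset.sum_congr rfl fun v _ => ?_
    simp only [activePairExpr, eval_select, eval_same, eval_isZero, eval_entry, eval, ht,
      Store.reg_setReg, Store.arr_setReg]
    by_cases h1 : lab u = 0 <;> by_cases h2 : lab v = 0 <;> by_cases h3 : u = v <;>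
      by_cases h5 : rounded G lab w u = 0 <;> by_cases h6 : rounded G lab w v = 0 <;>
      simp [hc.size, hL, hQ, hw, Fin.val_inj, h1, h2, h3, h5, h6]
  simp only [isGoodExpr, eval_isZero, eval_less, eval, hcost, hgain, hw, hL, hc.denom, IsGood]
  by_cases h1 : lab w = 0
  · rcases le_or_gt (10000 * lpDenom n * stepCost G lab w) (20599 * stepGain G lab w) with h2 | h2
    · simp [h1, h2, h2.not_gt]
    · simp [h1, h2, h2.not_ge]
  · simp [h1]

theorem eval_pivotExpr_le (hc : Consts G s) : pivotExpr.eval s ≤ n := by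
  simp only [pivotExpr, isZero, eval, hc.size]
  calc _ ≤ ∑ i ∈ Finset.range n, 1 := Finset.sum_le_sum fun i _ => Nat.sub_le 1 _
    _ = n := by simp

theorem eval_pivotExpr (hc : Consts G s) (hY : HoldsMatrix s 5 (lpMatrix G))
    {lab : Fin n → ℕ} (hL : HoldsVector s 1 lab) (hQ : HoldsMatrix s 7 (rounded G lab))
    (h : ∃ w, IsGood G lab w) : ∃ w, IsGood G lab w ∧ pivotExpr.eval s = w := by
  classical
  have hex : ∃ j, ∃ hj : j < n, IsGood G lab ⟨j, hj⟩ := by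
    obtain ⟨w, hw⟩ := h
    exact ⟨w, w.2, hw⟩
  obtain ⟨hj, hgood⟩ := Nat.find_spec hex
  refine ⟨⟨Nat.find hex, hj⟩, hgood, ?_⟩
  have hinner : ∀ i < n, (∑ j ∈ Finset.range (i + 1),
      isGoodExpr.eval ((s.setReg 19 i).setReg 20 j)) = 0 ↔ i < Nat.find hex := by
    intro i hi
    rw [Finset.sum_eq_zero_iff, Nat.lt_find_iff]
    have hev : ∀ j : Fin n, isGoodExpr.eval ((s.setReg 19 i).setReg 20 j) =
        if IsGood G lab j then 1 else 0 := fun j =>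
      eval_isGoodExpr ((hc.setReg (by omega) i).setReg (by omega) j) hY hL hQ
        (by simp [Store.reg_setReg])
    constructor
    · rintro h m hm ⟨hmn, hg⟩
      have h1 := h m (Finset.mem_range.2 (by omega))
      have h2 := hev ⟨m, hmn⟩
      rw [if_pos hg] at h2
      change isGoodExpr.eval ((s.setReg 19 i).setReg 20 m) = 1 at h2
      omega
    · intro h m hm
      have hm' := Finset.mem_range.1 hm
      have h2 := hev ⟨m, by omega⟩
      rw [if_neg fun hg => h m (by omega) ⟨by omega, hg⟩] at h2
      exact h2
  have e : pivotExpr.eval s = ∑ i ∈ Finset.range n, if i < Nat.find hex then 1 else 0 := by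
    simp only [pivotExpr, eval_isZero, eval, hc.size]
    refine Finset.sum_congr rfl fun i hi => ?_
    simp only [Store.reg_setReg, if_true]
    simp only [hinner i (Finset.mem_range.1 hi)]
  rw [e, ← Finset.card_filter]
  have : (Finset.range n).filter (fun i => i < Nat.find hex) = Finset.range (Nat.find hex) := by
    ext i
    simp only [Finset.mem_filter, Finset.mem_range]
    omega
  rw [this, Finset.card_range]

theorem eval_labelExpr (hc : Consts G s) {lab : Fin n → ℕ} {v : Fin n} (hL : s.arr 1 v = lab v)
    (hv : s.reg 14 = v) : labelExpr.eval s =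
      if lab v = 0 ∧ s.arr 7 (s.reg 6 * n + v) = 0 then s.reg 6 + 1 else lab v := by
  simp only [labelExpr, eval_select, eval_isZero, eval_entry, eval, hv, hL, hc.size]
  by_cases h1 : lab v = 0 <;> by_cases h2 : s.arr 7 (s.reg 6 * n + v) = 0 <;> simp [h1, h2]

end Eval

end Program

/-! ### The program and its running time -/

section Algorithm

open CorrClust.Expr

/-- The value of `lpScale`. -/
def lpScaleExpr : Expr :=
  .mul (.mul (.const 25000) (.mul (.var 0) (.var 0)))
    (.mul (.add (.const 1) (.mul (.const 2) (.mul (.mul (.var 0) (.var 0)) (.var 0))))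
      (.add (.const 1) (.mul (.const 2) (.mul (.mul (.var 0) (.var 0)) (.var 0)))))

/-- The value of `lpRounds`. -/
def lpRoundsExpr : Expr := .mul (.mul (.const 25000) (.mul (.var 0) (.var 0))) (.var 1)

/-- The value of `lpDenom`. -/
def lpDenomExpr : Expr := .mul (.var 2) (.var 1)

/-- The value of `probDenom`. -/
def probDenomExpr : Expr := .mul (.mul (.const 3195) (.var 3)) (.mul (.const 3195) (.var 3))

/-- The computation of the numbers that depend only on the number of vertices. -/
def setupProgram : Program :=
  .seq (assign 1 lpScaleExpr) (.seq (assign 2 lpRoundsExpr)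
    (.seq (assign 3 lpDenomExpr) (assign 4 probDenomExpr)))

/-- The running time of `setupProgram`, in terms of a bound on the memory. -/
def setupTime : Polynomial ℕ :=
  lpScaleExpr.bound + 2 + (lpRoundsExpr.bound + 2 + (lpDenomExpr.bound + 2 +
    (probDenomExpr.bound + 2)))

/-- One iteration of the subgradient method. -/
def lpBody : Program :=
  .seq (fillMatrix 4 (.add (entry 4 (.var 12) (.var 14)) (entry 2 (.var 12) (.var 14))))
    (.seq (fillMatrix 3 lpStepExpr) (fillMatrix 2 (entry 3 (.var 12) (.var 14))))

/-- The running time of `lpBody`, in terms of a bound on the memory. -/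
def lpBodyTime : Polynomial ℕ :=
  fillMatrixBound (.add (entry 4 (.var 12) (.var 14)) (entry 2 (.var 12) (.var 14))) +
    (fillMatrixBound lpStepExpr + fillMatrixBound (entry 3 (.var 12) (.var 14)))

/-- The computation of the cut probabilities. -/
def probProgram : Program :=
  .seq (assign 5 totalViolationExpr) (.seq (fillMatrix 5 lpMatrixExpr) (fillMatrix 6 probMatrixExpr))

/-- The running time of `probProgram`, in terms of a bound on the memory. -/
def probTime : Polynomial ℕ :=
  totalViolationExpr.bound + 2 + (fillMatrixBound lpMatrixExpr + fillMatrixBound probMatrixExpr)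

/-- One step of the rounding algorithm. -/
def roundBody : Program :=
  .seq (fillMatrix 7 (entry 6 (.var 12) (.var 14))) (.seq (fillMatrix 7 roundCoordExpr)
    (.seq (assign 6 pivotExpr) (fillVector 1 labelExpr)))

/-- The running time of `roundBody`, in terms of a bound on the memory. -/
def roundBodyTime : Polynomial ℕ :=
  fillMatrixBound (entry 6 (.var 12) (.var 14)) + (fillMatrixBound roundCoordExpr +
    (pivotExpr.bound + 2 + fillVectorBound labelExpr))

/-- The deterministic algorithm. Register `0` contains the number of vertices, the registers `1` to
`4` contain `lpScale`, `lpRounds`, `lpDenom` and `probDenom`, register `5` the total violation, and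
register `6` the pivot. Array `0` contains the adjacency matrix, array `1` the labels, the arrays
`2` and `3` the current and the next iterate of the subgradient method, array `4` the sum of the
iterates, array `5` the approximate solution of the linear program, array `6` the cut probabilities,
and array `7` the rounded probabilities, with one row for each pivot. -/
def mainProgram : Program :=
  .seq setupProgram (.seq (forLoop 10 (.var 2) lpBody)
    (.seq probProgram (forLoop 10 (.var 0) roundBody)))

open Polynomial in
/-- `lpScale` as a polynomial. -/
def lpScalePoly : ℕ[X] := 25000 * X ^ 2 * (1 + 2 * X ^ 3) ^ 2

open Polynomial in
/-- `lpRounds` as a polynomial. -/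
def lpRoundsPoly : ℕ[X] := 25000 * X ^ 2 * lpScalePoly

/-- A bound on all numbers in the memory, in terms of the number of vertices. -/
def memBound : Polynomial ℕ :=
  Polynomial.X + lpScalePoly + lpRoundsPoly + (Polynomial.X ^ 3 + 1) * (lpRoundsPoly * lpScalePoly)
    + (3195 * (lpRoundsPoly * lpScalePoly)) * (3195 * (lpRoundsPoly * lpScalePoly)) + 1

/-- The running time of `mainProgram`, in terms of the number of vertices. -/
def mainTime : Polynomial ℕ :=
  (setupTime + (loopBound (.var 2) lpBodyTime + (probTime + loopBound (.var 0) roundBodyTime))).comp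
    memBound

theorem eval_memBound (n : ℕ) : memBound.eval n = n + lpScale n + lpRounds n
    + (n ^ 3 + 1) * lpDenom n + probDenom n + 1 := by
  simp [memBound, lpRoundsPoly, lpScalePoly, lpDenom, lpRounds, lpScale, probDenom]

end Algorithm

/-! ### Correctness of the program -/

section Correctness

open CorrClust.Expr

variable {n : ℕ} {G : SimpleGraph (Fin n)} [DecidableRel G.Adj]

/-- All variables other than the counters of the outer loops contain bounded numbers. -/
structure BoundedOff (B : ℕ) (s : Store) : Prop where
  reg : ∀ q < 40, q ≠ 10 → q ≠ 11 → s.reg q ≤ B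
  arr : ∀ k i, s.arr k i ≤ B

theorem BoundedOff.bounded {B : ℕ} {s : Store} (h : BoundedOff B s) (h10 : s.reg 10 ≤ B)
    (h11 : s.reg 11 ≤ B) : Bounded 40 B s where
  reg q hq := by
    by_cases h1 : q = 10
    · rw [h1]; exact h10
    by_cases h2 : q = 11
    · rw [h2]; exact h11
    exact h.reg q hq h1 h2
  arr := h.arr

theorem Bounded.off {B : ℕ} {s : Store} (h : Bounded 40 B s) : BoundedOff B s :=
  ⟨fun q hq _ _ => h.reg q hq, h.arr⟩

theorem BoundedOff.congr {B : ℕ} {s s' : Store} (h : BoundedOff B s) (hr : AgreeOff [10, 11] s s')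
    (ha : s'.arr = s.arr) : BoundedOff B s' where
  reg q hq h1 h2 := by
    rw [hr q hq (by simp [h1, h2])]; exact h.reg q hq h1 h2
  arr k i := by rw [ha]; exact h.arr k i

theorem Bounded.of_agreeOff {B r : ℕ} {s s' : Store} (h : Bounded 40 B s) (hr : AgreeOff [r] s s')
    (hB : s'.reg r ≤ B) (ha : s'.arr = s.arr) : Bounded 40 B s' where
  reg q hq := by
    by_cases h1 : q = r
    · rw [h1]; exact hB
    · rw [hr q hq (by simp [h1])]; exact h.reg q hq
  arr k i := by rw [ha]; exact h.arr k i

/-- The state of the memory after `t` iterations of the subgradient method. -/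
structure LPInv (G : SimpleGraph (Fin n)) [DecidableRel G.Adj] (t : ℕ) (s : Store) : Prop where
  consts : Consts G s
  bounded : BoundedOff (memBound.eval n) s
  iter : HoldsMatrix s 2 (lpIter G (lpScale n) t)
  total : HoldsMatrix s 4 (lpSum G (lpScale n) t)
  labels : HoldsVector s 1 fun _ : Fin n => 0

/-- The state of the memory after `t` steps of the rounding algorithm. -/
structure RoundingInv (G : SimpleGraph (Fin n)) [DecidableRel G.Adj] (t : ℕ) (s : Store) :
    Prop where
  consts : Consts G s
  bounded : BoundedOff (memBound.eval n) s
  lp : HoldsMatrix s 5 (lpMatrix G)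
  prob : HoldsMatrix s 6 (probMatrix G)
  labels : ∃ lab, RoundInv G t lab ∧ HoldsVector s 1 lab

theorem inputStore_bounded : Bounded 40 (memBound.eval n) (inputStore G) := by
  rw [eval_memBound]
  constructor
  · intro r _
    simp only [inputStore]
    split_ifs <;> omega
  · intro k i
    simp only [inputStore]
    split_ifs <;> omega

theorem inputStore_adj : HoldsMatrix (inputStore G) 0 fun u v => if G.Adj u v then 1 else 0 := by
  intro u v
  have : (∃ u' v' : Fin n, G.Adj u' v' ∧ (u : ℕ) * n + v = u' * n + v') ↔ G.Adj u v := by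
    constructor
    · rintro ⟨u', v', h, he⟩
      obtain ⟨rfl, rfl⟩ := index_inj he
      exact h
    · exact fun h => ⟨u, v, h, rfl⟩
  simp only [inputStore, true_and, this]

theorem HT.setup {Q : Store → Prop} (h : ∀ s, LPInv G 0 s → Bounded 40 (memBound.eval n) s → Q s) :
    HT setupProgram (setupTime.eval (memBound.eval n)) (inputStore G) Q := by
  set B := memBound.eval n with hB
  have hmem := eval_memBound n
  rw [← hB] at hmem
  have hK : lpDenom n ≤ (n ^ 3 + 1) * lpDenom n := Nat.le_mul_of_pos_left _ (by positivity)
  simp only [setupTime, Polynomial.eval_add, Polynomial.eval_ofNat]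
  refine HT.seq (HT.assign (by decide) inputStore_bounded fun s₁ e1 a1 r1 => ?_)
  · have z1 : s₁.reg 0 = n := a1 0 (by omega) (by simp)
    have v1 : s₁.reg 1 = lpScale n := by
      rw [e1]; simp only [lpScaleExpr, eval, inputStore, if_true, lpScale]; ring
    have b1 : Bounded 40 B s₁ := inputStore_bounded.of_agreeOff a1 (by omega) r1
    refine HT.seq (HT.assign (by decide) b1 fun s₂ e2 a2 r2 => ?_)
    have z2 : s₂.reg 0 = n := (a2 0 (by omega) (by simp)).trans z1
    have w2 : s₂.reg 1 = lpScale n := (a2 1 (by omega) (by simp)).trans v1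
    have v2 : s₂.reg 2 = lpRounds n := by
      rw [e2]; simp only [lpRoundsExpr, eval, z1, v1, lpRounds]; ring
    have b2 : Bounded 40 B s₂ := b1.of_agreeOff a2 (by omega) r2
    refine HT.seq (HT.assign (by decide) b2 fun s₃ e3 a3 r3 => ?_)
    have v3 : s₃.reg 3 = lpDenom n := by
      rw [e3]; simp only [lpDenomExpr, eval, w2, v2, lpDenom]
    have b3 : Bounded 40 B s₃ := b2.of_agreeOff a3 (by omega) r3
    refine HT.assign (by decide) b3 fun s₄ e4 a4 r4 => ?_
    have v4 : s₄.reg 4 = probDenom n := by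
      rw [e4]; simp only [probDenomExpr, eval, v3, probDenom]
    have b4 : Bounded 40 B s₄ := b3.of_agreeOff a4 (by omega) r4
    have harr : s₄.arr = (inputStore G).arr := by rw [r4, r3, r2, r1]
    have hzero : ∀ k i, k ≠ 0 → s₄.arr k i = 0 := by
      intro k i hk
      rw [harr]
      exact if_neg fun h => hk h.1
    refine h s₄ ⟨⟨?_, ?_, ?_, ?_, v4, ?_⟩, b4.off, fun u v => hzero _ _ (by omega),
      fun u v => (hzero _ _ (by omega)).trans (by simp [lpSum]), fun v => hzero _ _ (by omega)⟩ b4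
    · rw [a4 0 (by omega) (by simp), a3 0 (by omega) (by simp), z2]
    · rw [a4 1 (by omega) (by simp), a3 1 (by omega) (by simp), w2]
    · rw [a4 2 (by omega) (by simp), a3 2 (by omega) (by simp), v2]
    · rw [a4 3 (by omega) (by simp), v3]
    · exact inputStore_adj.congr (by rw [harr])

theorem HT.lpBody {t : ℕ} {s : Store} (h : LPInv G t s) (hB : Bounded 40 (memBound.eval n) s)
    (ht : t < lpRounds n) {Q : Store → Prop}
    (hQ : ∀ s', LPInv G (t + 1) s' → s'.reg 10 = s.reg 10 → s'.reg 11 = s.reg 11 → Q s') :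
    HT CorrClust.lpBody (lpBodyTime.eval (memBound.eval n)) s Q := by
  set B := memBound.eval n with hB'
  have hmem := eval_memBound n
  rw [← hB'] at hmem
  have hK : lpDenom n ≤ (n ^ 3 + 1) * lpDenom n := Nat.le_mul_of_pos_left _ (by positivity)
  simp only [lpBodyTime, Polynomial.eval_add]
  refine HT.seq (HT.fillMatrix_fin (by decide) hB h.consts.size
    (lpSum G (lpScale n) (t + 1)) (fun u v => ?_) (fun u v s' a1 hu hv har hk => ?_)
    fun s₁ b1 a1 r1 m1 => ?_)
  rotate_left 2
  · have c1 : Consts G s₁ := h.consts.congr (fun q hq => a1 q (by omega) (by simp; omega))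
      (r1 0 (by omega))
    refine HT.seq (HT.fillMatrix_fin (by decide) b1 c1.size (lpIter G (lpScale n) (t + 1))
      (fun u v => ?_) (fun u v s' a2 hu hv har hk => ?_) fun s₂ b2 a2 r2 m2 => ?_)
    · have := lpIter_le G (lpScale n) (t + 1) u v
      omega
    · exact eval_lpStepExpr (c1.congr (fun q hq => a2 q (by omega) (by simp; omega))
        (har 0 (by omega))) (h.iter.congr ((har 2 (by omega)).trans (r1 2 (by omega)))) hu hv
    · have c2 : Consts G s₂ := c1.congr (fun q hq => a2 q (by omega) (by simp; omega))
        (r2 0 (by omega))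
      refine HT.fillMatrix_fin (by decide) b2 c2.size (lpIter G (lpScale n) (t + 1))
        (fun u v => ?_) (fun u v s' a3 hu hv har hk => ?_) fun s₃ b3 a3 r3 m3 => ?_
      · have := lpIter_le G (lpScale n) (t + 1) u v
        omega
      · rw [eval_entry, har 3 (by omega)]
        simp only [eval, hu, hv, a3 0 (by omega) (by simp), c2.size]
        exact m2 u v
      · refine hQ s₃ ⟨c2.congr (fun q hq => a3 q (by omega) (by simp; omega)) (r3 0 (by omega)),
          b3.off, m3, m1.congr ((r3 4 (by omega)).trans (r2 4 (by omega))), h.labels.congr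
          ((r3 1 (by omega)).trans ((r2 1 (by omega)).trans (r1 1 (by omega))))⟩ ?_ ?_
        · rw [a3 10 (by omega) (by simp), a2 10 (by omega) (by simp), a1 10 (by omega) (by simp)]
        · rw [a3 11 (by omega) (by simp), a2 11 (by omega) (by simp), a1 11 (by omega) (by simp)]
  · have h1 := lpSum_le G (lpScale n) (t + 1) u v
    have h2 : (t + 1) * lpScale n ≤ lpDenom n := Nat.mul_le_mul_right _ ht
    omega
  · simp only [eval, eval_entry, hu, hv, a1 0 (by omega) (by simp), h.consts.size,
      har 2 (by omega), h.iter u v, hk u v]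
    rw [if_neg (by simp), h.total u v, lpSum, lpSum, Finset.sum_range_succ]

theorem HT.lpLoop {s : Store} (h : LPInv G 0 s) (hB : Bounded 40 (memBound.eval n) s)
    {Q : Store → Prop} (hQ : ∀ s', LPInv G (lpRounds n) s' → Bounded 40 (memBound.eval n) s' → Q s') :
    HT (CorrClust.forLoop 10 (.var 2) CorrClust.lpBody)
      ((loopBound (.var 2) lpBodyTime).eval (memBound.eval n)) s Q := by
  have hmem := eval_memBound n
  refine (HT.forLoop (b := .var 2) (N := lpRounds n) (LPInv G) (by omega) (by decide) hB h.consts.rounds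
    (by omega) (fun i s₁ s₂ hi ha har => ?_) h (fun i hi s₁ h1 h2 h3 => ?_)).mono le_rfl
    fun s' hs' => ?_
  · exact ⟨hi.consts.congr (fun q hq => ha q (by omega) (by simp; omega)) (by rw [har]),
      hi.bounded.congr ha har, hi.iter.congr (by rw [har]), hi.total.congr (by rw [har]),
      hi.labels.congr (by rw [har])⟩
  · replace h3 : s₁.reg 11 = lpRounds n - i := h3
    refine HT.lpBody h1 (h1.bounded.bounded (by omega) (by omega)) hi fun s' i1 i2 i3 => ?_
    exact ⟨i1, i2.trans h2, i3.trans h3⟩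
  · obtain ⟨i1, i2, i3⟩ := hs'
    replace i3 : s'.reg 11 = 0 := i3
    exact hQ s' i1 (i1.bounded.bounded (by omega) (by omega))

theorem totalViolation_le {K : ℕ} {Z : Fin n → Fin n → ℕ} (hZ : ∀ u v, Z u v ≤ K) :
    totalViolation Z ≤ n ^ 3 * K := by
  unfold totalViolation
  calc _ ≤ ∑ _u : Fin n, ∑ _v : Fin n, ∑ _w : Fin n, K :=
        Finset.sum_le_sum fun u _ => Finset.sum_le_sum fun v _ => Finset.sum_le_sum fun w _ =>
          (Nat.sub_le _ _).trans (hZ u w)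
    _ = n ^ 3 * K := by simp; ring

theorem HT.prob {s : Store} (h : LPInv G (lpRounds n) s) (hB : Bounded 40 (memBound.eval n) s)
    {Q : Store → Prop} (hQ : ∀ s', RoundingInv G 0 s' → Bounded 40 (memBound.eval n) s' → Q s') :
    HT probProgram (probTime.eval (memBound.eval n)) s Q := by
  set B := memBound.eval n with hB'
  have hmem := eval_memBound n
  rw [← hB'] at hmem
  have hK : (n ^ 3 + 1) * lpDenom n = n ^ 3 * lpDenom n + lpDenom n := by ring
  simp only [probTime, Polynomial.eval_add, Polynomial.eval_ofNat]
  refine HT.seq (HT.assign (by decide) hB fun s₁ e1 a1 r1 => ?_)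
  · rw [eval_totalViolationExpr h.consts h.total] at e1
    have hV := totalViolation_le (lpSum_le G (lpScale n) (lpRounds n))
    have b1 : Bounded 40 B s₁ := hB.of_agreeOff a1 (by
      rw [e1]; change _ ≤ n ^ 3 * lpDenom n at hV; omega) r1
    have c1 : Consts G s₁ := h.consts.congr (fun q hq => a1 q (by omega) (by simp; omega))
      (by rw [r1])
    refine HT.seq (HT.fillMatrix_fin (by decide) b1 c1.size (lpMatrix G)
      (fun u v => ?_) (fun u v s' a2 hu hv har hk => ?_) fun s₂ b2 a2 r2 m2 => ?_)
    · have := lpMatrix_le G u v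
      omega
    · exact eval_lpMatrixExpr (c1.congr (fun q hq => a2 q (by omega) (by simp; omega))
        (har 0 (by omega))) (h.total.congr ((har 4 (by omega)).trans (by rw [r1])))
        ((a2 5 (by omega) (by simp)).trans e1) hu hv
    · have c2 : Consts G s₂ := c1.congr (fun q hq => a2 q (by omega) (by simp; omega))
        (r2 0 (by omega))
      refine HT.fillMatrix_fin (by decide) b2 c2.size (probMatrix G)
        (fun u v => ?_) (fun u v s' a3 hu hv har hk => ?_) fun s₃ b3 a3 r3 m3 => ?_
      · have := probMatrix_le G u v
        omega
      · exact eval_probMatrixExpr (c2.congr (fun q hq => a3 q (by omega) (by simp; omega))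
          (har 0 (by omega))) (m2.congr (har 5 (by omega))) hu hv
      · exact hQ s₃ ⟨c2.congr (fun q hq => a3 q (by omega) (by simp; omega)) (r3 0 (by omega)),
          b3.off, m2.congr (r3 5 (by omega)), m3, _, RoundInv.zero G,
          h.labels.congr ((r3 1 (by omega)).trans ((r2 1 (by omega)).trans (by rw [r1])))⟩ b3

theorem HT.roundBody {t : ℕ} {s : Store} (h : RoundingInv G t s)
    (hB : Bounded 40 (memBound.eval n) s) {Q : Store → Prop} (hn : 0 < n)
    (hQ : ∀ s', RoundingInv G (t + 1) s' → s'.reg 10 = s.reg 10 → s'.reg 11 = s.reg 11 → Q s') :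
    HT CorrClust.roundBody (roundBodyTime.eval (memBound.eval n)) s Q := by
  set B := memBound.eval n with hB'
  have hmem := eval_memBound n
  rw [← hB'] at hmem
  obtain ⟨lab, hlab, hL⟩ := h.labels
  simp only [roundBodyTime, Polynomial.eval_add, Polynomial.eval_ofNat]
  refine HT.seq (HT.fillMatrix_fin (by decide) hB h.consts.size
    (probMatrix G) (fun u v => ?_) (fun u v s' a1 hu hv har hk => ?_)
    fun s₁ b1 a1 r1 m1 => ?_)
  rotate_left 2
  · have c1 : Consts G s₁ := h.consts.congr (fun q hq => a1 q (by omega) (by simp; omega))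
      (r1 0 (by omega))
    refine HT.seq (HT.fillMatrix_fin (by decide) b1 c1.size (rounded G lab)
      (fun u v => ?_) (fun w u s' a2 hw hu har hk => ?_) fun s₂ b2 a2 r2 m2 => ?_)
    · have := rounded_le G lab u v
      omega
    · rw [rounded_eq]
      refine eval_roundCoordExpr (c1.congr (fun q hq => a2 q (by omega) (by simp; omega))
        (har 0 (by omega))) (h.lp.congr ((har 5 (by omega)).trans (r1 5 (by omega))))
        (hL.congr ((har 1 (by omega)).trans (r1 1 (by omega)))) (fun v => ?_) hw hu
      rw [hk w v, ← m1 w v]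
      simp
    · have c2 : Consts G s₂ := c1.congr (fun q hq => a2 q (by omega) (by simp; omega))
        (r2 0 (by omega))
      have hL2 : HoldsVector s₂ 1 lab := hL.congr ((r2 1 (by omega)).trans (r1 1 (by omega)))
      have hY2 : HoldsMatrix s₂ 5 (lpMatrix G) :=
        h.lp.congr ((r2 5 (by omega)).trans (r1 5 (by omega)))
      refine HT.seq (HT.assign (by decide) b2 fun s₃ e3 a3 r3 => ?_)
      have hp : s₃.reg 6 ≤ n := e3 ▸ eval_pivotExpr_le c2
      have b3 : Bounded 40 B s₃ := b2.of_agreeOff a3 (by omega) r3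
      have c3 : Consts G s₃ := c2.congr (fun q hq => a3 q (by omega) (by simp; omega))
        (by rw [r3])
      have hlab' : ∃ lab', RoundInv G (t + 1) lab' ∧ ∀ v : Fin n, lab' v =
          if lab v = 0 ∧ s₃.arr 7 (s₃.reg 6 * n + v) = 0 then s₃.reg 6 + 1 else lab v := by
        by_cases hA : (active lab).Nonempty
        · obtain ⟨w, hw, hew⟩ := eval_pivotExpr c2 hY2 hL2 m2 (exists_isGood G hn hA)
          refine ⟨_, hlab.step G hn hw fun v => ?_, fun v => rfl⟩
          rw [e3, hew, r3, m2 w v]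
        · refine ⟨lab, ⟨hlab.le, hlab.fresh, ?_, hlab.paid⟩, fun v => ?_⟩
          · rw [Finset.not_nonempty_iff_eq_empty.1 hA]
            exact Nat.zero_le _
          · rw [if_neg fun hv => hA ⟨v, mem_active.2 hv.1⟩]
      obtain ⟨lab', hinv, hval⟩ := hlab'
      refine HT.fillVector_fin (by decide) b3 c3.size lab' (fun v => ?_)
        (fun v s' a4 hv har hk => ?_) fun s₄ b4 a4 r4 m4 => ?_
      · have := hinv.le v
        omega
      · rw [hval, eval_labelExpr (c3.congr (fun q hq => a4 q (by omega) (by simp; omega))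
          (har 0 (by omega))) (lab := lab) (hk.trans (by rw [r3]; exact hL2 v)) hv,
          a4 6 (by omega) (by simp), har 7 (by omega)]
      · refine hQ s₄ ⟨c3.congr (fun q hq => a4 q (by omega) (by simp; omega)) (r4 0 (by omega)),
          b4.off, hY2.congr ((r4 5 (by omega)).trans (by rw [r3])),
          h.prob.congr ((r4 6 (by omega)).trans ((by rw [r3] : s₃.arr 6 = s₂.arr 6).trans
            ((r2 6 (by omega)).trans (r1 6 (by omega))))), lab', hinv, m4⟩ ?_ ?_
        · rw [a4 10 (by omega) (by simp), a3 10 (by omega) (by simp), a2 10 (by omega) (by simp),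
            a1 10 (by omega) (by simp)]
        · rw [a4 11 (by omega) (by simp), a3 11 (by omega) (by simp), a2 11 (by omega) (by simp),
            a1 11 (by omega) (by simp)]
  · have := probMatrix_le G u v
    omega
  · simp only [eval, eval_entry, hu, hv, a1 0 (by omega) (by simp), h.consts.size,
      har 6 (by omega), h.prob u v]

theorem HT.roundLoop {s : Store} (h : RoundingInv G 0 s) (hB : Bounded 40 (memBound.eval n) s) :
    HT (CorrClust.forLoop 10 (.var 0) CorrClust.roundBody)
      ((loopBound (.var 0) roundBodyTime).eval (memBound.eval n)) s (RoundingInv G n) := by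
  have hmem := eval_memBound n
  refine (HT.forLoop (b := .var 0) (N := n) (RoundingInv G) (by omega) (by decide) hB h.consts.size
    (by omega) (fun i s₁ s₂ hi ha har => ?_) h (fun i hi s₁ h1 h2 h3 => ?_)).mono le_rfl
    fun s' hs' => hs'.1
  · obtain ⟨lab, h1, h2⟩ := hi.labels
    exact ⟨hi.consts.congr (fun q hq => ha q (by omega) (by simp; omega)) (by rw [har]),
      hi.bounded.congr ha har, hi.lp.congr (by rw [har]), hi.prob.congr (by rw [har]),
      lab, h1, h2.congr (by rw [har])⟩
  · replace h3 : s₁.reg 11 = n - i := h3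
    refine HT.roundBody h1 (h1.bounded.bounded (by omega) (by omega)) (by omega)
      fun s' i1 i2 i3 => ?_
    exact ⟨i1, i2.trans h2, i3.trans h3⟩

/-- The algorithm halts within polynomial time, and all vertices have been clustered. -/
theorem mainProgram_spec : HT mainProgram (mainTime.eval n) (inputStore G) (RoundingInv G n) := by
  refine HT.le (HT.seq (HT.setup fun s₁ h1 b1 => HT.seq (HT.lpLoop h1 b1 fun s₂ h2 b2 =>
    HT.seq (HT.prob h2 b2 fun s₃ h3 b3 => HT.roundLoop h3 b3)))) ?_
  simp [mainTime]

/-- The guarantee of the algorithm, including the trivial case of no vertices. -/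
theorem RoundingInv.ratio {s : Store} (h : RoundingInv G n s) {x : Sym2 (Fin n) → I}
    (hx : IsFeasible x) :
    (numViolated G (TogetherInLabels (outputLabels n s)) : ℝ) ≤ 2.05995 * lpCost G x := by
  obtain ⟨lab, hlab, hL⟩ := h.labels
  have e : outputLabels n s = lab := funext hL
  rw [e]
  rcases Nat.eq_zero_or_pos n with rfl | hn
  · have h1 := two_mul_numViolated G (TogetherInLabels lab)
    have h2 := two_mul_lpCost G x
    simp only [pairSum, Finset.univ_eq_empty, Finset.sum_empty] at h1 h2
    linarith
  · exact hlab.ratio G hn hx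

end Correctness

end CorrClust

end

theorem mainTheorem1 :
    ∃ ε : ℝ, 0 < ε ∧ ε < 0.01 ∧
      -- the randomized rounding algorithm
      (∀ (V : Type u) [Fintype V] [DecidableEq V] (G : SimpleGraph V) [DecidableRel G.Adj]
          (x : Sym2 V → unitInterval), IsFeasible x →
        (∀ L ∈ (pivotRounding G fPlus fMinus x).support, IsClustering L) ∧
        expectedViolated G (pivotRounding G fPlus fMinus x) ≤
          ENNReal.ofReal ((2.06 - ε) * lpCost G x) ∧
        ((∀ y : Sym2 V → unitInterval, IsFeasible y → lpCost G x ≤ lpCost G y) →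
          ∀ c : V → ℕ, expectedViolated G (pivotRounding G fPlus fMinus x) ≤
            ENNReal.ofReal ((2.06 - ε) * numViolated G (TogetherInLabels c)))) ∧
      -- the deterministic polynomial-time algorithm
      ∃ (P : Program) (q : Polynomial ℕ),
        ∀ (n : ℕ) (G : SimpleGraph (Fin n)) [DecidableRel G.Adj],
          ∃ (t : ℕ) (s : Store), Runs P (inputStore G) t s ∧ t ≤ q.eval n ∧
            (∀ x : Sym2 (Fin n) → unitInterval, IsFeasible x →
              (numViolated G (TogetherInLabels (outputLabels n s)) : ℝ) ≤
                (2.06 - ε) * lpCost G x) ∧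
            ∀ c : Fin n → ℕ,
              (numViolated G (TogetherInLabels (outputLabels n s)) : ℝ) ≤
                (2.06 - ε) * numViolated G (TogetherInLabels c) := by
  refine ⟨0.00005, by norm_num, by norm_num, fun V _ _ G _ x hx => ?_, mainProgram, mainTime,
    fun n G _ => ?_⟩
  · have h0 : 0 ≤ lpCost G x := lpCost_nonneg G x
    have h1 : expectedViolated G (pivotRounding G fPlus fMinus x) ≤
        ENNReal.ofReal ((2.06 - 0.00005) * lpCost G x) :=
      (expectedViolated_le G hx).trans (ENNReal.ofReal_le_ofReal (by linarith))
    refine ⟨fun L hL => isClustering_of_mem_support G hx hL, h1, fun hopt c => ?_⟩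
    obtain ⟨y, hy, hyc⟩ := exists_feasible_of_labels G c
    refine h1.trans (ENNReal.ofReal_le_ofReal ?_)
    rw [← hyc]
    exact mul_le_mul_of_nonneg_left (hopt y hy) (by norm_num)
  · obtain ⟨t, s, hrun, ht, hs⟩ := mainProgram_spec (G := G)
    have h1 : ∀ x : Sym2 (Fin n) → unitInterval, IsFeasible x →
        (numViolated G (TogetherInLabels (outputLabels n s)) : ℝ) ≤
          (2.06 - 0.00005) * lpCost G x := fun x hx => (hs.ratio hx).trans_eq (by norm_num)
    refine ⟨t, s, hrun, ht, h1, fun c => ?_⟩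
    obtain ⟨y, hy, hyc⟩ := exists_feasible_of_labels G c
    rw [← hyc]
    exact h1 y hy
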